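/- **Setting.** Let $\mathcal P$ be a unitary symmetric set-operad: sets $\mathcal P(n)$, $n\ge 0$, with right actions of the symmetric groups, a unit $1\in\mathcal P(1)$, associative, unital and equivariant compositions $\gamma(c;d_1,\dots,d_n)$, and $\mathcal P(0)=\{0\}$. Write $\underline n=\{1,\dots,n\}$. The category $\mathcal S(\mathcal P)$ has the objects $\underline n$; a morphism $\underline n\to\underline m$ is a pair $(f,\omega)$ of a map $f$ and $\omega=(\omega_y)_{y\in\underline m}$, $\omega_y\in\mathcal P(|f^{-1}(y)|)$; the composite $(g,\omega^g)(f,\omega^f)$ is $gf$ with decorations $\gamma(\omega^g_i;\omega^f_{j_1},\dots,\omega^f_{j_s})\cdot\sigma_i$, where $g^{-1}(i)=\{j_1<\dots<j_s\}$ and $\sigma_i$ sends the position of an element of $(gf)^{-1}(i)$ in the natural order to its position in the concatenation of $f^{-1}(j_1),\dots,f^{-1}(j_s)$. $\Omega$ is the category of surjections between the $\underline n$, and $\Omega(\mathcal P)\subset\mathcal S(\mathcal P)$ consists of the $(f,\omega)$ with $f$ surjective. In the double category $\Omega(\mathcal P)_2$ the horizontal arrows are those of $\Omega$, the vertical arrows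 those of $\Omega(\mathcal P)$; a square consists of horizontal $f:A\to B$, $g:C\to D$ and vertical $(\phi,\omega^\phi):A\to C$, $(\psi,\omega^\psi):B\to D$ whose underlying square of sets is a pullback and such that for all $c\in C$ the bijection $\phi^{-1}(c)\to\psi^{-1}(g(c))$ induced by $f$ carries $\omega^\phi_c$ to $\omega^\psi_{g(c)}$ (a bijection $h$ acts by $\omega\mapsto\omega\cdot h^{-1}$). A double isomorphism from $A$ to $B$ is a pair of a horizontal isomorphism $f$ and a vertical isomorphism $u$, both $A\to B$, such that $f$ (top), $u$ (left) and two identities of $B$ (bottom, right) form a square. A *Janus functor* $M:\Omega(\mathcal P)_2\to Ab$ is a covariant functor $M_*$ on $\Omega$ and a contravariant functor $M^*$ on $\Omega(\mathcal P)$ to abelian groups, with the same values $M(\underline n)$ on objects. It is *pseudo-Mackey* if (1) $M_*(f)M^*(u)=\mathrm{Id}$ for every double isomorphism $(f,u)$, and (2) for every square as above $$M^*(\psi,\omega^\psi)\,M_*(g)=\sum_{A'}M_*(f_{A'})\,M^*((\phi,\omega^\phi)_{A'}),$$ the sum being over the subsets $A'\subseteq A$ such that $f|_{A'}$ and $\phi|_{A'}$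 are surjective; here $A'$ is identified with $\underline{|A'|}$ in increasing order, $f_{A'}=f\circ i$ and $(\phi,\omega^\phi)_{A'}=(\phi,\omega^\phi)\circ(i,\omega^i)$, where $i:A'\to A$ is the inclusion, decorated by $1$ at the points of $A'$ and by $0$ elsewhere. **Operators.** For a Janus functor $M$ put * $T_i^n=M_*(\tau_i^n)$, $\tau_i^n$ the transposition of $i,i+1$ ($1\le i<n$); * $I_n^{\alpha_1,\dots,\alpha_n}=M^*(\mathrm{Id}_{\underline n},(\alpha_1,\dots,\alpha_n))$, $\alpha_j\in\mathcal P(1)$; * $P_i^n=M_*(s_i^n)$, $s_i^n:\underline n\to\underline{n-1}$ the order-preserving surjection with $s_i^n(i)=s_i^n(i+1)=i$; * $H_i^{(b+p,b)\,\omega}=M^*(s_i^{b+p,b},\omega)$, where $s_i^{b+p,b}:\underline{b+p}\to\underline b$ is the order-preserving surjection that maps $i,\dots,i+p$ to $i$, decorated by $\omega\in\mathcal P(p+1)$ at $i$ and by $1$ elsewhere. For $p=0$ this is $I_b^{1,\dots,1,\omega,1,\dots,1}$, with $\omega$ at $i$. For $k\ge 1$ and $1\le i<n$ let $\sigma$ be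 the permutation of $\underline{n+2k}$ with $\sigma(i+p)=i+2p$, $\sigma(i+k+1+p)=i+2p+1$ for $0\le p\le k$, fixing all other letters. **(a)** $M$ is pseudo-Mackey if and only if the following relations hold for all $n$: 1. $T_i^n=(M^*(\tau_i^n,(1,\dots,1)))^{-1}$ for $1\le i<n$; 2. $I_{n-1}^{\alpha_1,\dots,\alpha_{n-1}}P_i^n=P_i^nI_n^{\alpha_1,\dots,\alpha_{i-1},\alpha_i,\alpha_i,\alpha_{i+1},\dots,\alpha_{n-1}}$ for $1\le i<n$, $\alpha_j\in\mathcal P(1)$; 3. $H_j^{(n+k-1,n-1)\,\alpha}P_i^n=P_i^{n+k}H_{j+1}^{(n+k,n)\,\alpha}$ for $1\le i<j<n$, $k\ge1$, $\alpha\in\mathcal P(k+1)$; 4. $H_j^{(n+k-1,n-1)\,\alpha}P_i^n=P_{i+k}^{n+k}H_{j}^{(n+k,n)\,\alpha}$ for $1\le j<i<n$, $k\ge1$, $\alpha\in\mathcal P(k+1)$; 5. for $1\le i<n$, $k\ge1$, $\alpha\in\mathcal P(k+1)$, $$H_i^{(n+k-1,n-1)\,\alpha}P_i^n=\sum_{\beta,u,\epsilon}P_{i+k}\cdots\widehat{P_{u_\beta}}\cdots\widehat{P_{u_1}}\cdots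 P_i^{\,n+2k-\beta}\;M_*(\sigma_{u_1+\epsilon_1(k+1),\dots,u_\beta+\epsilon_\beta(k+1)})\;H_i^{(n+2k-\beta,\,n+k-\sum\epsilon_j)\ \gamma(\alpha;\omega_1,\dots,\omega_{k+1})}\;H_{i+1}^{(n+k-\sum\epsilon_j,\,n)\ \gamma(\alpha;\omega'_1,\dots,\omega'_{k+1})}.$$ The sum is over $0\le\beta\le k+1$, $i\le u_1<\dots<u_\beta\le i+k$ and $\epsilon\in\{0,1\}^\beta$ with $\beta-k\le\sum\epsilon_j\le k$. In the product of the $P_v$, $v$ runs over the elements of $\{i,\dots,i+k\}$ other than the $u_j$, smaller $v$ acting first, and the upper index drops by one at each step, from $n+2k-\beta$ to $n+k$. $\omega_l=0$ if $l=u_j-i+1$ for some $j$ with $\epsilon_j=0$, and $\omega_l=1$ otherwise; $\omega'_l=0$ if $l=u_j-i+1$ for some $j$ with $\epsilon_j=1$, and $\omega'_l=1$ otherwise. $\sigma_{c_1,\dots,c_\beta}$ is the permutation of $n+2k-\beta$ letters obtained from $\sigma$ by removing the columns $c_j\mapsto\sigma(c_j)$ and renumbering the remaining arguments and the remaining values in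 increasing order. (For $\beta=0$ the term is $P_{i+k}^{n+k}\cdots P_i^{n+2k}M_*(\sigma)H_i^{(n+2k,n+k)\,\alpha}H_{i+1}^{(n+k,n)\,\alpha}$.) **(b)** The sum in 5 has exactly $3^{k+1}-2$ terms. **(c)** Suppose that $\mathcal P$ is generated by binary operations, or, more generally, that the smallest family of subsets of the $\mathcal P(n)$ that contains $\mathcal P(0),\mathcal P(1),\mathcal P(2)$ and is closed under the symmetric groups and $\gamma$ is all of $\mathcal P$. Then $M$ is pseudo-Mackey if and only if relations 1 and 2 hold, relations 3 and 4 hold for $k=1$, and for all $1\le i<n$ and $\alpha\in\mathcal P(2)$, with $x=\gamma(\alpha;0,1)$, $y=\gamma(\alpha;1,0)$ and $I_m^{j:z}=I_m^{1,\dots,1,z,1,\dots,1}$ ($z$ at position $j$), the 7-term relation holds: $$\begin{aligned}H_i^{(n,n-1)\alpha}P_i^n={}&P_{i+1}^{n+1}P_i^{n+2}T_{i+1}^{n+2}H_i^{(n+2,n+1)\alpha}H_{i+1}^{(n+1,n)\alpha}+P_{i+1}^{n+1}T_i^{n+1}I_{n+1}^{i:x}H_{i+1}^{(n+1,n)\alpha}+P_{i+1}^{n+1}H_i^{(n+1,n)\alpha}I_n^{i+1:x}\\&+P_i^{n+1}I_{n+1}^{i:y}H_{i+1}^{(n+1,n)\alpha}+P_i^{n+1}T_{i+1}^{n+1}H_i^{(n+1,n)\alpha}I_n^{i+1:y}+I_n^{1,\dots,1,y,x,1,\dots,1}+T_i^nI_n^{1,\dots,1,x,y,1,\dots,1},\end{aligned}$$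 where in the last two terms the pair stands at the positions $i,i+1$. **(d)** If moreover $\gamma(\alpha;0,1)=1=\gamma(\alpha;1,0)$ for all $\alpha\in\mathcal P(2)$, the same equivalence holds with the 7-term relation in which the factors $I$ of the second to fifth terms are omitted. -/

import Mathlib

open scoped BigOperators

universe u v

namespace PMack

/-- A symmetric sequence: sets `Op n` with right actions of the symmetric groups `𝔖ₙ`. -/
structure SymSeq where
  /-- the set of operations of arity `n` -/
  Op : ℕ → Type u
  /-- the right action `x · σ` -/
  act : ∀ {n : ℕ}, Op n → Equiv.Perm (Fin n) → Op n
  act_one : ∀ {n : ℕ} (x : Op n), act x 1 = x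
  act_mul : ∀ {n : ℕ} (x : Op n) (σ τ : Equiv.Perm (Fin n)), act x (σ * τ) = act (act x σ) τ

/-- Two standard finite sets in bijection have the same number of elements. -/
theorem fin_card_eq {a b : ℕ} (e : Fin a ≃ Fin b) : a = b := by
  simpa using Fintype.card_congr e

/-- The right action, for a bijection `e : Fin a ≃ Fin b` (so that `a = b`): the operation
`x · e`, in which the input `i` of `x · e` is the input `e i` of `x`.
For a permutation this is `act`; for `e = finCongr h` it is transport along `h : a = b`. -/
def SymSeq.reindex (P : SymSeq.{u}) {a b : ℕ} (e : Fin a ≃ Fin b) (x : P.Op b) : P.Op a :=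
  P.act ((fin_card_eq e).symm ▸ x) (e.trans (finCongr (fin_card_eq e).symm))

theorem SymSeq.reindex_perm (P : SymSeq.{u}) {a : ℕ} (e : Equiv.Perm (Fin a)) (x : P.Op a) :
    P.reindex e x = P.act x e := rfl

theorem SymSeq.reindex_refl (P : SymSeq.{u}) {a : ℕ} (x : P.Op a) :
    P.reindex (Equiv.refl _) x = x := P.act_one x

theorem SymSeq.reindex_trans (P : SymSeq.{u}) {a b c : ℕ} (e : Fin a ≃ Fin b) (f : Fin b ≃ Fin c)
    (x : P.Op c) : P.reindex e (P.reindex f x) = P.reindex (e.trans f) x := by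
  obtain rfl := fin_card_eq e
  obtain rfl := fin_card_eq f
  exact (P.act_mul x f e).symm

/-- The permutation of the entries inside consecutive blocks, block by block. -/
def blockSum {n : ℕ} {m m' : Fin n → ℕ} (τ : ∀ i, Fin (m i) ≃ Fin (m' i)) :
    Fin (∑ i, m i) ≃ Fin (∑ i, m' i) :=
  finSigmaFinEquiv.symm.trans ((Equiv.sigmaCongrRight τ).trans finSigmaFinEquiv)

/-- The permutation of consecutive blocks: block `i` on the left, which has `m (σ i)` entries, is
sent, in order, to block `σ i` on the right. -/
def blockPerm {n n' : ℕ} (m : Fin n' → ℕ) (σ : Fin n ≃ Fin n') :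
    Fin (∑ i, m (σ i)) ≃ Fin (∑ i, m i) :=
  finSigmaFinEquiv.symm.trans
    ((Equiv.sigmaCongrLeft (β := fun i => Fin (m i)) σ).trans finSigmaFinEquiv)

theorem sum_sum_eq {n : ℕ} (m : Fin n → ℕ) (l : ∀ i, Fin (m i) → ℕ) :
    ∑ x : Fin (∑ i, m i), l (finSigmaFinEquiv.symm x).1 (finSigmaFinEquiv.symm x).2 =
      ∑ i, ∑ j, l i j := by
  rw [Equiv.sum_comp finSigmaFinEquiv.symm (fun y => l y.1 y.2), Fintype.sum_sigma]

/-- A unitary symmetric set-operad.  `γ m c d` is `γ(c; d₁, …, dₙ)`, where `dᵢ` has arity `m i`;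
its inputs are those of `d₁`, …, `dₙ`, in this order. -/
structure UnitaryOperad extends SymSeq.{u} where
  /-- the unit `1 ∈ P(1)` -/
  one : Op 1
  /-- the composition of operations -/
  γ : ∀ {n : ℕ} (m : Fin n → ℕ), Op n → (∀ i, Op (m i)) → Op (∑ i, m i)
  /-- the element `0 ∈ P(0)` -/
  zero : Op 0
  /-- `P(0)` has one element -/
  eq_zero : ∀ x : Op 0, x = zero
  one_γ : ∀ {m : ℕ} (d : Op m),
    γ (fun _ : Fin 1 => m) one (fun _ => d) = toSymSeq.reindex (finCongr (by simp)) d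
  γ_one : ∀ {n : ℕ} (c : Op n),
    γ (fun _ : Fin n => 1) c (fun _ => one) = toSymSeq.reindex (finCongr (by simp)) c
  γ_assoc : ∀ {n : ℕ} (m : Fin n → ℕ) (l : ∀ i, Fin (m i) → ℕ) (c : Op n)
    (d : ∀ i, Op (m i)) (e : ∀ i j, Op (l i j)),
    γ (fun x => l (finSigmaFinEquiv.symm x).1 (finSigmaFinEquiv.symm x).2) (γ m c d)
        (fun x => e (finSigmaFinEquiv.symm x).1 (finSigmaFinEquiv.symm x).2) =
      toSymSeq.reindex (finCongr (sum_sum_eq m l))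
        (γ (fun i => ∑ j, l i j) c (fun i => γ (l i) (d i) (e i)))
  γ_act_left : ∀ {n : ℕ} (m : Fin n → ℕ) (c : Op n) (d : ∀ i, Op (m i))
    (σ : Equiv.Perm (Fin n)),
    γ (fun i => m (σ i)) (act c σ) (fun i => d (σ i)) =
      toSymSeq.reindex (blockPerm m σ) (γ m c d)
  γ_act_right : ∀ {n : ℕ} (m : Fin n → ℕ) (c : Op n) (d : ∀ i, Op (m i))
    (τ : ∀ i, Equiv.Perm (Fin (m i))),
    γ m c (fun i => act (d i) (τ i)) = act (γ m c d) (blockSum τ)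

theorem UnitaryOperad.γ_reindex_left (P : UnitaryOperad.{u}) {n n' : ℕ} (m : Fin n' → ℕ)
    (c : P.Op n') (d : ∀ i, P.Op (m i)) (σ : Fin n ≃ Fin n') :
    P.γ (fun i => m (σ i)) (P.reindex σ c) (fun i => d (σ i)) =
      P.reindex (blockPerm m σ) (P.γ m c d) := by
  obtain rfl := fin_card_eq σ
  exact P.γ_act_left m c d σ

theorem UnitaryOperad.γ_reindex_right (P : UnitaryOperad.{u}) {n : ℕ} (m m' : Fin n → ℕ)
    (c : P.Op n) (d : ∀ i, P.Op (m' i)) (τ : ∀ i, Fin (m i) ≃ Fin (m' i)) :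
    P.γ m c (fun i => P.reindex (τ i) (d i)) = P.reindex (blockSum τ) (P.γ m' c d) := by
  obtain rfl : m = m' := funext fun i => fin_card_eq (τ i)
  exact P.γ_act_right m c d τ

/-- The fibre `f⁻¹(y)`. -/
def fiber {a b : ℕ} (f : Fin a → Fin b) (y : Fin b) : Finset (Fin a) :=
  Finset.univ.filter fun x => f x = y

theorem mem_fiber {a b : ℕ} {f : Fin a → Fin b} {y : Fin b} {x : Fin a} :
    x ∈ fiber f y ↔ f x = y := by simp [fiber]

/-- The increasing enumeration of the fibre `f⁻¹(y)`. -/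
def fiberEnum {a b : ℕ} (f : Fin a → Fin b) (y : Fin b) :
    Fin (fiber f y).card ≃ fiber f y :=
  ((fiber f y).orderIsoOfFin rfl).toEquiv

theorem apply_fiberEnum {a b : ℕ} (f : Fin a → Fin b) (y : Fin b) (k : Fin (fiber f y).card) :
    f (fiberEnum f y k) = y := mem_fiber.1 (fiberEnum f y k).2

theorem fiberSigma_ext {a b : ℕ} {f : Fin a → Fin b} {n : ℕ} {y : Fin n → Fin b}
    {p q : Σ k : Fin n, fiber f (y k)} (h : p.1 = q.1) (h' : (p.2 : Fin a) = q.2) : p = q := by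
  obtain ⟨k, x, hx⟩ := p
  obtain ⟨k', x', hx'⟩ := q
  obtain rfl : k = k' := h
  obtain rfl : x = x' := h'
  rfl

/-- The fibre `(g ∘ f)⁻¹(i)` as the disjoint union of the fibres `f⁻¹(j₁), …, f⁻¹(jₛ)`, where
`g⁻¹(i) = {j₁ < ⋯ < jₛ}`. -/
def fiberSigma {a b c : ℕ} (f : Fin a → Fin b) (g : Fin b → Fin c) (i : Fin c) :
    fiber (g ∘ f) i ≃
      Σ k : Fin (fiber g i).card, fiber f (fiberEnum g i k : Fin b) where
  toFun x := ⟨(fiberEnum g i).symm ⟨f x, mem_fiber.2 (mem_fiber (f := g ∘ f) |>.1 x.2)⟩,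
    ⟨x, mem_fiber.2 (by simp)⟩⟩
  invFun y := ⟨y.2, mem_fiber.2 (by
    exact (congrArg g (mem_fiber.1 y.2.2)).trans (apply_fiberEnum g i y.1))⟩
  left_inv x := rfl
  right_inv := by
    rintro ⟨k, x, hx⟩
    have hk : (fiberEnum g i).symm ⟨f x, mem_fiber.2
        ((congrArg g (mem_fiber.1 hx)).trans (apply_fiberEnum g i k))⟩ = k := by
      rw [Equiv.symm_apply_eq]; exact Subtype.ext (mem_fiber.1 hx)
    exact fiberSigma_ext hk rfl

/-- The permutation `σᵢ`: the `k`-th element `x` of `(g ∘ f)⁻¹(i)` for the natural order is sent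
to the position of `x` in the list of the elements of `f⁻¹(j₁)`, then of `f⁻¹(j₂)`, …, where
`g⁻¹(i) = {j₁ < j₂ < ⋯}` and each `f⁻¹(j)` has its natural order. -/
def fiberPerm {a b c : ℕ} (f : Fin a → Fin b) (g : Fin b → Fin c) (i : Fin c) :
    Fin (fiber (g ∘ f) i).card ≃
      Fin (∑ k : Fin (fiber g i).card, (fiber f (fiberEnum g i k : Fin b)).card) :=
  (fiberEnum (g ∘ f) i).trans <| (fiberSigma f g i).trans <|
    (Equiv.sigmaCongrRight fun k => (fiberEnum f (fiberEnum g i k : Fin b)).symm).trans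
      finSigmaFinEquiv

variable (P : UnitaryOperad.{u})

/-- A morphism `n → m` of the May–Thomason category `𝒮(P)`: a map `f` together with an operation
`ω_y ∈ P(|f⁻¹(y)|)` for every `y`. -/
structure VHom (n m : ℕ) where
  /-- the underlying map -/
  toFun : Fin n → Fin m
  /-- the decorations -/
  dec : ∀ y : Fin m, P.Op (fiber toFun y).card

variable {P}

theorem VHom.ext' {a b : ℕ} {φ ψ : VHom P a b} (h : φ.toFun = ψ.toFun)
    (hd : ∀ y, φ.dec y = P.reindex (finCongr (by rw [h])) (ψ.dec y)) : φ = ψ := by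
  obtain ⟨f, ω⟩ := φ
  obtain ⟨g, ω'⟩ := ψ
  obtain rfl : f = g := h
  congr
  funext y
  exact (hd y).trans (P.reindex_refl _)

theorem card_fiber_id {n : ℕ} (y : Fin n) : (fiber id y).card = 1 := by
  rw [Finset.card_eq_one]
  exact ⟨y, by ext x; simp [mem_fiber]⟩

variable (P) in
/-- The vertical map `(id, (α₁, …, αₙ))`, for unary operations `αᵢ`. -/
def VHom.unary {n : ℕ} (α : Fin n → P.Op 1) : VHom P n n where
  toFun := id
  dec y := P.reindex (finCongr (card_fiber_id y)) (α y)

variable (P) in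
/-- The identity `(id, (1, …, 1))`. -/
def VHom.id (n : ℕ) : VHom P n n := VHom.unary P fun _ => P.one

/-- The composition `(g, ω^g) ∘ (f, ω^f)`, with
`ω_i = γ(ω^g_i; ω^f_{j₁}, …, ω^f_{jₛ}) · σ_i`, `g⁻¹(i) = {j₁ < ⋯ < jₛ}`. -/
def VHom.comp {a b c : ℕ} (ψ : VHom P b c) (φ : VHom P a b) : VHom P a c where
  toFun := ψ.toFun ∘ φ.toFun
  dec i := P.reindex (fiberPerm φ.toFun ψ.toFun i)
    (P.γ _ (ψ.dec i) fun k => φ.dec (fiberEnum ψ.toFun i k : Fin b))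

theorem γ_dec_congr {a b n : ℕ} (φ : VHom P a b) (c : P.Op n) {y z : Fin n → Fin b} (h : y = z) :
    P.γ _ c (fun k => φ.dec (y k)) =
      P.reindex (finCongr (by rw [h])) (P.γ _ c fun k => φ.dec (z k)) := by
  subst h
  exact (P.reindex_refl _).symm

/-- The element of the source with a given position in the list that defines `fiberPerm`. -/
def blockElt {a b c : ℕ} (f : Fin a → Fin b) (g : Fin b → Fin c) (i : Fin c)
    (x : Fin (∑ k : Fin (fiber g i).card, (fiber f (fiberEnum g i k : Fin b)).card)) : Fin a :=
  fiberEnum f (fiberEnum g i (finSigmaFinEquiv.symm x).1 : Fin b) (finSigmaFinEquiv.symm x).2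

theorem blockElt_fiberPerm {a b c : ℕ} (f : Fin a → Fin b) (g : Fin b → Fin c) (i : Fin c)
    (x : Fin (fiber (g ∘ f) i).card) :
    blockElt f g i (fiberPerm f g i x) = fiberEnum (g ∘ f) i x := by
  let F : (Σ k : Fin (fiber g i).card, Fin (fiber f (fiberEnum g i k : Fin b)).card) → Fin a :=
    fun p => fiberEnum f (fiberEnum g i p.1 : Fin b) p.2
  let q := fiberSigma f g i (fiberEnum (g ∘ f) i x)
  change F (finSigmaFinEquiv.symm (finSigmaFinEquiv ⟨q.1, (fiberEnum f _).symm q.2⟩)) = _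
  rw [Equiv.symm_apply_apply]
  change ((fiberEnum f _ ((fiberEnum f _).symm q.2) : fiber f _) : Fin a) = _
  rw [Equiv.apply_symm_apply]
  rfl

theorem blockElt_injective {a b c : ℕ} (f : Fin a → Fin b) (g : Fin b → Fin c) (i : Fin c) :
    Function.Injective (blockElt f g i) := by
  intro x y h
  obtain ⟨x, rfl⟩ := (fiberPerm f g i).surjective x
  obtain ⟨y, rfl⟩ := (fiberPerm f g i).surjective y
  rw [blockElt_fiberPerm, blockElt_fiberPerm] at h
  rw [(fiberEnum (g ∘ f) i).injective (Subtype.ext h)]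

theorem apply_blockElt {a b c : ℕ} (f : Fin a → Fin b) (g : Fin b → Fin c) (i : Fin c) (x) :
    g (f (blockElt f g i x)) = i := by
  obtain ⟨x, rfl⟩ := (fiberPerm f g i).surjective x
  rw [blockElt_fiberPerm]
  exact apply_fiberEnum (g ∘ f) i x

theorem finSigma_lt {n : ℕ} {m : Fin n → ℕ} (p q : Σ i, Fin (m i)) :
    finSigmaFinEquiv p < finSigmaFinEquiv q ↔
      p.1 < q.1 ∨ ∃ h : p.1 = q.1, Fin.cast (by rw [h]) p.2 < q.2 := by
  have key : ∀ p q : Σ i, Fin (m i), p.1 < q.1 → finSigmaFinEquiv p < finSigmaFinEquiv q := by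
    intro p q h
    rw [Fin.lt_def, finSigmaFinEquiv_apply, finSigmaFinEquiv_apply]
    have h1 : ∑ i : Fin (p.1 : ℕ), m (Fin.castLE p.1.2.le i) + m p.1 ≤
        ∑ i : Fin (q.1 : ℕ), m (Fin.castLE q.1.2.le i) := by
      have e : ∀ r : Fin n, ∑ i : Fin (r : ℕ), m (Fin.castLE r.2.le i) =
          ∑ i ∈ Finset.univ.filter (· < r), m i := by
        intro r
        refine Finset.sum_bij (fun i _ => Fin.castLE r.2.le i) ?_ ?_ ?_ ?_
        · intro i _; exact Finset.mem_filter.2 ⟨Finset.mem_univ _, i.2⟩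
        · intro i _ j _ h; exact Fin.castLE_injective _ h
        · intro j hj
          exact ⟨⟨j, (Finset.mem_filter.1 hj).2⟩, Finset.mem_univ _, rfl⟩
        · intro i _; rfl
      rw [e, e, add_comm, ← Finset.sum_insert (a := p.1) (by simp)]
      apply Finset.sum_le_sum_of_subset
      intro j hj
      simp only [Finset.mem_insert, Finset.mem_filter, Finset.mem_univ, true_and] at hj ⊢
      rcases hj with rfl | hj
      · exact h
      · exact hj.trans h
    have := p.2.2
    omega
  constructor
  · intro h
    rcases lt_trichotomy p.1 q.1 with h' | h' | h'
    · exact Or.inl h'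
    · obtain ⟨i, x⟩ := p
      obtain ⟨j, y⟩ := q
      obtain rfl : i = j := h'
      refine Or.inr ⟨rfl, ?_⟩
      rw [Fin.lt_def, finSigmaFinEquiv_apply, finSigmaFinEquiv_apply] at h
      simpa using h
    · exact absurd h (key q p h').not_gt
  · rintro (h | ⟨h, h'⟩)
    · exact key p q h
    · obtain ⟨i, x⟩ := p
      obtain ⟨j, y⟩ := q
      obtain rfl : i = j := h
      rw [Fin.lt_def, finSigmaFinEquiv_apply, finSigmaFinEquiv_apply]
      simpa using h'

theorem finCongr_eq_of_strictMono {a b : ℕ} (h : a = b) (f : Fin a → Fin b) (hf : StrictMono f)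
    (x : Fin a) : finCongr h x = f x := by
  subst h
  have : Function.Bijective f := Finite.injective_iff_bijective.1 hf.injective
  let e : Fin a ≃o Fin a := hf.orderIsoOfSurjective f this.2
  have he : e = OrderIso.refl _ := Subsingleton.elim _ _
  exact (congrFun (congrArg DFunLike.coe he) x).symm

theorem nested_lt {n : ℕ} {m : Fin n → ℕ} {l : ∀ i, Fin (m i) → ℕ} (p q : Σ i, Fin (m i))
    (t : Fin (l p.1 p.2)) (s : Fin (l q.1 q.2)) (h : finSigmaFinEquiv p < finSigmaFinEquiv q) :
    finSigmaFinEquiv (n := fun i => ∑ j, l i j) ⟨p.1, finSigmaFinEquiv ⟨p.2, t⟩⟩ <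
      finSigmaFinEquiv (n := fun i => ∑ j, l i j) ⟨q.1, finSigmaFinEquiv ⟨q.2, s⟩⟩ := by
  rw [finSigma_lt] at h ⊢
  obtain ⟨k, k'⟩ := p
  obtain ⟨q, q'⟩ := q
  rcases h with h | ⟨h, h'⟩
  · exact Or.inl h
  · obtain rfl : k = q := h
    refine Or.inr ⟨rfl, ?_⟩
    rw [Fin.cast_eq_self, finSigma_lt]
    exact Or.inl h'

theorem finCongr_sum_sum {n : ℕ} (m : Fin n → ℕ) (l : ∀ i, Fin (m i) → ℕ)
    (x : Fin (∑ x : Fin (∑ i, m i), l (finSigmaFinEquiv.symm x).1 (finSigmaFinEquiv.symm x).2)) :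
    finCongr (sum_sum_eq m l) x =
      finSigmaFinEquiv ⟨(finSigmaFinEquiv.symm (finSigmaFinEquiv.symm x).1).1,
        finSigmaFinEquiv ⟨(finSigmaFinEquiv.symm (finSigmaFinEquiv.symm x).1).2,
          (finSigmaFinEquiv.symm x).2⟩⟩ := by
  refine finCongr_eq_of_strictMono (sum_sum_eq m l)
    (fun x => finSigmaFinEquiv ⟨(finSigmaFinEquiv.symm (finSigmaFinEquiv.symm x).1).1,
        finSigmaFinEquiv ⟨(finSigmaFinEquiv.symm (finSigmaFinEquiv.symm x).1).2,
          (finSigmaFinEquiv.symm x).2⟩⟩) ?_ x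
  intro x y hxy
  obtain ⟨⟨x, t⟩, rfl⟩ := finSigmaFinEquiv.surjective x
  obtain ⟨⟨y, s⟩, rfl⟩ := finSigmaFinEquiv.surjective y
  let G : (Σ x : Fin (∑ i, m i), Fin (l (finSigmaFinEquiv.symm x).1 (finSigmaFinEquiv.symm x).2)) →
      Fin (∑ i, ∑ j, l i j) := fun z => finSigmaFinEquiv ⟨(finSigmaFinEquiv.symm z.1).1,
        finSigmaFinEquiv ⟨(finSigmaFinEquiv.symm z.1).2, z.2⟩⟩
  change G (finSigmaFinEquiv.symm (finSigmaFinEquiv ⟨x, t⟩)) <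
    G (finSigmaFinEquiv.symm (finSigmaFinEquiv ⟨y, s⟩))
  rw [Equiv.symm_apply_apply, Equiv.symm_apply_apply]
  rw [finSigma_lt] at hxy
  rcases hxy with h | ⟨h, h'⟩
  · apply nested_lt
    rw [Equiv.apply_symm_apply, Equiv.apply_symm_apply]
    exact h
  · obtain rfl : x = y := h
    refine (finSigma_lt _ _).2 (Or.inr ⟨rfl, ?_⟩)
    rw [Fin.cast_eq_self, finSigma_lt]
    exact Or.inr ⟨rfl, h'⟩

theorem reindex_aux {a a' b c d e : ℕ} (e₀ : Fin a ≃ Fin a') (e₁ : Fin a' ≃ Fin b)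
    (e₂ : Fin b ≃ Fin c) (e₃ : Fin c ≃ Fin d) (e₄ : Fin a ≃ Fin e) (e₅ : Fin e ≃ Fin d)
    (x : P.Op d) (h : ∀ y, e₃ (e₂ (e₁ (e₀ y))) = e₅ (e₄ y)) :
    P.reindex e₀ (P.reindex e₁ (P.reindex e₂ (P.reindex e₃ x))) =
      P.reindex e₄ (P.reindex e₅ x) := by
  simp only [SymSeq.reindex_trans]
  exact congrArg (fun E => P.reindex E x) (Equiv.ext h)

theorem reindex_aux' {a b c d e f : ℕ} (e₀ : Fin a ≃ Fin b) (e₁ : Fin b ≃ Fin c)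
    (e₂ : Fin c ≃ Fin d) (e₃ : Fin d ≃ Fin e) (e₄ : Fin a ≃ Fin a) (e₅ : Fin a ≃ Fin f)
    (e₆ : Fin f ≃ Fin e) (x : P.Op e) (h₄ : e₄ = Equiv.refl _)
    (h : ∀ y, e₃ (e₂ (e₁ (e₀ y))) = e₆ (e₅ y)) :
    P.reindex e₀ (P.reindex e₁ (P.reindex e₂ (P.reindex e₃ x))) =
      P.reindex e₄ (P.reindex e₅ (P.reindex e₆ x)) := by
  subst h₄
  rw [SymSeq.reindex_refl]
  exact reindex_aux e₀ e₁ e₂ e₃ e₅ e₆ x h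

theorem finCongr_sum_congr {n : ℕ} {m m' : Fin n → ℕ} (h : m = m') (hs : ∑ i, m i = ∑ i, m' i)
    (k : Fin n) (t : Fin (m k)) :
    finCongr hs (finSigmaFinEquiv ⟨k, t⟩) =
      finSigmaFinEquiv (n := m') ⟨k, Fin.cast (congrFun h k) t⟩ := by
  subst h; rfl

theorem blockPerm_apply {n n' : ℕ} (m : Fin n' → ℕ) (σ : Fin n ≃ Fin n') (k : Fin n)
    (t : Fin (m (σ k))) :
    blockPerm m σ (finSigmaFinEquiv ⟨k, t⟩) = finSigmaFinEquiv (n := m) ⟨σ k, t⟩ := by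
  change finSigmaFinEquiv (Equiv.sigmaCongrLeft σ (finSigmaFinEquiv.symm (finSigmaFinEquiv _))) = _
  rw [Equiv.symm_apply_apply]
  rfl

theorem fiberEnum_congr {a b : ℕ} (f : Fin a → Fin b) {y y' : Fin b} (h : y = y')
    (t : Fin (fiber f y).card) (e : (fiber f y).card = (fiber f y').card) :
    (fiberEnum f y t : Fin a) = fiberEnum f y' (Fin.cast e t) := by
  subst h; rfl

theorem blockElt_mk {a b c : ℕ} (f : Fin a → Fin b) (g : Fin b → Fin c) (i : Fin c) (k t) :
    blockElt f g i (finSigmaFinEquiv ⟨k, t⟩) = fiberEnum f (fiberEnum g i k : Fin b) t := by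
  let F : (Σ k : Fin (fiber g i).card, Fin (fiber f (fiberEnum g i k : Fin b)).card) → Fin a :=
    fun p => fiberEnum f (fiberEnum g i p.1 : Fin b) p.2
  change F (finSigmaFinEquiv.symm (finSigmaFinEquiv ⟨k, t⟩)) = _
  rw [Equiv.symm_apply_apply]

theorem VHom.comp_assoc {a b c d : ℕ} (χ : VHom P c d) (ψ : VHom P b c) (φ : VHom P a b) :
    (χ.comp ψ).comp φ = χ.comp (ψ.comp φ) := by
  obtain ⟨f, u⟩ := φ
  obtain ⟨g, v⟩ := ψ
  obtain ⟨h, w⟩ := χ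
  refine VHom.ext' rfl fun i => ?_
  let X : Fin (∑ k : Fin (fiber h i).card, (fiber g (fiberEnum h i k : Fin c)).card) → Fin b :=
    blockElt g h i
  have hX : (fun k => (fiberEnum (h ∘ g) i k : Fin b)) = fun k => X (fiberPerm g h i k) := by
    funext k; exact (blockElt_fiberPerm g h i k).symm
  have h1 : P.γ (fun k => (fiber f (fiberEnum (h ∘ g) i k : Fin b)).card) (P.reindex (fiberPerm g h i)
      (P.γ _ (w i) fun k => v (fiberEnum h i k : Fin c))) (fun k => u (fiberEnum (h ∘ g) i k : Fin b)) =
      P.reindex (finCongr (Finset.sum_congr rfl fun k _ => by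
          rw [congrFun hX k]))
        (P.γ (fun k => (fiber f (X (fiberPerm g h i k))).card) (P.reindex (fiberPerm g h i)
          (P.γ _ (w i) fun k => v (fiberEnum h i k : Fin c))) fun k => u (X (fiberPerm g h i k))) :=
    γ_dec_congr (VHom.mk f u) (P.reindex (fiberPerm g h i)
    (P.γ _ (w i) fun k => v (fiberEnum h i k : Fin c))) hX
  have h2 := P.γ_reindex_left (fun l => (fiber f (X l)).card)
    (P.γ _ (w i) fun k => v (fiberEnum h i k : Fin c)) (fun l => u (X l)) (fiberPerm g h i)
  have h3 : P.γ (fun l => (fiber f (X l)).card)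
      (P.γ _ (w i) fun k => v (fiberEnum h i k : Fin c)) (fun l => u (X l)) =
      P.reindex (finCongr (sum_sum_eq _ (fun k k' =>
        (fiber f (fiberEnum g (fiberEnum h i k : Fin c) k' : Fin b)).card)))
        (P.γ _ (w i) fun k => P.γ _ (v (fiberEnum h i k : Fin c))
      fun k' => u (fiberEnum g (fiberEnum h i k : Fin c) k' : Fin b)) :=
    P.γ_assoc _ (fun k k' => (fiber f (fiberEnum g (fiberEnum h i k : Fin c) k' : Fin b)).card)
    (w i) (fun k => v (fiberEnum h i k : Fin c))
    (fun k k' => u (fiberEnum g (fiberEnum h i k : Fin c) k' : Fin b))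
  have h4 := P.γ_reindex_right _ _ (w i)
    (fun k => P.γ _ (v (fiberEnum h i k : Fin c))
      fun k' => u (fiberEnum g (fiberEnum h i k : Fin c) k' : Fin b))
    (fun k => fiberPerm f g (fiberEnum h i k : Fin c))
  change P.reindex (fiberPerm f (h ∘ g) i) (P.γ _ (P.reindex (fiberPerm g h i)
    (P.γ _ (w i) fun k => v (fiberEnum h i k : Fin c))) fun k => u (fiberEnum (h ∘ g) i k : Fin b)) =
    P.reindex _ (P.reindex (fiberPerm (g ∘ f) h i) (P.γ _ (w i) fun k =>
      P.reindex (fiberPerm f g (fiberEnum h i k : Fin c)) (P.γ _ (v (fiberEnum h i k : Fin c))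
      fun k' => u (fiberEnum g (fiberEnum h i k : Fin c) k' : Fin b))))
  rw [h4, h1, h2, h3]
  refine reindex_aux' _ _ _ _ _ _ _ _ rfl ?_
  let pos' : (Σ k : Fin (fiber h i).card, Fin (∑ k' : Fin (fiber g (fiberEnum h i k : Fin c)).card,
      (fiber f (fiberEnum g (fiberEnum h i k : Fin c) k' : Fin b)).card)) → Fin a :=
    fun y => blockElt f g (fiberEnum h i y.1 : Fin c) y.2
  have hpos : Function.Injective (pos' ∘ finSigmaFinEquiv.symm) := by
    refine Function.Injective.comp ?_ finSigmaFinEquiv.symm.injective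
    rintro ⟨k, y⟩ ⟨k', y'⟩ hy
    change blockElt f g _ y = blockElt f g _ y' at hy
    obtain rfl : k = k' := by
      apply (fiberEnum h i).injective
      apply Subtype.ext
      rw [← apply_blockElt f g _ y, ← apply_blockElt f g _ y', hy]
    rw [blockElt_injective _ _ _ hy]
  intro x
  apply hpos
  have hR : pos' (finSigmaFinEquiv.symm (blockSum (fun k => fiberPerm f g (fiberEnum h i k : Fin c))
      (fiberPerm (g ∘ f) h i x))) = fiberEnum (h ∘ g ∘ f) i x := by
    rw [← blockElt_fiberPerm (g ∘ f) h i x]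
    change pos' (finSigmaFinEquiv.symm (finSigmaFinEquiv (Equiv.sigmaCongrRight _ _))) = _
    rw [Equiv.symm_apply_apply]
    exact blockElt_fiberPerm f g _ _
  refine Eq.trans ?_ hR.symm
  obtain ⟨y, hy⟩ : ∃ y, y = fiberPerm f (h ∘ g) i x := ⟨_, rfl⟩
  have hL : (fiberEnum (h ∘ g ∘ f) i x : Fin a) = blockElt f (h ∘ g) i y := by
    rw [hy, blockElt_fiberPerm]; rfl
  rw [hL]
  rw [← hy]
  clear hy hL hR
  obtain ⟨⟨k, t⟩, rfl⟩ := finSigmaFinEquiv.surjective y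
  have hE := fun y => finCongr_sum_sum (fun k : Fin (fiber h i).card =>
    (fiber g (fiberEnum h i k : Fin c)).card)
    (fun k k' => (fiber f (fiberEnum g (fiberEnum h i k : Fin c) k' : Fin b)).card) y
  have hE' : ∀ l (s : Fin (fiber f (X l)).card), finCongr (sum_sum_eq _ (fun k k' =>
      (fiber f (fiberEnum g (fiberEnum h i k : Fin c) k' : Fin b)).card))
      (finSigmaFinEquiv (n := fun l => (fiber f (X l)).card) ⟨l, s⟩) =
      finSigmaFinEquiv ⟨(finSigmaFinEquiv.symm l).1,
        finSigmaFinEquiv ⟨(finSigmaFinEquiv.symm l).2, s⟩⟩ := by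
    intro l s
    let G : (Σ l, Fin (fiber f (X l)).card) → Fin (∑ k, ∑ k',
        (fiber f (fiberEnum g (fiberEnum h i k : Fin c) k' : Fin b)).card) := fun z =>
      finSigmaFinEquiv ⟨(finSigmaFinEquiv.symm z.1).1,
        finSigmaFinEquiv ⟨(finSigmaFinEquiv.symm z.1).2, z.2⟩⟩
    refine (hE _).trans ?_
    change G (finSigmaFinEquiv.symm (finSigmaFinEquiv ⟨l, s⟩)) = _
    rw [Equiv.symm_apply_apply]
  rw [blockElt_mk, fiberEnum_congr f (congrFun hX k) t (by rw [congrFun hX k])]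
  have e1 := finCongr_sum_congr (m := fun k => (fiber f (fiberEnum (h ∘ g) i k : Fin b)).card)
    (m' := fun k => (fiber f (X (fiberPerm g h i k))).card)
    (funext fun k => by rw [congrFun hX k]) (Finset.sum_congr rfl fun k _ => by
          rw [congrFun hX k]) k t
  have e2 := blockPerm_apply (fun l => (fiber f (X l)).card) (fiberPerm g h i) k
    (Fin.cast (by rw [congrFun hX k]) t)
  have e3 := hE' _ (Fin.cast (by rw [congrFun hX k]) t : Fin (fiber f (X (fiberPerm g h i k))).card)
  refine (congrArg (fun z => pos' (finSigmaFinEquiv.symm (finCongr (sum_sum_eq _ (fun k k' =>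
      (fiber f (fiberEnum g (fiberEnum h i k : Fin c) k' : Fin b)).card))
      (blockPerm (fun l => (fiber f (X l)).card) (fiberPerm g h i) z)))) e1).trans ?_
  refine (congrArg (fun z => pos' (finSigmaFinEquiv.symm (finCongr (sum_sum_eq _ (fun k k' =>
      (fiber f (fiberEnum g (fiberEnum h i k : Fin c) k' : Fin b)).card)) z))) e2).trans ?_
  refine (congrArg (fun z => pos' (finSigmaFinEquiv.symm z)) e3).trans ?_
  rw [Equiv.symm_apply_apply]
  exact blockElt_mk f g _ _ _

theorem reindex_eq_self {a b c d : ℕ} (e₀ : Fin a ≃ Fin b) (e₁ : Fin b ≃ Fin c)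
    (e₂ : Fin c ≃ Fin d) (e₃ : Fin d ≃ Fin a) (e₄ : Fin a ≃ Fin a) (x : P.Op a)
    (h₄ : e₄ = Equiv.refl _) (h : ∀ y, e₃ (e₂ (e₁ (e₀ y))) = y) :
    P.reindex e₀ (P.reindex e₁ (P.reindex e₂ (P.reindex e₃ x))) = P.reindex e₄ x := by
  subst h₄
  simp only [SymSeq.reindex_trans]
  exact congrArg (fun E => P.reindex E x) (Equiv.ext h)

theorem finSigma_const_one {m : ℕ} (k : Fin 1) (t : Fin m) (h : ∑ _ : Fin 1, m = m) :
    finCongr h (finSigmaFinEquiv (n := fun _ : Fin 1 => m) ⟨k, t⟩) = t := by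
  apply Fin.ext
  simp

theorem VHom.id_comp {a b : ℕ} (φ : VHom P a b) : (VHom.id P b).comp φ = φ := by
  obtain ⟨f, u⟩ := φ
  refine VHom.ext' rfl fun i => ?_
  have hX : (fun k => (fiberEnum (_root_.id : Fin b → Fin b) i k : Fin b)) = fun _ => i := by
    funext k; exact apply_fiberEnum _root_.id i k
  let e : Fin (fiber (_root_.id : Fin b → Fin b) i).card ≃ Fin 1 := finCongr (card_fiber_id i)
  have h1 : P.γ (fun k => (fiber f (fiberEnum (_root_.id : Fin b → Fin b) i k : Fin b)).card)
      (P.reindex e P.one) (fun k => u (fiberEnum (_root_.id : Fin b → Fin b) i k : Fin b)) =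
      P.reindex (finCongr (Finset.sum_congr rfl fun k _ => by rw [congrFun hX k]))
        (P.γ (fun _ => (fiber f i).card) (P.reindex e P.one) fun _ => u i) :=
    γ_dec_congr (VHom.mk f u) _ hX
  have h2 := P.γ_reindex_left (fun _ => (fiber f i).card) P.one (fun _ => u i) e
  change P.reindex (fiberPerm f _root_.id i) (P.γ _ (P.reindex e P.one)
    fun k => u (fiberEnum (_root_.id : Fin b → Fin b) i k : Fin b)) = _
  rw [h1, h2, P.one_γ]
  refine reindex_eq_self _ _ _ _ _ _ rfl ?_
  intro x
  apply (fiberEnum f i).injective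
  apply Subtype.ext
  have hx := blockElt_fiberPerm f _root_.id i x
  refine Eq.trans ?_ hx
  generalize fiberPerm f _root_.id i x = y
  obtain ⟨⟨k, t⟩, rfl⟩ := finSigmaFinEquiv.surjective y
  rw [blockElt_mk, fiberEnum_congr f (congrFun hX k) t (by rw [congrFun hX k])]
  have e1 := finCongr_sum_congr
    (m := fun k => (fiber f (fiberEnum (_root_.id : Fin b → Fin b) i k : Fin b)).card)
    (m' := fun _ => (fiber f i).card)
    (funext fun k => by rw [congrFun hX k]) (Finset.sum_congr rfl fun k _ => by
          rw [congrFun hX k]) k t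
  have e2 := blockPerm_apply (fun _ => (fiber f i).card) e k (Fin.cast (by rw [congrFun hX k]) t)
  rw [e1]
  refine congrArg (fun z => ((fiberEnum f i z : fiber f i) : Fin a)) ?_
  refine (congrArg (finCongr _) e2).trans ?_
  exact finSigma_const_one _ _ _

theorem VHom.comp_id {a b : ℕ} (φ : VHom P a b) : φ.comp (VHom.id P a) = φ := by
  obtain ⟨f, u⟩ := φ
  refine VHom.ext' rfl fun i => ?_
  have h1 := P.γ_reindex_right _ (fun _ => 1) (u i) (fun _ => P.one)
    (fun k => finCongr (card_fiber_id (fiberEnum f i k : Fin a)))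
  change P.reindex (fiberPerm _root_.id f i) (P.γ _ (u i) fun k =>
    P.reindex (finCongr (card_fiber_id (fiberEnum f i k : Fin a))) P.one) = _
  rw [h1, P.γ_one]
  refine (P.reindex_refl _).symm.trans (reindex_eq_self (Equiv.refl _) _ _ _ _ (u i) rfl ?_)
  intro x
  apply (fiberEnum f i).injective
  apply Subtype.ext
  have hx := blockElt_fiberPerm _root_.id f i x
  refine Eq.trans ?_ hx
  change ((fiberEnum f i (finCongr _ (blockSum _ (fiberPerm _root_.id f i x))) : fiber f i) :
    Fin a) = _
  generalize fiberPerm _root_.id f i x = y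
  obtain ⟨⟨k, t⟩, rfl⟩ := finSigmaFinEquiv.surjective y
  rw [blockElt_mk]
  have ht : (fiberEnum (_root_.id : Fin a → Fin a) (fiberEnum f i k : Fin a) t : Fin a) =
    fiberEnum f i k := apply_fiberEnum _root_.id _ t
  rw [ht]
  have e2 : blockSum (m' := fun _ => 1)
      (fun k => finCongr (card_fiber_id (fiberEnum f i k : Fin a))) (finSigmaFinEquiv ⟨k, t⟩) =
      finSigmaFinEquiv (n := fun _ => 1) ⟨k, 0⟩ := by
    change finSigmaFinEquiv (Equiv.sigmaCongrRight _ (finSigmaFinEquiv.symm (finSigmaFinEquiv _))) = _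
    rw [Equiv.symm_apply_apply]
    exact congrArg _ (Sigma.ext rfl (heq_of_eq (Subsingleton.elim _ _)))
  refine congrArg (fun z => ((fiberEnum f i z : fiber f i) : Fin a)) ?_
  refine (congrArg (finCongr _) e2).trans ?_
  apply Fin.ext
  simp [finSigmaFinEquiv_apply]

/-- A square of the double category `Ω(P)₂` (or `𝒮(P)₂`) with horizontal maps `f`, `g` and vertical
maps `φ`, `ψ`:
`f : a → b` is the top, `g : c → d` the bottom, `φ : a ⇢ c` the left and `ψ : b ⇢ d` the right side.
The underlying square of sets is a pullback, and for every `z` the bijection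
`φ⁻¹(z) → ψ⁻¹(g z)` induced by `f` carries the decoration of `φ` at `z` to that of `ψ` at `g z`
(a bijection `h` acts on operations by `ω ↦ ω · h⁻¹`). -/
structure IsSquare {a b c d : ℕ} (f : Fin a → Fin b) (φ : VHom P a c) (ψ : VHom P b d)
    (g : Fin c → Fin d) : Prop where
  comm : ∀ x, ψ.toFun (f x) = g (φ.toFun x)
  pullback : ∀ y z, ψ.toFun y = g z → ∃! x, f x = y ∧ φ.toFun x = z
  dec : ∀ z, ∃ h : Fin (fiber φ.toFun z).card ≃ Fin (fiber ψ.toFun (g z)).card,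
    (∀ k, (fiberEnum ψ.toFun (g z) (h k) : Fin b) = f (fiberEnum φ.toFun z k)) ∧
      P.reindex h.symm (φ.dec z) = ψ.dec (g z)

/-- A double isomorphism `(f, u)` from `a` to `b`: a horizontal isomorphism `f` and a vertical
isomorphism `u` that form a square with two identities of `b`. -/
structure IsDoubleIso {a b : ℕ} (f : Fin a → Fin b) (u : VHom P a b) : Prop where
  horizontal : Function.Bijective f
  vertical : ∃ w : VHom P b a, u.comp w = VHom.id P b ∧ w.comp u = VHom.id P a
  square : IsSquare f u (VHom.id P b) (_root_.id : Fin b → Fin b)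

theorem card_fiber_equiv {a b : ℕ} (σ : Fin a ≃ Fin b) (y : Fin b) : (fiber σ y).card = 1 := by
  rw [Finset.card_eq_one]
  exact ⟨σ.symm y, by ext x; simp [mem_fiber, Equiv.eq_symm_apply]⟩

theorem card_fiber_incl {a : ℕ} (A : Finset (Fin a)) (y : Fin a) :
    (fiber (A.orderEmbOfFin rfl) y).card = if y ∈ A then 1 else 0 := by
  split_ifs with h
  · rw [Finset.card_eq_one]
    obtain ⟨x, hx⟩ : y ∈ Set.range (A.orderEmbOfFin rfl) := by
      rw [Finset.range_orderEmbOfFin]; exact h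
    refine ⟨x, ?_⟩
    ext z
    rw [mem_fiber, Finset.mem_singleton, ← hx, (A.orderEmbOfFin rfl).injective.eq_iff]
  · rw [Finset.card_eq_zero, Finset.eq_empty_iff_forall_notMem]
    intro x hx
    exact h (mem_fiber.1 hx ▸ A.orderEmbOfFin_mem rfl x)

variable (P) in
/-- The vertical map `(σ, (1, …, 1))` given by a bijection `σ`. -/
def VHom.ofEquiv {a b : ℕ} (σ : Fin a ≃ Fin b) : VHom P a b where
  toFun := σ
  dec y := P.reindex (finCongr (card_fiber_equiv σ y)) P.one

variable (P) in
/-- The inclusion of a subset `A` (identified with a standard set by its increasing enumeration),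
decorated with `1` at the elements of `A` and with `0` at the others. -/
def VHom.incl {a : ℕ} (A : Finset (Fin a)) : VHom P A.card a where
  toFun := A.orderEmbOfFin rfl
  dec y :=
    if h : y ∈ A then P.reindex (finCongr (by rw [card_fiber_incl, if_pos h])) P.one
    else P.reindex (finCongr (by rw [card_fiber_incl, if_neg h])) P.zero

/-- For `a = b + p`: the order preserving surjection `s_i^{a,b}` that sends
`i, i + 1, …, i + p` to `i` and is injective elsewhere. -/
def collapse {a b p : ℕ} (h : a = b + p) (i : Fin b) : Fin a → Fin b := fun x =>
  ⟨if (x : ℕ) ≤ i then x else if (x : ℕ) ≤ i + p then i else x - p, by split_ifs <;> omega⟩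

theorem collapse_surjective {a b p : ℕ} (h : a = b + p) (i : Fin b) :
    Function.Surjective (collapse h i) := by
  intro y
  by_cases hy : (y : ℕ) ≤ i
  · refine ⟨⟨y, by omega⟩, Fin.ext ?_⟩
    simp [collapse, hy]
  · refine ⟨⟨y + p, by omega⟩, Fin.ext ?_⟩
    simp only [collapse]
    split_ifs <;> omega

theorem card_fiber_collapse_self {a b p : ℕ} (h : a = b + p) (i : Fin b) :
    (fiber (collapse h i) i).card = p + 1 := by
  have e : (fiber (collapse h i) i).map Fin.valEmbedding = Finset.Icc (i : ℕ) (i + p) := by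
    ext x
    simp only [Finset.mem_map, mem_fiber, Fin.valEmbedding_apply, Finset.mem_Icc, collapse,
      Fin.ext_iff]
    constructor
    · rintro ⟨y, hy, rfl⟩
      split_ifs at hy <;> omega
    · rintro hx
      refine ⟨⟨x, by omega⟩, ?_, rfl⟩
      simp only
      split_ifs <;> omega
  rw [← Finset.card_map Fin.valEmbedding, e, Nat.card_Icc]
  omega

theorem card_fiber_collapse_of_ne {a b p : ℕ} (h : a = b + p) (i : Fin b) {y : Fin b}
    (hy : y ≠ i) : (fiber (collapse h i) y).card = 1 := by
  rw [Finset.card_eq_one]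
  obtain ⟨x, hx⟩ := collapse_surjective h i y
  refine ⟨x, ?_⟩
  ext z
  rw [mem_fiber, Finset.mem_singleton]
  refine ⟨fun hz => ?_, fun hz => hz ▸ hx⟩
  rw [Ne, Fin.ext_iff] at hy
  rw [Fin.ext_iff] at hx hz ⊢
  simp only [collapse] at hx hz
  split_ifs at hx hz <;> omega

/-- The vertical map `(s_i^{a,b}, ω)`, for `a = b + p` and `ω ∈ P(p + 1)`: the decoration is `ω` at
`i` and `1` elsewhere.  For `p = 0` this is `(id, (1, …, 1, ω, 1, …, 1))`, with `ω` at `i`. -/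
def VHom.block {a b p : ℕ} (h : a = b + p) (i : Fin b) (ω : P.Op (p + 1)) : VHom P a b where
  toFun := collapse h i
  dec y :=
    if hy : y = i then
      P.reindex (finCongr (by rw [hy, card_fiber_collapse_self])) ω
    else P.reindex (finCongr (card_fiber_collapse_of_ne h i hy)) P.one

theorem VHom.block_zero {b : ℕ} (i : Fin b) (ω : P.Op 1) :
    VHom.block (p := 0) rfl i ω = VHom.unary P (Function.update (fun _ => P.one) i ω) := by
  refine VHom.ext' ?_ ?_
  · funext x
    apply Fin.ext
    simp only [VHom.block, VHom.unary, collapse, _root_.id]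
    split_ifs <;> omega
  · intro y
    simp only [VHom.block, VHom.unary, SymSeq.reindex_trans]
    by_cases hy : y = i
    · subst hy
      simp only [dif_pos, Function.update_self]
      rfl
    · simp only [dif_neg hy, Function.update_of_ne hy]
      rfl

/-- A Janus functor `Ω(P)₂ → Ab`: abelian groups `M(n)`, a covariant functor `M_* = push` on the
category of surjections between the sets `{1, …, n}`, and a contravariant functor `M^* = pull` on
the category `Ω(P)` of decorated surjections, with the same values on objects. -/
structure Janus (P : UnitaryOperad.{u}) where
  /-- the groups `M(n)` -/
  obj : ℕ → Type v
  [grp : ∀ n, AddCommGroup (obj n)]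
  /-- the covariant functor `M_*` -/
  push : ∀ {a b : ℕ} (f : Fin a → Fin b), Function.Surjective f → (obj a →+ obj b)
  /-- the contravariant functor `M^*` -/
  pull : ∀ {a b : ℕ} (φ : VHom P a b), Function.Surjective φ.toFun → (obj b →+ obj a)
  push_id : ∀ n, push (id : Fin n → Fin n) Function.surjective_id = AddMonoidHom.id _
  push_comp : ∀ {a b c : ℕ} (f : Fin a → Fin b) (g : Fin b → Fin c)
    (hf : Function.Surjective f) (hg : Function.Surjective g),
    push (g ∘ f) (hg.comp hf) = (push g hg).comp (push f hf)
  pull_id : ∀ n, pull (VHom.id P n) Function.surjective_id = AddMonoidHom.id _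
  pull_comp : ∀ {a b c : ℕ} (φ : VHom P a b) (ψ : VHom P b c)
    (hφ : Function.Surjective φ.toFun) (hψ : Function.Surjective ψ.toFun),
    pull (ψ.comp φ) (hψ.comp hφ) = (pull φ hφ).comp (pull ψ hψ)

attribute [instance] Janus.grp

/-- The admissible subsets `A` of the corner of a square: the restrictions of `f` and `φ` to `A`
are both surjective. -/
def Admissible {a b c : ℕ} (f : Fin a → Fin b) (φ : VHom P a c) : Type :=
  {A : Finset (Fin a) // Function.Surjective (f ∘ (VHom.incl P A).toFun) ∧
    Function.Surjective (φ.comp (VHom.incl P A)).toFun}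

noncomputable instance {a b c : ℕ} (f : Fin a → Fin b) (φ : VHom P a c) :
    Fintype (Admissible f φ) :=
  @Fintype.ofFinite _ (Subtype.finite)

/-- Pseudo-Mackey functors `Ω(P)₂ → Ab`. -/
structure IsPseudoMackey (M : Janus.{u, v} P) : Prop where
  double_iso : ∀ {a b : ℕ} (f : Fin a → Fin b) (w : VHom P a b) (hf : Function.Surjective f)
    (hw : Function.Surjective w.toFun), IsDoubleIso f w →
    (M.push f hf).comp (M.pull w hw) = AddMonoidHom.id _
  square : ∀ {a b c d : ℕ} (f : Fin a → Fin b) (φ : VHom P a c) (ψ : VHom P b d)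
    (g : Fin c → Fin d) (_ : Function.Surjective f) (_ : Function.Surjective φ.toFun)
    (hψ : Function.Surjective ψ.toFun) (hg : Function.Surjective g), IsSquare f φ ψ g →
    (M.pull ψ hψ).comp (M.push g hg) =
      ∑ A : Admissible f φ, (M.push (f ∘ (VHom.incl P A.1).toFun) A.2.1).comp
        (M.pull (φ.comp (VHom.incl P A.1)) A.2.2)

/-! In the following operators, positions are counted from `0`: the index `i` stands for the
`(i + 1)`-st element. -/

/-- The transposition `τ_i` of `i` and `i + 1`. -/
def tau {n : ℕ} (i : Fin n) : Equiv.Perm (Fin (n + 1)) := Equiv.swap i.castSucc i.succ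

namespace Janus

variable (M : Janus.{u, v} P)

/-- `T_i = M_*(τ_i)` -/
def opT {n : ℕ} (i : Fin n) : M.obj (n + 1) →+ M.obj (n + 1) := M.push (tau i) (tau i).surjective

/-- `M^*(τ_i, (1, …, 1))` -/
def opT' {n : ℕ} (i : Fin n) : M.obj (n + 1) →+ M.obj (n + 1) :=
  M.pull (VHom.ofEquiv P (tau i)) (tau i).surjective

/-- `I_n^{α₁, …, αₙ} = M^*(id, (α₁, …, αₙ))` -/
def opI {n : ℕ} (α : Fin n → P.Op 1) : M.obj n →+ M.obj n :=
  M.pull (VHom.unary P α) Function.surjective_id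

/-- `P_i^a = M_*(s_i^a) : M(a) → M(b)`, where `a = b + 1` -/
def opP {a b : ℕ} (h : a = b + 1) (i : Fin b) : M.obj a →+ M.obj b :=
  M.push (collapse h i) (collapse_surjective h i)

/-- `H_i^{(a,b) ω} = M^*(s_i^{a,b}, ω) : M(b) → M(a)`, where `a = b + p` and `ω ∈ P(p + 1)`.
For `p = 0` it is `I_b^{1, …, 1, ω, 1, …, 1}`, with `ω` at `i`. -/
def opH {a b p : ℕ} (h : a = b + p) (i : Fin b) (ω : P.Op (p + 1)) : M.obj b →+ M.obj a :=
  M.pull (VHom.block h i ω) (collapse_surjective h i)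

theorem opH_zero {b : ℕ} (i : Fin b) (ω : P.Op 1) :
    M.opH (p := 0) rfl i ω = M.opI (Function.update (fun _ => P.one) i ω) := by
  unfold opH opI
  congr 1
  exact VHom.block_zero i ω

/-- For a list `v₁, …, v_r` of positions, the operator
`P_{v_r}^{b+1} ∘ ⋯ ∘ P_{v₂}^{b+r-1} ∘ P_{v₁}^{b+r} : M(b + r) → M(b)`. -/
def opPs {b : ℕ} : (L : List (Fin b)) → (M.obj (b + L.length) →+ M.obj b)
  | [] => AddMonoidHom.id _
  | v :: L => (opPs L).comp (M.opP (a := b + L.length + 1) rfl (v.castAdd L.length))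

end Janus

theorem sum_zero_one {n q : ℕ} {Z : Finset (Fin n)} (h : q + Z.card = n) :
    q = ∑ l, if l ∈ Z then 0 else 1 := by
  have h1 : ∑ l, (if l ∈ Z then 0 else 1) = Zᶜ.card := by
    rw [Finset.card_eq_sum_ones, Finset.compl_eq_univ_sdiff, Finset.sdiff_eq_filter,
      Finset.sum_filter]
    exact Finset.sum_congr rfl fun l _ => by split_ifs <;> rfl
  rw [h1, Finset.card_compl, Fintype.card_fin]
  omega

/-- `γ(α; ω₁, …, ωₙ) ∈ P(q)`, where `ω_l = 0` for `l ∈ Z` and `ω_l = 1` for `l ∉ Z`; here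
`q = n - |Z|`. -/
def UnitaryOperad.plugZeros (P : UnitaryOperad.{u}) {n : ℕ} (α : P.Op n) (Z : Finset (Fin n))
    (q : ℕ) (h : q + Z.card = n) : P.Op q :=
  P.reindex (finCongr (sum_zero_one h)) <|
    P.γ (fun l => if l ∈ Z then 0 else 1) α fun l =>
      if hl : l ∈ Z then P.reindex (finCongr (if_pos hl)) P.zero
      else P.reindex (finCongr (if_neg hl)) P.one

/-- The permutation `σ` of `n + 2k` letters (`n = N + 1`) which sends `i + p` to `i + 2p` and
`i + k + 1 + p` to `i + 2p + 1`, for `0 ≤ p ≤ k`, and fixes the other letters. -/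
def interleave {N : ℕ} (k : ℕ) (i : Fin N) : Equiv.Perm (Fin (N + 1 + 2 * k)) where
  toFun x := ⟨if (x : ℕ) < i then x else if (x : ℕ) ≤ i + k then i + 2 * (x - i)
    else if (x : ℕ) ≤ i + 2 * k + 1 then i + 2 * (x - (i + k + 1)) + 1 else x, by
      split_ifs <;> omega⟩
  invFun y := ⟨if (y : ℕ) < i then y else if (y : ℕ) ≤ i + 2 * k + 1 then
    (if ((y : ℕ) - i) % 2 = 0 then i + (y - i) / 2 else i + k + 1 + (y - i) / 2) else y, by
      split_ifs <;> omega⟩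
  left_inv x := by
    apply Fin.ext
    simp only
    split_ifs <;> omega
  right_inv y := by
    apply Fin.ext
    simp only
    split_ifs <;> omega

/-- The bijection obtained from the permutation `σ` by removing the columns `x ↦ σ x` with `x ∈ C`
and reindexing: the remaining arguments and the remaining values are numbered in increasing
order. -/
def removeColumns {m a b : ℕ} (σ : Equiv.Perm (Fin m)) (C : Finset (Fin m))
    (ha : Cᶜ.card = a) (hb : (Cᶜ.map σ.toEmbedding).card = b) : Fin a ≃ Fin b :=
  (Cᶜ.orderIsoOfFin ha).toEquiv.trans <|
    (σ.subtypeEquiv fun x => by simp).trans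
      ((Cᶜ.map σ.toEmbedding).orderIsoOfFin hb).toEquiv.symm

/-- The index set of the long relation.  A pair `(U₀, U₁)` stands for the positions
`u₁ < ⋯ < u_β` in `{i, …, i + k}` and the signs `ε₁, …, ε_β ∈ {0, 1}` with
`β - k ≤ ε₁ + ⋯ + ε_β ≤ k`: the set `U_e` consists of the `l` such that `i + l` is some `u_j` with
`ε_j = e`.  The pair `(∅, ∅)` (`β = 0`) is included; it gives the leading term. -/
abbrev LongIndex (k : ℕ) : Type :=
  {U : Finset (Fin (k + 1)) × Finset (Fin (k + 1)) //
    Disjoint U.1 U.2 ∧ U.1.card ≤ k ∧ U.2.card ≤ k}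

/-- The columns `u_j + ε_j (k + 1)`. -/
def LongIndex.columns {N k : ℕ} (i : Fin N) (U : LongIndex k) : Finset (Fin (N + 1 + 2 * k)) :=
  U.1.1.image (fun l : Fin (k + 1) => ⟨i + l, by omega⟩) ∪ U.1.2.image (fun l : Fin (k + 1) => ⟨i + (k + 1) + l, by omega⟩)

/-- The positions of `{i, …, i + k}` different from all the `u_j`, in increasing order. -/
def LongIndex.kept {N k : ℕ} (i : Fin N) (U : LongIndex k) : List (Fin (N + k)) :=
  ((U.1.1 ∪ U.1.2)ᶜ.sort (· ≤ ·)).map fun l : Fin (k + 1) => ⟨i + l, by omega⟩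

theorem LongIndex.card_columns {N k : ℕ} (i : Fin N) (U : LongIndex k) :
    (U.columns i).card = U.1.1.card + U.1.2.card := by
  unfold LongIndex.columns
  rw [Finset.card_union_of_disjoint, Finset.card_image_of_injective,
    Finset.card_image_of_injective]
  · intro x y h; simpa [Fin.ext_iff] using h
  · intro x y h; simpa [Fin.ext_iff] using h
  · rw [Finset.disjoint_left]
    intro x hx hy
    simp only [Finset.mem_image, Fin.ext_iff] at hx hy
    obtain ⟨l, -, hl⟩ := hx
    obtain ⟨l', -, hl'⟩ := hy
    omega

theorem LongIndex.card_union_le {k : ℕ} (U : LongIndex k) :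
    U.1.1.card + U.1.2.card ≤ k + 1 := by
  rw [← Finset.card_union_of_disjoint U.2.1]
  simpa using Finset.card_le_univ (U.1.1 ∪ U.1.2)

theorem LongIndex.length_kept {N k : ℕ} (i : Fin N) (U : LongIndex k) :
    (U.kept i).length = k + 1 - (U.1.1.card + U.1.2.card) := by
  rw [LongIndex.kept, List.length_map, Finset.length_sort, Finset.card_compl, Fintype.card_fin,
    Finset.card_union_of_disjoint U.2.1]

/-- The permutation of `n + 2k - β` letters (`n = N + 1`) obtained from `σ` by removing the columns
`u_j + ε_j (k + 1)` and reindexing. -/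
def LongIndex.perm {N k : ℕ} (i : Fin N) (U : LongIndex k) :
    Fin (N + 1 + (k - U.1.2.card) + (k - U.1.1.card)) ≃ Fin (N + k + (U.kept i).length) :=
  removeColumns (interleave k i) (U.columns i)
    (by
      have := U.2.2
      rw [Finset.card_compl, U.card_columns, Fintype.card_fin]; omega)
    (by
      have := U.card_union_le
      rw [Finset.card_map, Finset.card_compl, U.card_columns, Fintype.card_fin, U.length_kept]
      omega)

/-- The summand
`P_{i+k} ⋯ P̂_{u_β} ⋯ P̂_{u₁} ⋯ P_i M_*(σ_{u₁+ε₁(k+1), …}) H_i^{γ(α; ω)} H_{i+1}^{γ(α; ω')}` of the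
long relation, from `M(n)` to `M(n + k - 1)`, with `n = N + 1`.  Here `ω_l = 0` for the positions
with sign `0`, `ω'_l = 0` for those with sign `1`, and the other `ω_l`, `ω'_l` are `1`. -/
def Janus.longTerm (M : Janus.{u, v} P) {N k : ℕ} (i : Fin N) (α : P.Op (k + 1))
    (U : LongIndex k) : M.obj (N + 1) →+ M.obj (N + k) :=
  (M.opPs (U.kept i)).comp <| (M.push (U.perm i) (U.perm i).surjective).comp <|
    (M.opH (p := k - U.1.1.card) rfl (i.castSucc.castAdd (k - U.1.2.card))
      (P.plugZeros α U.1.1 _ (by have := U.2.2.1; omega))).comp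
    (M.opH (p := k - U.1.2.card) rfl i.succ (P.plugZeros α U.1.2 _ (by have := U.2.2.2; omega)))

/-- The presentation, for a general operad; `n = N + 1`, so that `i : Fin N` says `1 ≤ i < n`. -/
structure Relations (M : Janus.{u, v} P) : Prop where
  /-- `T_i = (M^*(τ_i, (1, …, 1)))⁻¹` -/
  rel_T : ∀ {N : ℕ} (i : Fin N), (M.opT i).comp (M.opT' i) = AddMonoidHom.id _ ∧
    (M.opT' i).comp (M.opT i) = AddMonoidHom.id _
  /-- `I^{α₁, …, α_{n-1}} P_i = P_i I^{α₁, …, α_{i-1}, α_i, α_i, …, α_{n-1}}` -/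
  rel_I : ∀ {N : ℕ} (i : Fin N) (α : Fin N → P.Op 1),
    (M.opI α).comp (M.opP (a := N + 1) rfl i) =
      (M.opP (a := N + 1) rfl i).comp (M.opI (α ∘ collapse (a := N + 1) rfl i))
  /-- `H_j^{(n+k-1,n-1) α} P_i^n = P_i^{n+k} H_{j+1}^{(n+k,n) α}` for `i < j` -/
  rel_lt : ∀ {N k : ℕ} (i j : Fin N) (α : P.Op (k + 1)), 1 ≤ k → i < j →
    (M.opH (a := N + k) rfl j α).comp (M.opP (a := N + 1) rfl i) =
      (M.opP (a := N + k + 1) rfl (i.castAdd k)).comp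
        (M.opH (a := N + k + 1) (by omega) j.succ α)
  /-- `H_j^{(n+k-1,n-1) α} P_i^n = P_{i+k}^{n+k} H_j^{(n+k,n) α}` for `j < i` -/
  rel_gt : ∀ {N k : ℕ} (i j : Fin N) (α : P.Op (k + 1)), 1 ≤ k → j < i →
    (M.opH (a := N + k) rfl j α).comp (M.opP (a := N + 1) rfl i) =
      (M.opP (a := N + k + 1) rfl (i.addNat k)).comp
        (M.opH (a := N + k + 1) (by omega) j.castSucc α)
  /-- the long relation -/
  rel_eq : ∀ {N k : ℕ} (i : Fin N) (α : P.Op (k + 1)), 1 ≤ k →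
    (M.opH (a := N + k) rfl i α).comp (M.opP (a := N + 1) rfl i) =
      ∑ U : LongIndex k, M.longTerm i α U

/-- The operad `P` is generated by operations of arity at most two: every family of subsets of the
`P(n)` that contains `0`, the unary and the binary operations and is closed under the symmetric
groups and under `γ` is everything.  This holds when `P` is generated by binary operations. -/
def BinaryGenerated (P : UnitaryOperad.{u}) : Prop :=
  ∀ S : ∀ n, Set (P.Op n), P.zero ∈ S 0 → (∀ x, x ∈ S 1) → (∀ x, x ∈ S 2) →
    (∀ n (x : P.Op n) (σ : Equiv.Perm (Fin n)), x ∈ S n → P.act x σ ∈ S n) →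
    (∀ n (m : Fin n → ℕ) (c : P.Op n) (d : ∀ i, P.Op (m i)),
      c ∈ S n → (∀ i, d i ∈ S (m i)) → P.γ m c d ∈ S (∑ i, m i)) →
    ∀ n (x : P.Op n), x ∈ S n

/-- `γ(α; 0, 1)` -/
def UnitaryOperad.zeroLeft (P : UnitaryOperad.{u}) (α : P.Op 2) : P.Op 1 :=
  P.plugZeros α {0} 1 rfl

/-- `γ(α; 1, 0)` -/
def UnitaryOperad.zeroRight (P : UnitaryOperad.{u}) (α : P.Op 2) : P.Op 1 :=
  P.plugZeros α {1} 1 rfl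

/-- The sequence `(1, …, 1, x, 1, …, 1)` with `x` at position `j`. -/
def UnitaryOperad.single (P : UnitaryOperad.{u}) {n : ℕ} (j : Fin n) (x : P.Op 1) :
    Fin n → P.Op 1 := Function.update (fun _ => P.one) j x

/-- The sequence `(1, …, 1, x, y, 1, …, 1)` with `x`, `y` at the positions `i`, `i + 1`. -/
def UnitaryOperad.double (P : UnitaryOperad.{u}) {N : ℕ} (i : Fin N) (x y : P.Op 1) :
    Fin (N + 1) → P.Op 1 := Function.update (P.single i.castSucc x) i.succ y

/-- The short relations, which involve only the operators `H` attached to `P(2)`. -/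
structure ShortRelations (M : Janus.{u, v} P) : Prop where
  rel_T : ∀ {N : ℕ} (i : Fin N), (M.opT i).comp (M.opT' i) = AddMonoidHom.id _ ∧
    (M.opT' i).comp (M.opT i) = AddMonoidHom.id _
  rel_I : ∀ {N : ℕ} (i : Fin N) (α : Fin N → P.Op 1),
    (M.opI α).comp (M.opP (a := N + 1) rfl i) =
      (M.opP (a := N + 1) rfl i).comp (M.opI (α ∘ collapse (a := N + 1) rfl i))
  rel_lt : ∀ {N : ℕ} (i j : Fin N) (α : P.Op 2), i < j →
    (M.opH (a := N + 1) (p := 1) rfl j α).comp (M.opP (a := N + 1) rfl i) =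
      (M.opP (a := N + 2) rfl i.castSucc).comp (M.opH (a := N + 2) (p := 1) rfl j.succ α)
  rel_gt : ∀ {N : ℕ} (i j : Fin N) (α : P.Op 2), j < i →
    (M.opH (a := N + 1) (p := 1) rfl j α).comp (M.opP (a := N + 1) rfl i) =
      (M.opP (a := N + 2) rfl i.succ).comp (M.opH (a := N + 2) (p := 1) rfl j.castSucc α)

/-- The `7`-term relation, at `1 ≤ i < n = N + 1`, for `α ∈ P(2)`, `x = γ(α; 0, 1)` and
`y = γ(α; 1, 0)`. -/
def SevenTerm (M : Janus.{u, v} P) {N : ℕ} (i : Fin N) (α : P.Op 2) : Prop :=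
  (M.opH (a := N + 1) (p := 1) rfl i α).comp (M.opP (a := N + 1) rfl i) =
    (M.opP (a := N + 2) rfl i.succ).comp ((M.opP (a := N + 3) rfl i.castSucc.castSucc).comp
      ((M.opT i.succ.castSucc).comp ((M.opH (a := N + 3) (p := 1) rfl i.castSucc.castSucc α).comp
        (M.opH (a := N + 2) (p := 1) rfl i.succ α)))) +
    (M.opP (a := N + 2) rfl i.succ).comp ((M.opT i.castSucc).comp
      ((M.opI (P.single i.castSucc.castSucc (P.zeroLeft α))).comp
        (M.opH (a := N + 2) (p := 1) rfl i.succ α))) +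
    (M.opP (a := N + 2) rfl i.succ).comp ((M.opH (a := N + 2) (p := 1) rfl i.castSucc α).comp
      (M.opI (P.single i.succ (P.zeroLeft α)))) +
    (M.opP (a := N + 2) rfl i.castSucc).comp
      ((M.opI (P.single i.castSucc.castSucc (P.zeroRight α))).comp
        (M.opH (a := N + 2) (p := 1) rfl i.succ α)) +
    (M.opP (a := N + 2) rfl i.castSucc).comp ((M.opT i.succ).comp
      ((M.opH (a := N + 2) (p := 1) rfl i.castSucc α).comp
        (M.opI (P.single i.succ (P.zeroRight α))))) +
    M.opI (P.double i (P.zeroRight α) (P.zeroLeft α)) +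
    (M.opT i).comp (M.opI (P.double i (P.zeroLeft α) (P.zeroRight α)))

/-- The `7`-term relation without unary operations in its second to fifth terms. -/
def SevenTermUnital (M : Janus.{u, v} P) {N : ℕ} (i : Fin N) (α : P.Op 2) : Prop :=
  (M.opH (a := N + 1) (p := 1) rfl i α).comp (M.opP (a := N + 1) rfl i) =
    (M.opP (a := N + 2) rfl i.succ).comp ((M.opP (a := N + 3) rfl i.castSucc.castSucc).comp
      ((M.opT i.succ.castSucc).comp ((M.opH (a := N + 3) (p := 1) rfl i.castSucc.castSucc α).comp
        (M.opH (a := N + 2) (p := 1) rfl i.succ α)))) +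
    (M.opP (a := N + 2) rfl i.succ).comp ((M.opT i.castSucc).comp
      (M.opH (a := N + 2) (p := 1) rfl i.succ α)) +
    (M.opP (a := N + 2) rfl i.succ).comp (M.opH (a := N + 2) (p := 1) rfl i.castSucc α) +
    (M.opP (a := N + 2) rfl i.castSucc).comp (M.opH (a := N + 2) (p := 1) rfl i.succ α) +
    (M.opP (a := N + 2) rfl i.castSucc).comp ((M.opT i.succ).comp
      (M.opH (a := N + 2) (p := 1) rfl i.castSucc α)) +
    M.opI (P.double i (P.zeroRight α) (P.zeroLeft α)) +
    (M.opT i).comp (M.opI (P.double i (P.zeroLeft α) (P.zeroRight α)))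

end PMack

/-! The first axiom of a pseudo-Mackey functor says that `M_*` and `M^*` of a permutation are
inverse to each other; since neighbouring transpositions generate the symmetric groups, this is
relation 1. Once it holds, isomorphic spans have the same operator (`term_equiv`). Any two pullback
corners of a given pair `(ψ, g)` are isomorphic, decorations included (`Sq.exists_equiv`), so the
square formula is a property of `(ψ, g)` alone and can be tested after relabelling all corners.

The engine is that the formula is compatible with pasting (`Sq.formula_vertical`,
`Sq.formula_horizontal`). Expanding it for one constituent gives a sum over subsets `S` of the
intermediate corner; the formula for the other constituent, restricted to `S`, then gives a sum over
pairs `(S, L)`, where `L` lies over `S`. The nonzero terms are those with `L` onto `S`, so they are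
indexed by the subsets `L` of the big corner, `S` being the image of `L` (`sum_pairs`). The second
constituent must be known together with its restrictions to admissible `S`. The induction in
`Janus.formulaUpTo` allows for this: it runs on `|A| - |D|`, the upper left corner against the lower
right one. Factoring `g` or `ψ` into two non-injective surjections makes the corner of one
constituent smaller and the lower right corner of the other one larger.

What cannot be factored is a `g` that glues two points, together with a `ψ` that is either bijective
with unary decorations or a single block. In coordinates these are the squares behind relation 2
(unary), relations 3 and 4 (block away from the glued point) and relation 5 (block at the glued
point). In the first three cases each point of the corner is alone in its fibre for one of the two
legs, so no proper subset is admissible and the sum has one term. In the last case the corner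
contains two copies of the block. An admissible subset omits sets of inputs `U₀`, `U₁` from the two
copies; they are disjoint because the top map stays onto, and neither is everything because the left
map stays onto. So an input has three states and two constant choices are excluded, which gives `3 ^
(k + 1) - 2` terms. The permutation `σ` sorts the corner by its image under the top map; what is
left is a composite of collapses.

For part (c), a block whose decoration is a nontrivial composite needs no relation, because `ψ`
factors. If the operad is generated in arity at most two, every operation of arity at least three is
such a composite (`BinaryGenerated.decomposable`): the stronger property that all its restrictions
to at least three inputs decompose is preserved by `γ`. Only `k = 1` remains, with `3 ^ 2 - 2 = 7`
terms.

Two devices keep this manageable. Decorations are read through arbitrary enumerations of the fibres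
(`HasDec`), which removes the permutations `σ_i` from the composition law. Non-surjective maps get
the operator `0`, so that the sums run over all subsets. -/

namespace PMack

variable {P : UnitaryOperad.{u}}

/-! ### Decorations read through an arbitrary enumeration of a fibre -/

/-- The function `j` enumerates the fibre of `f` over `y`. -/
structure Enumerates {X Y : Type*} (f : X → Y) (y : Y) {m : ℕ} (j : Fin m → X) : Prop where
  injective : Function.Injective j
  mem_iff : ∀ x, f x = y ↔ ∃ t, j t = x

theorem Enumerates.apply {X Y : Type*} {f : X → Y} {y : Y} {m : ℕ} {j : Fin m → X}
    (h : Enumerates f y j) (t : Fin m) : f (j t) = y := (h.mem_iff _).2 ⟨t, rfl⟩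

/-- Two enumerations of the same fibre differ by a permutation. -/
theorem Enumerates.exists_equiv {X Y Y' : Type*} {f : X → Y} {y : Y} {g : X → Y'} {y' : Y'}
    {m m' : ℕ} {j : Fin m → X} {j' : Fin m' → X} (h : Enumerates f y j) (h' : Enumerates g y' j')
    (hf : ∀ x, f x = y ↔ g x = y') : ∃ e : Fin m' ≃ Fin m, j ∘ e = j' := by
  have H : ∀ t, ∃ s, j s = j' t := fun t => (h.mem_iff _).1 ((hf _).2 (h'.apply t))
  choose e he using H
  have hb : Function.Bijective e := by
    refine ⟨fun s t hst => h'.injective ?_, fun s => ?_⟩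
    · rw [← he, ← he, hst]
    · obtain ⟨t, ht⟩ := (h'.mem_iff _).1 ((hf _).1 (h.apply s))
      exact ⟨t, h.injective ((he t).trans ht)⟩
  exact ⟨Equiv.ofBijective e hb, funext he⟩

theorem Enumerates.comp_equiv {X Y : Type*} {f : X → Y} {y : Y} {m m' : ℕ} {j : Fin m → X}
    (h : Enumerates f y j) (e : Fin m' ≃ Fin m) : Enumerates f y (j ∘ e) where
  injective := h.injective.comp e.injective
  mem_iff x := by
    rw [h.mem_iff]
    exact ⟨fun ⟨t, ht⟩ => ⟨e.symm t, by simp [ht]⟩, fun ⟨t, ht⟩ => ⟨e t, ht⟩⟩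

theorem exists_enumerates {X Y : Type*} [Finite X] (f : X → Y) (y : Y) :
    ∃ (m : ℕ) (j : Fin m → X), Enumerates f y j := by
  obtain ⟨n, ⟨e⟩⟩ := Finite.exists_equiv_fin {x // f x = y}
  refine ⟨n, fun t => (e.symm t).1, fun s t h => e.symm.injective (Subtype.ext h), fun x => ?_⟩
  exact ⟨fun h => ⟨e ⟨x, h⟩, by simp⟩, by rintro ⟨t, rfl⟩; exact (e.symm t).2⟩

theorem enumerates_fiberEnum {a b : ℕ} (f : Fin a → Fin b) (y : Fin b) :
    Enumerates f y (fun t => (fiberEnum f y t : Fin a)) where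
  injective s t h := (fiberEnum f y).injective (Subtype.ext h)
  mem_iff x := ⟨fun h => ⟨(fiberEnum f y).symm ⟨x, mem_fiber.2 h⟩, by simp⟩,
    by rintro ⟨t, rfl⟩; exact apply_fiberEnum f y t⟩

namespace VHom

/-- Read through the enumeration `j` of the fibre over `y`, the decoration of `φ` at `y` is `x`. -/
def HasDec {a b : ℕ} (φ : VHom P a b) (y : Fin b) {m : ℕ} (j : Fin m → Fin a) (x : P.Op m) : Prop :=
  ∃ E : Fin m ≃ Fin (fiber φ.toFun y).card,
    (∀ t, (fiberEnum φ.toFun y (E t) : Fin a) = j t) ∧ x = P.reindex E (φ.dec y)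

theorem hasDec_dec {a b : ℕ} (φ : VHom P a b) (y : Fin b) :
    φ.HasDec y (fun t => (fiberEnum φ.toFun y t : Fin a)) (φ.dec y) :=
  ⟨Equiv.refl _, fun _ => rfl, (P.reindex_refl _).symm⟩

theorem HasDec.reindex {a b : ℕ} {φ : VHom P a b} {y : Fin b} {m m' : ℕ} {j : Fin m → Fin a}
    {x : P.Op m} (h : φ.HasDec y j x) (e : Fin m' ≃ Fin m) :
    φ.HasDec y (j ∘ e) (P.reindex e x) := by
  obtain ⟨E, hE, rfl⟩ := h
  exact ⟨e.trans E, fun t => hE (e t), P.reindex_trans _ _ _⟩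

theorem HasDec.enumerates {a b : ℕ} {φ : VHom P a b} {y : Fin b} {m : ℕ} {j : Fin m → Fin a}
    {x : P.Op m} (h : φ.HasDec y j x) : Enumerates φ.toFun y j := by
  obtain ⟨E, hE, -⟩ := h
  have := (enumerates_fiberEnum φ.toFun y).comp_equiv E
  rwa [show (fun t => (fiberEnum φ.toFun y t : Fin a)) ∘ E = j from funext hE] at this

theorem exists_hasDec {a b : ℕ} (φ : VHom P a b) {y : Fin b} {m : ℕ} {j : Fin m → Fin a}
    (h : Enumerates φ.toFun y j) : ∃ x, φ.HasDec y j x := by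
  obtain ⟨e, rfl⟩ := (enumerates_fiberEnum φ.toFun y).exists_equiv h fun _ => Iff.rfl
  exact ⟨_, (φ.hasDec_dec y).reindex e⟩

theorem HasDec.unique {a b : ℕ} {φ : VHom P a b} {y : Fin b} {m : ℕ} {j : Fin m → Fin a}
    {x x' : P.Op m} (h : φ.HasDec y j x) (h' : φ.HasDec y j x') : x = x' := by
  obtain ⟨E, hE, rfl⟩ := h
  obtain ⟨E', hE', rfl⟩ := h'
  congr 1
  ext t : 1
  exact (fiberEnum φ.toFun y).injective (Subtype.ext ((hE t).trans (hE' t).symm))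

/-- One enumeration per point suffices, because reindexing along a bijection is invertible. -/
theorem ext_hasDec {a b : ℕ} {φ ψ : VHom P a b} (h : φ.toFun = ψ.toFun)
    (hd : ∀ y, ∃ (m : ℕ) (j : Fin m → Fin a) (x : P.Op m), φ.HasDec y j x ∧ ψ.HasDec y j x) :
    φ = ψ := by
  obtain ⟨f, ω⟩ := φ
  obtain ⟨g, ω'⟩ := ψ
  obtain rfl : f = g := h
  congr
  funext y
  obtain ⟨m, j, x, ⟨E, hE, hx⟩, ⟨E', hE', hx'⟩⟩ := hd y
  have : E = E' := by
    ext t : 1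
    exact (fiberEnum f y).injective (Subtype.ext ((hE t).trans (hE' t).symm))
  subst this
  have key := congrArg (P.reindex E.symm) (hx.symm.trans hx')
  simpa only [SymSeq.reindex_trans, Equiv.symm_trans_self, SymSeq.reindex_refl] using key

/-- Concatenating enumerations of the fibres of `φ` enumerates the composite fibre, and the
decoration read there is the bare `γ`: the permutation `fiberPerm` only compares this concatenation
with the natural order. Equivariance of `γ` on both sides takes care of the chosen enumerations. -/
theorem HasDec.comp {a b c : ℕ} {φ : VHom P a b} {ψ : VHom P b c} {z : Fin c} {n : ℕ}
    {i : Fin n → Fin b} {w : P.Op n} (hw : ψ.HasDec z i w) {m : Fin n → ℕ}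
    {j : ∀ k, Fin (m k) → Fin a} {d : ∀ k, P.Op (m k)} (hd : ∀ k, φ.HasDec (i k) (j k) (d k)) :
    (ψ.comp φ).HasDec z (fun x => j (finSigmaFinEquiv.symm x).1 (finSigmaFinEquiv.symm x).2)
      (P.γ m w d) := by
  obtain ⟨E, hE, rfl⟩ := hw
  obtain rfl : (fun k => (fiberEnum ψ.toFun z (E k) : Fin b)) = i := funext hE
  choose F hF hd using hd
  obtain rfl := funext hd
  have h1 := P.γ_reindex_right m (fun k => (fiber φ.toFun (fiberEnum ψ.toFun z (E k) : Fin b)).card)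
    (P.reindex E (ψ.dec z)) (fun k => φ.dec (fiberEnum ψ.toFun z (E k) : Fin b)) F
  have h2 := P.γ_reindex_left (fun k => (fiber φ.toFun (fiberEnum ψ.toFun z k : Fin b)).card)
    (ψ.dec z) (fun k => φ.dec (fiberEnum ψ.toFun z k : Fin b)) E
  suffices H : ∃ E' : Fin (∑ k, m k) ≃ Fin (fiber (ψ.toFun ∘ φ.toFun) z).card,
      (∀ t, (fiberEnum (ψ.toFun ∘ φ.toFun) z (E' t) : Fin a) =
        j (finSigmaFinEquiv.symm t).1 (finSigmaFinEquiv.symm t).2) ∧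
      P.γ m (P.reindex E (ψ.dec z))
          (fun k => P.reindex (F k) (φ.dec (fiberEnum ψ.toFun z (E k) : Fin b))) =
        P.reindex E' (P.reindex (fiberPerm φ.toFun ψ.toFun z)
          (P.γ _ (ψ.dec z) fun k => φ.dec (fiberEnum ψ.toFun z k : Fin b))) from H
  refine ⟨(blockSum F).trans ((blockPerm
    (fun k => (fiber φ.toFun (fiberEnum ψ.toFun z k : Fin b)).card) E).trans
      (fiberPerm φ.toFun ψ.toFun z).symm), ?_, ?_⟩
  · intro t
    obtain ⟨⟨k, s⟩, rfl⟩ := finSigmaFinEquiv.surjective t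
    rw [Equiv.symm_apply_apply, ← hF k s]
    have e1 : blockSum F (finSigmaFinEquiv ⟨k, s⟩) = finSigmaFinEquiv ⟨k, F k s⟩ := by
      simp [blockSum]
    have e2 := blockPerm_apply (fun k => (fiber φ.toFun (fiberEnum ψ.toFun z k : Fin b)).card) E k
      (F k s)
    rw [Equiv.trans_apply, e1, Equiv.trans_apply, e2,
      ← blockElt_fiberPerm φ.toFun ψ.toFun z, Equiv.apply_symm_apply]
    exact blockElt_mk φ.toFun ψ.toFun z (E k) (F k s)
  · rw [h1, h2, SymSeq.reindex_trans, SymSeq.reindex_trans]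
    congr 1
    ext t : 1
    simp

theorem exists_of_hasDec {a b : ℕ} (f : Fin a → Fin b) (m : Fin b → ℕ)
    (j : ∀ y, Fin (m y) → Fin a) (hj : ∀ y, Enumerates f y (j y)) (x : ∀ y, P.Op (m y)) :
    ∃ φ : VHom P a b, φ.toFun = f ∧ ∀ y, φ.HasDec y (j y) (x y) := by
  have H := fun y => (hj y).exists_equiv (enumerates_fiberEnum f y) fun _ => Iff.rfl
  choose e he using H
  refine ⟨⟨f, fun y => P.reindex (e y) (x y)⟩, rfl, fun y => ⟨(e y).symm, fun t => ?_, ?_⟩⟩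
  · rw [← show j y (e y ((e y).symm t)) = _ from congrFun (he y) _, Equiv.apply_symm_apply]
  · rw [SymSeq.reindex_trans, Equiv.symm_trans_self, SymSeq.reindex_refl]

end VHom

/-- The unit, or the element of `P(0)`. -/
def UnitaryOperad.point (P : UnitaryOperad.{u}) : (m : ℕ) → m ≤ 1 → P.Op m
  | 0, _ => P.zero
  | 1, _ => P.one

theorem UnitaryOperad.reindex_point (P : UnitaryOperad.{u}) {m m' : ℕ} (e : Fin m ≃ Fin m')
    (h' : m' ≤ 1) (h : m ≤ 1) : P.reindex e (P.point m' h') = P.point m h := by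
  obtain rfl := fin_card_eq e
  have : e = Equiv.refl _ := by
    ext t : 1
    have : Subsingleton (Fin m) := Fin.subsingleton_iff_le_one.2 h
    exact Subsingleton.elim _ _
  rw [this, SymSeq.reindex_refl]

/-- The vertical map given by an injection, decorated by `1` and `0`. -/
def VHom.ofInj (P : UnitaryOperad.{u}) {a b : ℕ} (f : Fin a → Fin b) (hf : Function.Injective f) :
    VHom P a b where
  toFun := f
  dec _ := P.point _ (Finset.card_le_one.2 fun _ hs _ ht =>
    hf ((mem_fiber.1 hs).trans (mem_fiber.1 ht).symm))

theorem VHom.ofInj_hasDec {a b : ℕ} (f : Fin a → Fin b) (hf : Function.Injective f) {y : Fin b}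
    {m : ℕ} {j : Fin m → Fin a} (h : Enumerates f y j) (hm : m ≤ 1) :
    (VHom.ofInj P f hf).HasDec y j (P.point m hm) := by
  obtain ⟨x, E, hE, hx⟩ := (VHom.ofInj P f hf).exists_hasDec h
  exact ⟨E, hE, (P.reindex_point _ _ _).symm⟩

/-! ### Finite types with a chosen enumeration -/

/-- A type with a chosen bijection onto a standard finite set. -/
class Enumerated (X : Type) where
  /-- the number of elements -/
  size : ℕ
  /-- the enumeration -/
  equiv : X ≃ Fin size

/-- The number of elements. -/
abbrev size (X : Type) [Enumerated X] : ℕ := Enumerated.size X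

/-- The chosen enumeration. -/
abbrev enum (X : Type) [Enumerated X] : X ≃ Fin (size X) := Enumerated.equiv

instance (n : ℕ) : Enumerated (Fin n) := ⟨n, Equiv.refl _⟩

theorem Enumerated.finite (X : Type) [Enumerated X] : Finite X := Finite.of_equiv _ (enum X).symm

/-- Some enumeration of a finite type. -/
noncomputable abbrev Enumerated.ofFinite (X : Type) [Finite X] : Enumerated X :=
  ⟨Nat.card X, Finite.equivFin X⟩

noncomputable instance {X : Type} [Enumerated X] (p : X → Prop) : Enumerated {x // p x} :=
  haveI := Enumerated.finite X
  Enumerated.ofFinite _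

noncomputable instance {X : Type} [Enumerated X] (S : Set X) : Enumerated S :=
  inferInstanceAs (Enumerated {x // x ∈ S})

noncomputable instance {X Y : Type} [Enumerated X] [Enumerated Y] : Enumerated (X ⊕ Y) :=
  haveI := Enumerated.finite X
  haveI := Enumerated.finite Y
  Enumerated.ofFinite _

noncomputable instance {X Y : Type} [Enumerated X] [Enumerated Y] : Enumerated (X × Y) :=
  haveI := Enumerated.finite X
  haveI := Enumerated.finite Y
  Enumerated.ofFinite _

variable (P) in
/-- Decorated maps between enumerated types. -/
structure DMap (X Y : Type) [Enumerated X] [Enumerated Y] where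
  /-- the decorated map between standard sets -/
  hom : VHom P (size X) (size Y)

namespace DMap

variable {X Y Z W : Type} [Enumerated X] [Enumerated Y] [Enumerated Z] [Enumerated W]

/-- The underlying map. -/
def fn (φ : DMap P X Y) : X → Y := fun x => (enum Y).symm (φ.hom.toFun (enum X x))

/-- Composition. -/
def comp (ψ : DMap P Y Z) (φ : DMap P X Y) : DMap P X Z := ⟨ψ.hom.comp φ.hom⟩

theorem comp_assoc (χ : DMap P Z W) (ψ : DMap P Y Z) (φ : DMap P X Y) :
    (χ.comp ψ).comp φ = χ.comp (ψ.comp φ) := congrArg DMap.mk (VHom.comp_assoc _ _ _)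

theorem fn_comp_apply (ψ : DMap P Y Z) (φ : DMap P X Y) (x : X) :
    (ψ.comp φ).fn x = ψ.fn (φ.fn x) := by
  simp [fn, comp, VHom.comp]

theorem fn_comp (ψ : DMap P Y Z) (φ : DMap P X Y) : (ψ.comp φ).fn = ψ.fn ∘ φ.fn :=
  funext (fn_comp_apply ψ φ)

end DMap
namespace DMap

variable {X Y Z W : Type} [Enumerated X] [Enumerated Y] [Enumerated Z] [Enumerated W]

/-- Read through the enumeration `j` of the fibre over `y`, the decoration of `φ` at `y` is `x`. -/
def HasDec (φ : DMap P X Y) (y : Y) {m : ℕ} (j : Fin m → X) (x : P.Op m) : Prop :=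
  φ.hom.HasDec (enum Y y) (enum X ∘ j) x

theorem enumerates_hom {φ : DMap P X Y} {y : Y} {m : ℕ} {j : Fin m → X} :
    Enumerates φ.hom.toFun (enum Y y) (enum X ∘ j) ↔ Enumerates φ.fn y j := by
  constructor
  · rintro ⟨h1, h2⟩
    refine ⟨h1.of_comp, fun x => ?_⟩
    rw [fn, Equiv.symm_apply_eq, h2]
    simp
  · rintro ⟨h1, h2⟩
    refine ⟨(enum X).injective.comp h1, fun x => ?_⟩
    obtain ⟨x, rfl⟩ := (enum X).surjective x
    have := h2 x
    rw [fn, Equiv.symm_apply_eq] at this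
    rw [this]
    simp

theorem HasDec.enumerates {φ : DMap P X Y} {y : Y} {m : ℕ} {j : Fin m → X} {x : P.Op m}
    (h : φ.HasDec y j x) : Enumerates φ.fn y j := enumerates_hom.1 (VHom.HasDec.enumerates h)

theorem HasDec.reindex {φ : DMap P X Y} {y : Y} {m m' : ℕ} {j : Fin m → X} {x : P.Op m}
    (h : φ.HasDec y j x) (e : Fin m' ≃ Fin m) : φ.HasDec y (j ∘ e) (P.reindex e x) :=
  VHom.HasDec.reindex h e

theorem exists_hasDec (φ : DMap P X Y) {y : Y} {m : ℕ} {j : Fin m → X}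
    (h : Enumerates φ.fn y j) : ∃ x, φ.HasDec y j x :=
  φ.hom.exists_hasDec (enumerates_hom.2 h)

theorem exists_dec (φ : DMap P X Y) (y : Y) :
    ∃ (m : ℕ) (j : Fin m → X) (x : P.Op m), φ.HasDec y j x := by
  have := Enumerated.finite X
  obtain ⟨m, j, hj⟩ := exists_enumerates φ.fn y
  obtain ⟨x, hx⟩ := φ.exists_hasDec hj
  exact ⟨m, j, x, hx⟩

theorem HasDec.unique {φ : DMap P X Y} {y : Y} {m : ℕ} {j : Fin m → X} {x x' : P.Op m}
    (h : φ.HasDec y j x) (h' : φ.HasDec y j x') : x = x' := VHom.HasDec.unique h h'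

/-- Changing the enumeration reindexes both decorations by the same bijection, so agreement along
`f` has to be checked only once. -/
theorem HasDec.transfer {φ : DMap P X Y} {ψ : DMap P Z W} {y : Y} {w : W} {f : X → Z} {m m' : ℕ}
    {j : Fin m → X} {x : P.Op m} {j' : Fin m' → X} {x' : P.Op m'} (h : φ.HasDec y j x)
    (hψ : ψ.HasDec w (f ∘ j) x) (h' : φ.HasDec y j' x') : ψ.HasDec w (f ∘ j') x' := by
  obtain ⟨e, rfl⟩ := h.enumerates.exists_equiv h'.enumerates fun _ => Iff.rfl
  obtain rfl := (h.reindex e).unique h'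
  exact hψ.reindex e

theorem ext_hasDec {φ ψ : DMap P X Y} (h : φ.fn = ψ.fn)
    (hd : ∀ y, ∃ (m : ℕ) (j : Fin m → X) (x : P.Op m), φ.HasDec y j x ∧ ψ.HasDec y j x) :
    φ = ψ := by
  have : φ.hom = ψ.hom := by
    refine VHom.ext_hasDec ?_ fun y => ?_
    · funext x
      have := congrFun h ((enum X).symm x)
      simpa [fn] using this
    · obtain ⟨m, j, x, h1, h2⟩ := hd ((enum Y).symm y)
      refine ⟨m, enum X ∘ j, x, ?_, ?_⟩
      · simpa [HasDec] using h1
      · simpa [HasDec] using h2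
  cases φ
  cases ψ
  exact congrArg DMap.mk this

theorem HasDec.comp {φ : DMap P X Y} {ψ : DMap P Y Z} {z : Z} {n : ℕ} {i : Fin n → Y} {w : P.Op n}
    (hw : ψ.HasDec z i w) {m : Fin n → ℕ} {j : ∀ k, Fin (m k) → X} {d : ∀ k, P.Op (m k)}
    (hd : ∀ k, φ.HasDec (i k) (j k) (d k)) :
    (ψ.comp φ).HasDec z (fun x => j (finSigmaFinEquiv.symm x).1 (finSigmaFinEquiv.symm x).2)
      (P.γ m w d) :=
  VHom.HasDec.comp (ψ := ψ.hom) (φ := φ.hom) hw hd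

theorem exists_of_hasDec (f : X → Y) (m : Y → ℕ) (j : ∀ y, Fin (m y) → X)
    (hj : ∀ y, Enumerates f y (j y)) (x : ∀ y, P.Op (m y)) :
    ∃ φ : DMap P X Y, φ.fn = f ∧ ∀ y, φ.HasDec y (j y) (x y) := by
  obtain ⟨φ, h1, h2⟩ := VHom.exists_of_hasDec (P := P) (enum Y ∘ f ∘ (enum X).symm)
    (fun y => m ((enum Y).symm y)) (fun y => enum X ∘ j ((enum Y).symm y)) (fun y => by
      refine ⟨(enum X).injective.comp (hj _).injective, fun x => ?_⟩
      have := (hj ((enum Y).symm y)).mem_iff ((enum X).symm x)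
      simp only [Function.comp_apply, ← Equiv.eq_symm_apply]
      exact this) (fun y => x ((enum Y).symm y))
  refine ⟨⟨φ⟩, ?_, fun y => ?_⟩
  · funext x
    simp [fn, h1]
  · have := h2 (enum Y y)
    simp only [HasDec]
    rwa [Equiv.symm_apply_apply] at this

/-- If the decoration of `ψ` at `z` is `1`, that of `ψ ∘ φ` is the one of `φ`. -/
theorem HasDec.comp_of_one_left {φ : DMap P X Y} {ψ : DMap P Y Z} {z : Z} {y : Y}
    (hψ : ψ.HasDec z (fun _ : Fin 1 => y) P.one) {m : ℕ} {j : Fin m → X} {x : P.Op m}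
    (hφ : φ.HasDec y j x) : (ψ.comp φ).HasDec z j x := by
  have h := hψ.comp (m := fun _ => m) (j := fun _ => j) (d := fun _ => x) fun _ => hφ
  rw [P.one_γ] at h
  have h' := h.reindex (finCongr (show m = ∑ _ : Fin 1, m by simp))
  rw [SymSeq.reindex_trans, show (finCongr (show m = ∑ _ : Fin 1, m by simp)).trans
    (finCongr (by simp)) = Equiv.refl _ by ext; simp, SymSeq.reindex_refl] at h'
  convert h' using 1
  funext t
  simp only [Function.comp_apply]
  obtain ⟨⟨k, s⟩, hs⟩ := finSigmaFinEquiv.surjective (finCongr (show m = ∑ _ : Fin 1, m by simp) t)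
  rw [← hs, Equiv.symm_apply_apply]
  have := finSigma_const_one k s (by simp)
  rw [hs] at this
  exact congrArg j (by simpa using this)

/-- If the decorations of `φ` over the fibre of `ψ` at `z` are `1`, the decoration of `ψ ∘ φ` is the
one of `ψ`. -/
theorem HasDec.comp_of_one_right {φ : DMap P X Y} {ψ : DMap P Y Z} {z : Z} {n : ℕ} {i : Fin n → Y}
    {w : P.Op n} (hψ : ψ.HasDec z i w) {j : Fin n → X}
    (hφ : ∀ k, φ.HasDec (i k) (fun _ : Fin 1 => j k) P.one) : (ψ.comp φ).HasDec z j w := by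
  have h := hψ.comp (m := fun _ => 1) (j := fun k _ => j k) (d := fun _ => P.one) hφ
  rw [P.γ_one] at h
  have h' := h.reindex (finCongr (show n = ∑ _ : Fin n, 1 by simp))
  rw [SymSeq.reindex_trans, show (finCongr (show n = ∑ _ : Fin n, 1 by simp)).trans
    (finCongr (by simp)) = Equiv.refl _ by ext; simp, SymSeq.reindex_refl] at h'
  convert h' using 1
  funext t
  simp only [Function.comp_apply]
  obtain ⟨⟨k, s⟩, hs⟩ := finSigmaFinEquiv.surjective (finCongr (show n = ∑ _ : Fin n, 1 by simp) t)
  rw [← hs, Equiv.symm_apply_apply]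
  congr 1
  have := congrArg Fin.val hs
  rw [finSigmaFinEquiv_apply] at this
  apply Fin.ext
  simpa using this.symm

/-! ### Injections -/

variable (P) in
/-- An injection, decorated by `1` at the points of its image and by `0` elsewhere. -/
def incl (i : X → Y) (hi : Function.Injective i) : DMap P X Y :=
  ⟨VHom.ofInj P (enum Y ∘ i ∘ (enum X).symm)
    ((enum Y).injective.comp (hi.comp (enum X).symm.injective))⟩

@[simp] theorem fn_incl (i : X → Y) (hi : Function.Injective i) : (incl P i hi).fn = i := by
  funext x
  simp [fn, incl, VHom.ofInj]

theorem incl_hasDec_point (i : X → Y) (hi : Function.Injective i) {y : Y} {m : ℕ} {j : Fin m → X}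
    (h : Enumerates i y j) (hm : m ≤ 1) : (incl P i hi).HasDec y j (P.point m hm) := by
  have h' : Enumerates (incl P i hi).hom.toFun (enum Y y) (enum X ∘ j) :=
    enumerates_hom.2 (by rwa [fn_incl])
  exact VHom.ofInj_hasDec (enum Y ∘ i ∘ (enum X).symm)
    ((enum Y).injective.comp (hi.comp (enum X).symm.injective)) h' hm

theorem incl_hasDec (i : X → Y) (hi : Function.Injective i) (x : X) :
    (incl P i hi).HasDec (i x) (fun _ : Fin 1 => x) P.one :=
  incl_hasDec_point i hi (j := fun _ : Fin 1 => x) ⟨fun _ _ _ => Subsingleton.elim _ _,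
    fun _ => ⟨fun h => ⟨0, (hi h).symm⟩, fun ⟨_, h⟩ => congrArg i h.symm⟩⟩ le_rfl

theorem incl_hasDec_zero (i : X → Y) (hi : Function.Injective i) {y : Y} (hy : y ∉ Set.range i) :
    (incl P i hi).HasDec y (Fin.elim0 : Fin 0 → X) P.zero :=
  incl_hasDec_point (m := 0) i hi ⟨fun t => t.elim0,
    fun x' => ⟨fun h => (hy ⟨x', h⟩).elim, fun ⟨t, _⟩ => t.elim0⟩⟩ zero_le_one

/-- Over an empty fibre the decoration is `0`. -/
theorem hasDec_zero (φ : DMap P X Y) {y : Y} (hy : y ∉ Set.range φ.fn) :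
    φ.HasDec y (Fin.elim0 : Fin 0 → X) P.zero := by
  obtain ⟨x, hx⟩ := φ.exists_hasDec (y := y) (j := (Fin.elim0 : Fin 0 → X)) ⟨fun t => t.elim0,
    fun x' => ⟨fun h => (hy ⟨x', h⟩).elim, fun ⟨t, _⟩ => t.elim0⟩⟩
  rwa [P.eq_zero x] at hx

theorem HasDec.comp_incl {φ : DMap P Y Z} {i : X → Y} (hi : Function.Injective i) {z : Z} {m : ℕ}
    {j : Fin m → X} {x : P.Op m} (h : φ.HasDec z (i ∘ j) x) :
    (φ.comp (incl P i hi)).HasDec z j x :=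
  h.comp_of_one_right fun k => incl_hasDec i hi (j k)

theorem HasDec.incl_comp {φ : DMap P X Y} {i : Y → Z} (hi : Function.Injective i) {y : Y} {m : ℕ}
    {j : Fin m → X} {x : P.Op m} (h : φ.HasDec y j x) :
    ((incl P i hi).comp φ).HasDec (i y) j x := (incl_hasDec i hi y).comp_of_one_left h

theorem fn_comp_incl (φ : DMap P Y Z) (i : X → Y) (hi : Function.Injective i) :
    (φ.comp (incl P i hi)).fn = φ.fn ∘ i := by rw [fn_comp, fn_incl]

theorem fn_incl_comp (φ : DMap P X Y) (i : Y → Z) (hi : Function.Injective i) :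
    ((incl P i hi).comp φ).fn = i ∘ φ.fn := by rw [fn_comp, fn_incl]

theorem hasDec_incl_comp_iff {φ : DMap P X Y} {i : Y → Z} (hi : Function.Injective i) {y : Y}
    {m : ℕ} {j : Fin m → X} {x : P.Op m} :
    ((incl P i hi).comp φ).HasDec (i y) j x ↔ φ.HasDec y j x := by
  refine ⟨fun h => ?_, fun h => h.incl_comp hi⟩
  have hj : Enumerates φ.fn y j := by
    refine ⟨h.enumerates.injective, fun x => ?_⟩
    rw [← h.enumerates.mem_iff, fn_incl_comp, Function.comp_apply, hi.eq_iff]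
  obtain ⟨x', hx'⟩ := φ.exists_hasDec hj
  rwa [h.unique (hx'.incl_comp hi)]

theorem incl_comp_incl (i : X → Y) (hi : Function.Injective i) (k : Y → Z)
    (hk : Function.Injective k) : (incl P k hk).comp (incl P i hi) = incl P (k ∘ i) (hk.comp hi) := by
  refine ext_hasDec (by simp [fn_comp]) fun z => ?_
  by_cases hz : z ∈ Set.range (k ∘ i)
  · obtain ⟨x, rfl⟩ := hz
    exact ⟨_, _, _, (incl_hasDec i hi x).incl_comp hk, incl_hasDec (k ∘ i) (hk.comp hi) x⟩
  · refine ⟨_, _, _, hasDec_zero _ ?_, incl_hasDec_zero _ _ hz⟩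
    rwa [fn_comp, fn_incl, fn_incl]

theorem incl_congr {i j : X → Y} (hi : Function.Injective i) (h : i = j) :
    incl P i hi = incl P j (h ▸ hi) := by subst h; rfl

theorem comp_incl_id (φ : DMap P X Y) {i : X → X} (h : Function.Injective i)
    (hi : i = id) : φ.comp (incl P i h) = φ := by
  subst hi
  refine ext_hasDec (by rw [fn_comp, fn_incl]; rfl) fun z => ?_
  obtain ⟨m, j, x, h⟩ := φ.exists_dec z
  exact ⟨m, j, x, HasDec.comp_incl (i := id) Function.injective_id h, h⟩

/-- A map whose image lies in the image of an injection factors through it. -/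
theorem exists_lift (χ : DMap P X Z) (i : Y → Z) (hi : Function.Injective i) (f : X → Y)
    (hf : i ∘ f = χ.fn) : ∃ φ : DMap P X Y, φ.fn = f ∧ (incl P i hi).comp φ = χ := by
  have H := fun y => χ.exists_dec (i y)
  choose m j x H using H
  obtain ⟨φ, h1, h2⟩ := exists_of_hasDec f m j (fun y => ⟨(H y).enumerates.injective, fun x => by
    rw [← (H y).enumerates.mem_iff, ← hf, Function.comp_apply, hi.eq_iff]⟩) x
  refine ⟨φ, h1, ext_hasDec (by rw [fn_incl_comp, h1, hf]) fun z => ?_⟩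
  by_cases hz : z ∈ Set.range i
  · obtain ⟨y, rfl⟩ := hz
    exact ⟨_, _, _, (h2 y).incl_comp hi, H y⟩
  · refine ⟨_, _, _, hasDec_zero _ ?_, hasDec_zero _ ?_⟩
    · rw [fn_incl_comp]
      exact fun ⟨x, hx⟩ => hz ⟨_, hx⟩
    · rw [← hf]
      exact fun ⟨x, hx⟩ => hz ⟨_, hx⟩

end DMap
-- Squares between enumerated types: pullbacks, restriction, pasting
theorem Enumerates.le_one {X Y : Type*} {i : X → Y} (hi : Function.Injective i) {y : Y} {m : ℕ}
    {j : Fin m → X} (h : Enumerates i y j) : m ≤ 1 := by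
  refine Fin.subsingleton_iff_le_one.1 ⟨fun s t => h.injective (hi ?_)⟩
  rw [h.apply, h.apply]

section

variable {A B C D E F A' B' C' D' : Type} [Enumerated A] [Enumerated B] [Enumerated C]
  [Enumerated D] [Enumerated E] [Enumerated F] [Enumerated A'] [Enumerated B'] [Enumerated C']
  [Enumerated D']

/-- The squares of the double category, for enumerated types. -/
structure Sq (f : A → B) (φ : DMap P A C) (ψ : DMap P B D) (g : C → D) : Prop where
  comm : ∀ a, ψ.fn (f a) = g (φ.fn a)
  pullback : ∀ b c, ψ.fn b = g c → ∃ a, f a = b ∧ φ.fn a = c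
  inj : ∀ a a', f a = f a' → φ.fn a = φ.fn a' → a = a'
  dec : ∀ c, ∃ (m : ℕ) (j : Fin m → A) (x : P.Op m), φ.HasDec c j x ∧ ψ.HasDec (g c) (f ∘ j) x

namespace Sq

theorem hasDec {f : A → B} {φ : DMap P A C} {ψ : DMap P B D} {g : C → D} (h : Sq f φ ψ g) {c : C}
    {m : ℕ} {j : Fin m → A} {x : P.Op m} (hx : φ.HasDec c j x) : ψ.HasDec (g c) (f ∘ j) x := by
  obtain ⟨m', j', x', h1, h2⟩ := h.dec c
  exact h1.transfer h2 hx

/-- In a pullback of sets `f` maps each fibre of `p` bijectively onto a fibre of `ψ`. An enumeration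
of the former is thus one of the latter, and the decoration of `φ` is forced to be what `ψ` shows
there. -/
theorem exists_of_pullback {ψ : DMap P B D} {g : C → D} {f : A → B} {p : A → C}
    (comm : ∀ a, ψ.fn (f a) = g (p a)) (pb : ∀ b c, ψ.fn b = g c → ∃ a, f a = b ∧ p a = c)
    (inj : ∀ a a', f a = f a' → p a = p a' → a = a') :
    ∃ φ : DMap P A C, φ.fn = p ∧ Sq f φ ψ g := by
  have := Enumerated.finite A
  choose m j hj using exists_enumerates p
  have hj' : ∀ c, Enumerates ψ.fn (g c) (f ∘ j c) := fun c => by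
    refine ⟨fun s t h => (hj c).injective (inj _ _ h ?_), fun b => ⟨fun h => ?_, ?_⟩⟩
    · rw [(hj c).apply, (hj c).apply]
    · obtain ⟨a, rfl, ha⟩ := pb b c h
      obtain ⟨t, rfl⟩ := ((hj c).mem_iff a).1 ha
      exact ⟨t, rfl⟩
    · rintro ⟨t, rfl⟩
      rw [Function.comp_apply, comm, (hj c).apply]
  choose x hx using fun c => ψ.exists_hasDec (hj' c)
  obtain ⟨φ, h1, h2⟩ := DMap.exists_of_hasDec p m j hj x
  subst h1
  exact ⟨φ, rfl, comm, pb, inj, fun c => ⟨_, _, _, h2 c, hx c⟩⟩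

/-- The standard model of the corner; it supplies the intermediate corners in the inductions. -/
theorem exists_sq (ψ : DMap P B D) (g : C → D) :
    ∃ φ : DMap P {p : C × B // g p.1 = ψ.fn p.2} C,
      Sq (fun p : {p : C × B // g p.1 = ψ.fn p.2} => p.1.2) φ ψ g := by
  obtain ⟨φ, -, h⟩ := exists_of_pullback (ψ := ψ) (g := g)
    (f := fun p : {p : C × B // g p.1 = ψ.fn p.2} => p.1.2) (p := fun p => p.1.1)
    (fun p => p.2.symm) (fun b c h => ⟨⟨(c, b), h.symm⟩, rfl, rfl⟩)
    (fun a a' h h' => Subtype.ext (Prod.ext h' h))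
  exact ⟨φ, h⟩

/-- Restriction to a subset of the upper right corner. -/
theorem restrict_right {f : A → B} {φ : DMap P A C} {ψ : DMap P B D} {g : C → D} (h : Sq f φ ψ g)
    {i : A' → A} (hi : Function.Injective i) {k : B' → B} (hk : Function.Injective k) {f' : A' → B'}
    (hf : k ∘ f' = f ∘ i) (hpre : ∀ a b', f a = k b' → ∃ a', i a' = a) :
    Sq f' (φ.comp (DMap.incl P i hi)) (ψ.comp (DMap.incl P k hk)) g := by
  have hf' := fun a' => congrFun hf a'
  simp only [Function.comp_apply] at hf'
  refine ⟨fun a => ?_, fun b' c h' => ?_, fun a a' h1 h2 => ?_, fun c => ?_⟩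
  · rw [DMap.fn_comp_incl, DMap.fn_comp_incl, Function.comp_apply, Function.comp_apply, hf', h.comm]
  · rw [DMap.fn_comp_incl, Function.comp_apply] at h'
    obtain ⟨a, h1, h2⟩ := h.pullback _ _ h'
    obtain ⟨a', rfl⟩ := hpre a b' h1
    refine ⟨a', hk ((hf' a').trans h1), ?_⟩
    rw [DMap.fn_comp_incl, Function.comp_apply, h2]
  · rw [DMap.fn_comp_incl, Function.comp_apply, Function.comp_apply] at h2
    exact hi (h.inj _ _ (by rw [← hf', ← hf', h1]) h2)
  · obtain ⟨n, j, x, h1, h2⟩ := h.dec c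
    have := Enumerated.finite A'
    choose m l hl using fun t => exists_enumerates i (j t)
    have hl' : ∀ t, Enumerates k (f (j t)) (f' ∘ l t) := fun t => by
      refine ⟨fun s s' hs => ?_, fun b' => ⟨fun hb => ?_, ?_⟩⟩
      · refine (hl t).injective (hi ?_)
        rw [(hl t).apply, (hl t).apply]
      · obtain ⟨a', ha'⟩ := hpre _ _ hb.symm
        obtain ⟨s, rfl⟩ := ((hl t).mem_iff a').1 ha'
        exact ⟨s, hk (by rw [Function.comp_apply, hf', ha', hb])⟩
      · rintro ⟨s, rfl⟩
        rw [Function.comp_apply, hf', (hl t).apply]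
    exact ⟨_, _, _, h1.comp fun t => DMap.incl_hasDec_point i hi (hl t) ((hl t).le_one hi),
      h2.comp (j := fun t => f' ∘ l t) fun t =>
        DMap.incl_hasDec_point k hk (hl' t) ((hl' t).le_one hk)⟩

/-- Restriction to a subset of the lower left corner. -/
theorem restrict_left {f : A → B} {φ : DMap P A C} {ψ : DMap P B D} {g : C → D} (h : Sq f φ ψ g)
    {i : A' → A} (hi : Function.Injective i) {k : C' → C} (hk : Function.Injective k)
    {φ' : DMap P A' C'} (hφ : (DMap.incl P k hk).comp φ' = φ.comp (DMap.incl P i hi))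
    (hpre : ∀ a c', φ.fn a = k c' → ∃ a', i a' = a) : Sq (f ∘ i) φ' ψ (g ∘ k) := by
  have hf : ∀ a', k (φ'.fn a') = φ.fn (i a') := fun a' => by
    have := congrFun (congrArg DMap.fn hφ) a'
    rwa [DMap.fn_incl_comp, DMap.fn_comp_incl] at this
  refine ⟨fun a => ?_, fun b c' h' => ?_, fun a a' h1 h2 => ?_, fun c' => ?_⟩
  · rw [Function.comp_apply, Function.comp_apply, hf, h.comm]
  · obtain ⟨a, h1, h2⟩ := h.pullback _ _ h'
    obtain ⟨a', rfl⟩ := hpre a c' h2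
    exact ⟨a', h1, hk ((hf a').trans h2)⟩
  · exact hi (h.inj _ _ h1 (by rw [← hf, ← hf, h2]))
  · obtain ⟨n, j, x, h1, h2⟩ := h.dec (k c')
    have H := fun t => hpre (j t) c' (h1.enumerates.apply t)
    choose j' hj' using H
    obtain rfl : i ∘ j' = j := funext hj'
    refine ⟨_, j', x, ?_, h2⟩
    rw [← DMap.hasDec_incl_comp_iff hk, hφ]
    exact h1.comp_incl hi

/-- The left part of a horizontal composite. -/
theorem of_horizontal {f' : B → B'} {ψ : DMap P B D} {χ : DMap P B' D'} {g' : D → D'}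
    (h' : Sq f' ψ χ g') {g : C → D} {f : A → B} {φ : DMap P A C} (h : Sq (f' ∘ f) φ χ (g' ∘ g))
    (hf : ∀ a, ψ.fn (f a) = g (φ.fn a)) : Sq f φ ψ g := by
  refine ⟨hf, fun b c hbc => ?_, fun a a' h1 h2 => h.inj _ _ (congrArg f' h1) h2, fun c => ?_⟩
  · obtain ⟨a, h1, h2⟩ := h.pullback (f' b) c (by rw [h'.comm, hbc]; rfl)
    exact ⟨a, h'.inj _ _ h1 (by rw [hf, h2, hbc]), h2⟩
  · obtain ⟨m, j, x, h1, h2⟩ := h.dec c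
    have hj : Enumerates ψ.fn (g c) (f ∘ j) := by
      refine ⟨fun s t hst => h2.enumerates.injective (congrArg f' hst), fun b => ⟨fun hb => ?_, ?_⟩⟩
      · obtain ⟨t, ht⟩ := (h2.enumerates.mem_iff (f' b)).1 (by rw [h'.comm, hb]; rfl)
        refine ⟨t, h'.inj _ _ ht ?_⟩
        rw [Function.comp_apply, hf, h1.enumerates.apply, hb]
      · rintro ⟨t, rfl⟩
        rw [Function.comp_apply, hf, h1.enumerates.apply]
    obtain ⟨x', hx'⟩ := ψ.exists_hasDec hj
    have := h'.hasDec hx'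
    obtain rfl := this.unique h2
    exact ⟨m, j, _, h1, hx'⟩

/-- The upper part of a vertical composite. -/
theorem exists_of_vertical {g' : C → D} {φ' : DMap P C E} {ψ' : DMap P D F} {h : E → F}
    (h' : Sq g' φ' ψ' h) {f : A → B} {Φ : DMap P A E} {ψ : DMap P B D} (H : Sq f Φ (ψ'.comp ψ) h)
    {p : A → C} (hp : φ'.fn ∘ p = Φ.fn) (hp' : ψ.fn ∘ f = g' ∘ p) :
    ∃ φ : DMap P A C, φ.fn = p ∧ Sq f φ ψ g' ∧ φ'.comp φ = Φ := by
  have hp1 : ∀ a, φ'.fn (p a) = Φ.fn a := fun a => congrFun hp a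
  have hp2 : ∀ a, ψ.fn (f a) = g' (p a) := fun a => congrFun hp' a
  obtain ⟨φ, h1, h2⟩ := exists_of_pullback (ψ := ψ) (g := g') (f := f) (p := p) hp2
    (fun b c hbc => by
      obtain ⟨a, ha, ha'⟩ := H.pullback b (φ'.fn c) (by rw [DMap.fn_comp_apply, hbc, h'.comm])
      exact ⟨a, ha, h'.inj _ _ (by rw [← hp2, ha, hbc]) (by rw [hp1, ha'])⟩)
    (fun a a' ha ha' => H.inj _ _ ha (by rw [← hp1, ← hp1, ha']))
  refine ⟨φ, h1, h2, DMap.ext_hasDec (by rw [DMap.fn_comp, h1, hp]) fun e => ?_⟩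
  obtain ⟨n, i, c, hc, hc'⟩ := h'.dec e
  choose m j d hd using fun k => φ.exists_dec (i k)
  have k1 := hc.comp hd
  have k2 := hc'.comp (j := fun k => f ∘ j k) fun k => h2.hasDec (hd k)
  refine ⟨_, _, _, k1, ?_⟩
  obtain ⟨x, hx⟩ := Φ.exists_hasDec (y := e) (j := fun x : Fin (∑ k, m k) =>
    j (finSigmaFinEquiv.symm x).1 (finSigmaFinEquiv.symm x).2) (by
      have := k1.enumerates
      rwa [DMap.fn_comp, h1, hp] at this)
  have k3 := H.hasDec hx
  rwa [← k3.unique k2]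

/-- Relabels three corners and leaves the upper left one alone, so that a sum over its subsets keeps
its index set. -/
theorem of_equiv {B₀ C₀ D₀ : Type} [Enumerated B₀] [Enumerated C₀] [Enumerated D₀]
    {f : A → B₀} {φ : DMap P A C₀} {ψ₀ : DMap P B₀ D₀} {g₀ : C₀ → D₀} (h : Sq f φ ψ₀ g₀)
    (eB : B ≃ B₀) (eC : C ≃ C₀) (eD : D ≃ D₀) {ψ : DMap P B D} {g : C → D}
    (hψ : (DMap.incl P eD eD.injective).comp ψ = ψ₀.comp (DMap.incl P eB eB.injective))
    (hg : eD ∘ g = g₀ ∘ eC) :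
    Sq (eB.symm ∘ f) ((DMap.incl P eC.symm eC.symm.injective).comp φ) ψ g := by
  have hψ' : ∀ b, eD (ψ.fn b) = ψ₀.fn (eB b) := fun b => by
    have := congrFun (congrArg DMap.fn hψ) b
    rwa [DMap.fn_incl_comp, DMap.fn_comp_incl] at this
  have hg' : ∀ c, eD (g c) = g₀ (eC c) := congrFun hg
  refine ⟨fun a => eD.injective ?_, fun b c hbc => ?_, fun a a' h1 h2 => ?_, fun c => ?_⟩
  · rw [hψ', hg', Function.comp_apply, Equiv.apply_symm_apply, h.comm, DMap.fn_incl_comp,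
      Function.comp_apply, Equiv.apply_symm_apply]
  · obtain ⟨a, h1, h2⟩ := h.pullback (eB b) (eC c) (by rw [← hψ', hbc, hg'])
    exact ⟨a, by simp [h1], by simp [DMap.fn_incl_comp, h2]⟩
  · rw [DMap.fn_incl_comp] at h2
    exact h.inj _ _ (eB.symm.injective h1) (eC.symm.injective h2)
  · obtain ⟨m, j, x, h1, h2⟩ := h.dec (eC c)
    refine ⟨m, j, x, ?_, ?_⟩
    · have := h1.incl_comp eC.symm.injective
      rwa [Equiv.symm_apply_apply] at this
    · rw [← DMap.hasDec_incl_comp_iff eD.injective, hψ, hg']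
      refine DMap.HasDec.comp_incl _ ?_
      convert h2 using 1
      funext t
      simp

end Sq
end
-- Operators of spans and the square formula
theorem VHom.ofInj_eq_ofEquiv {a b : ℕ} (σ : Fin a ≃ Fin b) :
    VHom.ofInj P σ σ.injective = VHom.ofEquiv P σ := by
  have h : (VHom.ofInj P σ σ.injective).dec = (VHom.ofEquiv P σ).dec :=
    funext fun y => (P.reindex_point (finCongr (card_fiber_equiv σ y)) le_rfl _).symm
  exact congrArg (VHom.mk (σ : Fin a → Fin b)) h

/-- Reindexing for pasting: a pair `(S, L)` with `L` mapping onto `S` is the same as the subset `L`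
of `A`, since `S` is then the image of `L`. All other pairs contribute zero by `ht`. -/
theorem sum_pairs {A K G : Type*} [Fintype A] [Fintype K] [AddCommMonoid G] (π : A → K)
    [∀ S : Set K, Fintype ↥(π ⁻¹' S)] (t : ∀ S : Set K, Set ↥(π ⁻¹' S) → G)
    (ht : ∀ S L, (¬ ∀ k ∈ S, ∃ a ∈ L, π a.1 = k) → t S L = 0) :
    ∑ S, ∑ L, t S L = ∑ L : Set A, t (π '' L) {a | a.1 ∈ L} := by
  rw [← Fintype.sum_sigma' (fun S L => t S L)]
  symm
  refine Finset.sum_of_injOn (fun L : Set A => ⟨π '' L, {a | a.1 ∈ L}⟩) ?_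
    (fun _ _ => Finset.mem_coe.2 (Finset.mem_univ _)) ?_ fun _ _ => rfl
  · intro L _ L' _ h
    have h1 : ∀ {L L' : Set A}, (⟨π '' L, {a | a.1 ∈ L}⟩ : Σ S : Set K, Set ↥(π ⁻¹' S)) =
        ⟨π '' L', {a | a.1 ∈ L'}⟩ → L ⊆ L' := by
      intro L L' h a ha
      have key : ∀ p : Σ S : Set K, Set ↥(π ⁻¹' S),
          p = (⟨π '' L', {a | a.1 ∈ L'}⟩ : Σ S : Set K, Set ↥(π ⁻¹' S)) →
          ∀ a, ∀ h : π a ∈ p.1, (⟨a, h⟩ : {a // π a ∈ p.1}) ∈ p.2 → a ∈ L' := by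
        rintro p rfl a h h'
        exact h'
      exact key _ h a ⟨a, ha, rfl⟩ ha
    exact Set.Subset.antisymm (h1 h) (h1 h.symm)
  · rintro ⟨S, L⟩ - hSL
    refine ht S L fun hs => hSL ⟨Subtype.val '' L, Finset.mem_coe.2 (Finset.mem_univ _), ?_⟩
    have hS : π '' (Subtype.val '' L) = S := by
      ext k
      constructor
      · rintro ⟨-, ⟨a, -, rfl⟩, rfl⟩
        exact a.2
      · intro hk
        obtain ⟨a, ha, rfl⟩ := hs k hk
        exact ⟨a, ⟨a, ha, rfl⟩, rfl⟩
    refine Sigma.ext hS ?_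
    have key : ∀ S', S' = S → HEq ({a | a.1 ∈ Subtype.val '' L} : Set ↥(π ⁻¹' S')) L := by
      rintro _ rfl
      refine heq_of_eq (Set.ext fun a => ?_)
      simp only [Set.mem_ofPred_eq, Set.mem_image, Subtype.exists, exists_and_right, exists_eq_right]
      exact ⟨fun ⟨_, h⟩ => h, fun h => ⟨a.2, h⟩⟩
    exact key _ hS

namespace Janus

variable (M : Janus.{u, v} P)
variable {A B C D X Y Z : Type} [Enumerated A] [Enumerated B] [Enumerated C] [Enumerated D]
  [Enumerated X] [Enumerated Y] [Enumerated Z]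

open Classical in
/-- The covariant functor on maps of enumerated types; `0` on maps that are not surjective. -/
noncomputable def ps (f : X → Y) : M.obj (size X) →+ M.obj (size Y) :=
  if h : Function.Surjective f then M.push (enum Y ∘ f ∘ (enum X).symm)
    ((enum Y).surjective.comp (h.comp (enum X).symm.surjective)) else 0

theorem surjective_hom {φ : DMap P X Y} :
    Function.Surjective φ.hom.toFun ↔ Function.Surjective φ.fn := by
  have : φ.fn = (enum Y).symm ∘ φ.hom.toFun ∘ enum X := rfl
  rw [this, (enum Y).symm.comp_surjective, (enum X).surjective_comp]

open Classical in
/-- The contravariant functor on decorated maps; `0` on maps that are not surjective. -/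
noncomputable def pl (φ : DMap P X Y) : M.obj (size Y) →+ M.obj (size X) :=
  if h : Function.Surjective φ.fn then M.pull φ.hom (surjective_hom.2 h) else 0

theorem ps_of_not_surjective {f : X → Y} (h : ¬ Function.Surjective f) : M.ps f = 0 := dif_neg h

theorem pl_of_not_surjective {φ : DMap P X Y} (h : ¬ Function.Surjective φ.fn) : M.pl φ = 0 :=
  dif_neg h

theorem ps_fin {a b : ℕ} (f : Fin a → Fin b) (h : Function.Surjective f) : M.ps f = M.push f h :=
  dif_pos h

theorem pl_fin {a b : ℕ} (φ : VHom P a b) (h : Function.Surjective φ.toFun) :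
    M.pl (⟨φ⟩ : DMap P (Fin a) (Fin b)) = M.pull φ h := dif_pos h

theorem push_congr {a b : ℕ} {f g : Fin a → Fin b} (h : f = g) (hf : Function.Surjective f) :
    M.push f hf = M.push g (h ▸ hf) := by subst h; rfl

theorem pull_congr {a b : ℕ} {φ ψ : VHom P a b} (h : φ = ψ) (hf : Function.Surjective φ.toFun) :
    M.pull φ hf = M.pull ψ (h ▸ hf) := by subst h; rfl

/-- If `g` is not surjective, neither is the composite, and both sides have the default value `0`.
Surjectivity of `f` is the essential hypothesis here; in `pl_comp` it is that of `φ`. -/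
theorem ps_comp {f : X → Y} (hf : Function.Surjective f) (g : Y → Z) :
    M.ps (g ∘ f) = (M.ps g).comp (M.ps f) := by
  by_cases hg : Function.Surjective g
  · rw [ps, ps, ps, dif_pos hf, dif_pos hg, dif_pos (hg.comp hf), ← M.push_comp]
    refine M.push_congr ?_ _
    funext x
    simp
  · rw [M.ps_of_not_surjective hg, M.ps_of_not_surjective fun h => hg h.of_comp]
    rfl

theorem pl_comp {φ : DMap P X Y} (hφ : Function.Surjective φ.fn) (ψ : DMap P Y Z) :
    M.pl (ψ.comp φ) = (M.pl φ).comp (M.pl ψ) := by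
  by_cases hψ : Function.Surjective ψ.fn
  · have h : Function.Surjective (ψ.comp φ).fn := by rw [DMap.fn_comp]; exact hψ.comp hφ
    rw [pl, pl, pl, dif_pos hφ, dif_pos hψ, dif_pos h, ← M.pull_comp]
    rfl
  · have h : ¬ Function.Surjective (ψ.comp φ).fn := by
      rw [DMap.fn_comp]; exact fun h => hψ h.of_comp
    rw [M.pl_of_not_surjective hψ, M.pl_of_not_surjective h, AddMonoidHom.comp_zero]

theorem ps_id {f : X → X} (hf : f = id) : M.ps f = AddMonoidHom.id _ := by
  subst hf
  rw [ps, dif_pos Function.surjective_id, ← M.push_id]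
  refine M.push_congr ?_ _
  funext x
  simp

/-- The covariant and the contravariant action of a permutation are inverse to each other. -/
def PermInverse : Prop := ∀ (n : ℕ) (σ : Equiv.Perm (Fin n)),
  (M.push σ σ.surjective).comp (M.pull (VHom.ofEquiv P σ) σ.surjective) = AddMonoidHom.id _

variable {M}

namespace PermInverse

variable (hM : M.PermInverse)
include hM

theorem ps_comp_pl (e : X ≃ Y) :
    (M.ps e).comp (M.pl (DMap.incl P e e.injective)) = AddMonoidHom.id _ := by
  have key : ∀ {a b : ℕ} (σ : Fin a ≃ Fin b), (M.push σ σ.surjective).comp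
      (M.pull (VHom.ofInj P σ σ.injective) σ.surjective) = AddMonoidHom.id _ := by
    intro a b σ
    obtain rfl := fin_card_eq σ
    have h := M.pull_congr (VHom.ofInj_eq_ofEquiv (P := P) σ) σ.surjective
    exact (congrArg (fun F => (M.push σ σ.surjective).comp F) h).trans (hM _ σ)
  rw [ps, pl, dif_pos e.surjective, dif_pos (by rw [DMap.fn_incl]; exact e.surjective)]
  exact key ((enum X).symm.trans (e.trans (enum Y)))

theorem pl_incl (e : X ≃ Y) : M.pl (DMap.incl P e e.injective) = M.ps e.symm := by
  have h := congrArg (fun F => (M.ps e.symm).comp F) (hM.ps_comp_pl e)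
  simp only [← AddMonoidHom.comp_assoc] at h
  rw [← M.ps_comp e.surjective, M.ps_id (by funext x; simp)] at h
  exact h

theorem pl_comp_ps (e : X ≃ Y) :
    (M.pl (DMap.incl P e e.injective)).comp (M.ps e) = AddMonoidHom.id _ := by
  rw [hM.pl_incl, ← M.ps_comp e.surjective, M.ps_id (by funext x; simp)]

end PermInverse

variable (M) in
/-- The operator of a span. -/
noncomputable def term (f : X → B) (φ : DMap P X C) : M.obj (size C) →+ M.obj (size B) :=
  (M.ps f).comp (M.pl φ)

/-- The bijection contributes `M_*(e) M^*(e) = 1` in the middle of the span. Hence the enumerations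
chosen for subsets do not matter. -/
theorem PermInverse.term_equiv (hM : M.PermInverse) (e : X ≃ Y) (f : Y → B) (φ : DMap P Y C) :
    M.term (f ∘ e) (φ.comp (DMap.incl P e e.injective)) = M.term f φ := by
  rw [term, M.ps_comp e.surjective, M.pl_comp (by rw [DMap.fn_incl]; exact e.surjective),
    AddMonoidHom.comp_assoc, ← AddMonoidHom.comp_assoc (M.pl φ), hM.ps_comp_pl]
  rfl

theorem PermInverse.term_equiv' (hM : M.PermInverse) (e : X ≃ Y) {f : Y → B} {φ : DMap P Y C}
    {f' : X → B} {φ' : DMap P X C} (hf : f ∘ e = f')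
    (hφ : φ.comp (DMap.incl P e e.injective) = φ') : M.term f' φ' = M.term f φ := by
  rw [← hf, ← hφ, hM.term_equiv]

variable (M) in
/-- The sum of the operators of the subspans of a span. -/
noncomputable def termSum [Fintype A] (f : A → B) (φ : DMap P A C) :
    M.obj (size C) →+ M.obj (size B) :=
  ∑ S : Set A, M.term (fun a : S => f a)
    (φ.comp (DMap.incl P (fun a : S => (a : A)) Subtype.val_injective))

theorem PermInverse.termSum_equiv (hM : M.PermInverse) [Fintype X] [Fintype Y] (e : X ≃ Y)
    {f : Y → B} {φ : DMap P Y C} {f' : X → B} {φ' : DMap P X C} (hf : f ∘ e = f')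
    (hφ : φ.comp (DMap.incl P e e.injective) = φ') : M.termSum f' φ' = M.termSum f φ := by
  subst hf hφ
  refine Fintype.sum_equiv (Equiv.Set.congr e) _ _ fun S => ?_
  change _ = M.term (fun a : (e '' S : Set Y) => f a)
    (φ.comp (DMap.incl P (fun a : (e '' S : Set Y) => (a : Y)) Subtype.val_injective))
  refine hM.term_equiv' (e.image S) rfl ?_
  rw [DMap.comp_assoc, DMap.comp_assoc, DMap.incl_comp_incl, DMap.incl_comp_incl]
  rfl

variable (M) in
/-- The square formula. -/
def Formula [Fintype A] (f : A → B) (φ : DMap P A C) (ψ : DMap P B D) (g : C → D) : Prop :=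
  (M.pl ψ).comp (M.ps g) = M.termSum f φ

end Janus

namespace Sq

variable {A B C D X : Type} [Enumerated A] [Enumerated B] [Enumerated C] [Enumerated D]
  [Enumerated X]

/-- The comparison of two pullbacks is a bijection of sets; it respects decorations because on both
sides they are read off from `ψ`. -/
theorem exists_equiv {f : A → B} {φ : DMap P A C} {ψ : DMap P B D} {g : C → D} (h : Sq f φ ψ g)
    {f' : X → B} {φ' : DMap P X C} (h' : Sq f' φ' ψ g) :
    ∃ e : X ≃ A, f ∘ e = f' ∧ φ.comp (DMap.incl P e e.injective) = φ' := by
  choose e he he' using fun x => h.pullback (f' x) (φ'.fn x) (h'.comm x)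
  have hb : Function.Bijective e := by
    refine ⟨fun x y hxy => h'.inj _ _ ?_ ?_, fun a => ?_⟩
    · rw [← he, ← he, hxy]
    · rw [← he', ← he', hxy]
    · obtain ⟨x, h1, h2⟩ := h'.pullback (f a) (φ.fn a) (h.comm a)
      exact ⟨x, h.inj _ _ ((he x).trans h1) ((he' x).trans h2)⟩
  refine ⟨Equiv.ofBijective e hb, funext he, DMap.ext_hasDec ?_ fun c => ?_⟩
  · rw [DMap.fn_comp_incl]
    exact funext he'
  · obtain ⟨m, j, x, h1, h2⟩ := h'.dec c
    have hj : Enumerates φ.fn c (e ∘ j) := by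
      refine ⟨hb.1.comp h1.enumerates.injective, fun a => ?_⟩
      obtain ⟨y, rfl⟩ := hb.2 a
      rw [he', h1.enumerates.mem_iff]
      exact exists_congr fun t => ⟨fun h => congrArg e h, fun h => hb.1 h⟩
    obtain ⟨x', hx'⟩ := φ.exists_hasDec hj
    have h3 := h.hasDec hx'
    rw [← Function.comp_assoc, show f ∘ e = f' from funext he] at h3
    obtain rfl := h2.unique h3
    exact ⟨m, j, _, hx'.comp_incl (i := Equiv.ofBijective e hb) (Equiv.injective _), h1⟩

/-- The formula depends only on the pair `(ψ, g)`, so any model of the pullback may be used to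
verify it. -/
theorem formula_iff {M : Janus.{u, v} P} (hM : M.PermInverse) [Fintype A] [Fintype X] {f : A → B}
    {φ : DMap P A C} {ψ : DMap P B D} {g : C → D} (h : Sq f φ ψ g) {f' : X → B} {φ' : DMap P X C}
    (h' : Sq f' φ' ψ g) : M.Formula f φ ψ g ↔ M.Formula f' φ' ψ g := by
  obtain ⟨e, h1, h2⟩ := h.exists_equiv h'
  rw [Janus.Formula, Janus.Formula, hM.termSum_equiv e h1 h2]

end Sq
-- Pasting the square formula
variable {M : Janus.{u, v} P}

section

variable {A B C D E F X : Type} [Enumerated A] [Enumerated B] [Enumerated C]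
  [Enumerated D] [Enumerated E] [Enumerated F] [Enumerated X]

/-- The inclusion of a subset, decorated by `1` and `0`. -/
noncomputable abbrev DMap.val (P : UnitaryOperad.{u}) {A : Type} [Enumerated A] (S : Set A) :
    DMap P S A :=
  DMap.incl P (fun a : S => (a : A)) Subtype.val_injective

theorem Janus.term_of_not_surjective_left {f : X → B} {φ : DMap P X C}
    (h : ¬ Function.Surjective f) : M.term f φ = 0 := by
  rw [Janus.term, M.ps_of_not_surjective h, AddMonoidHom.zero_comp]

theorem Janus.term_of_not_surjective_right {f : X → B} {φ : DMap P X C}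
    (h : ¬ Function.Surjective φ.fn) : M.term f φ = 0 := by
  rw [Janus.term, M.pl_of_not_surjective h, AddMonoidHom.comp_zero]

theorem image_surjective {A K : Type} (π : A → K) (L : Set A)
    (p : ↥(π ⁻¹' (π '' L)) → (π '' L : Set K)) (hp : ∀ a, (p a : K) = π a) :
    Function.Surjective fun a : {a : ↥(π ⁻¹' (π '' L)) | a.1 ∈ L} => p a := by
  rintro ⟨-, a, ha, rfl⟩
  exact ⟨⟨⟨a, a, ha, rfl⟩, ha⟩, Subtype.ext (hp _)⟩

/-- A subset of `A`, as a subset of the preimage of its image. -/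
def imageEquiv {A K : Type} (π : A → K) (L : Set A) :
    {a : ↥(π ⁻¹' (π '' L)) | a.1 ∈ L} ≃ L where
  toFun a := ⟨a.1.1, a.2⟩
  invFun a := ⟨⟨a.1, a.1, a.2, rfl⟩, a.2⟩
  left_inv _ := rfl
  right_inv _ := rfl

theorem sum_comp {ι : Type*} [Fintype ι] {G G' G'' : Type*} [AddCommGroup G] [AddCommGroup G']
    [AddCommGroup G''] (F : ι → G →+ G') (g : G'' →+ G) :
    (∑ i, F i).comp g = ∑ i, (F i).comp g := by
  ext x
  simp

theorem comp_sum {ι : Type*} [Fintype ι] {G G' G'' : Type*} [AddCommGroup G] [AddCommGroup G']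
    [AddCommGroup G''] (g : G' →+ G'') (F : ι → G →+ G') :
    g.comp (∑ i, F i) = ∑ i, g.comp (F i) := by
  ext x
  simp

open Classical in
/-- The square formula for a vertical composite. -/
theorem Sq.formula_vertical (hM : M.PermInverse) [Fintype A] [Fintype C] {f : A → B}
    {Φ : DMap P A E} {ψ : DMap P B D} {ψ' : DMap P D F} {h : E → F} {g' : C → D} {φ' : DMap P C E}
    (H : Sq f Φ (ψ'.comp ψ) h) (h' : Sq g' φ' ψ' h) (hψ : Function.Surjective ψ.fn)
    (F' : M.Formula g' φ' ψ' h)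
    (IH : ∀ S : Set C, Function.Surjective (fun c : S => g' c) →
      Function.Surjective (fun c : S => φ'.fn c) → ∀ (A₁ : Set A) (f₁ : A₁ → B) (φ₁ : DMap P A₁ S),
      Sq f₁ φ₁ ψ (fun c : S => g' c) → M.Formula f₁ φ₁ ψ (fun c : S => g' c)) :
    M.Formula f Φ (ψ'.comp ψ) h := by
  have H1 : ∀ a, ∃ c, g' c = ψ.fn (f a) ∧ φ'.fn c = Φ.fn a := fun a =>
    h'.pullback _ _ (by rw [← H.comm, DMap.fn_comp_apply])
  choose p hp hp' using H1
  obtain ⟨φ, rfl, hφ, rfl⟩ := h'.exists_of_vertical H (funext hp') (funext fun a => (hp a).symm)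
  -- The upper left map is restricted to the preimage of `S`, and its target is cut down to `S`.
  choose φr hφr hφr' using fun S : Set C => DMap.exists_lift
    (φ.comp (DMap.val P (φ.fn ⁻¹' S))) (fun c : S => (c : C)) Subtype.val_injective
    (fun a => ⟨φ.fn a.1, a.2⟩) (by rw [DMap.fn_comp_incl]; rfl)
  have hφv : ∀ S a, ((φr S).fn a : C) = φ.fn a := fun S a => by rw [hφr]
  have hsq : ∀ S, Sq (fun a : (φ.fn ⁻¹' S) => f a) (φr S) ψ (fun c : S => g' c) := fun S =>
    hφ.restrict_left Subtype.val_injective Subtype.val_injective (hφr' S)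
      fun a c hac => ⟨⟨a, by change φ.fn a ∈ S; rw [hac]; exact c.2⟩, rfl⟩
  let t : ∀ S : Set C, Set ↥(φ.fn ⁻¹' S) → (M.obj (size E) →+ M.obj (size B)) := fun S L =>
    (M.term (fun a : L => f a) ((φr S).comp (DMap.val P L))).comp (M.pl (φ'.comp (DMap.val P S)))
  -- For `S` with a non-surjective leg both sides vanish, so the hypothesis `IH` is needed for
  -- admissible `S` only.
  have key : ∀ S : Set C, ((M.pl ψ).comp (M.ps fun c : S => g' c)).comp
      (M.pl (φ'.comp (DMap.val P S))) = ∑ L, t S L := by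
    intro S
    by_cases h2 : Function.Surjective (φ'.comp (DMap.val P S)).fn
    · by_cases h1 : Function.Surjective fun c : S => g' c
      · rw [IH S h1 (by rwa [DMap.fn_comp_incl] at h2) _ _ (φr S) (hsq S), Janus.termSum, sum_comp]
      · rw [M.ps_of_not_surjective h1, AddMonoidHom.comp_zero, AddMonoidHom.zero_comp]
        refine (Finset.sum_eq_zero fun L _ => ?_).symm
        change AddMonoidHom.comp _ _ = 0
        rw [Janus.term_of_not_surjective_left, AddMonoidHom.zero_comp]
        intro h3
        -- As `ψ` is onto, a subset `L` onto `B` would force `S` to be onto `D`.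
        refine h1 fun d => ?_
        obtain ⟨b, rfl⟩ := hψ d
        obtain ⟨a, rfl⟩ := h3 b
        exact ⟨⟨φ.fn a, a.1.2⟩, (hφ.comm _).symm⟩
    · rw [M.pl_of_not_surjective h2, AddMonoidHom.comp_zero]
      refine (Finset.sum_eq_zero fun L _ => ?_).symm
      change AddMonoidHom.comp _ _ = 0
      rw [M.pl_of_not_surjective h2, AddMonoidHom.comp_zero]
  rw [Janus.Formula, M.pl_comp hψ, AddMonoidHom.comp_assoc, F', Janus.termSum, comp_sum]
  have h3 : ∀ S : Set C, (M.pl ψ).comp (M.term (fun c : S => g' c) (φ'.comp (DMap.val P S))) =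
      ∑ L, t S L := key
  -- The pairs dropped are those for which `L` is not onto `S`; there the decorated leg from `L` to
  -- `S` has operator `0`.
  rw [Finset.sum_congr rfl fun S _ => h3 S, sum_pairs]
  · refine Finset.sum_congr rfl fun L _ => ?_
    change (M.term _ _).comp _ = M.term _ _
    have hs : Function.Surjective ((φr (φ.fn '' L)).comp
        (DMap.val P {a : ↥(φ.fn ⁻¹' (φ.fn '' L)) | a.1 ∈ L})).fn := by
      rw [DMap.fn_comp_incl]
      exact image_surjective φ.fn L _ (hφv _)
    rw [Janus.term, AddMonoidHom.comp_assoc, ← M.pl_comp hs]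
    refine hM.term_equiv' (imageEquiv φ.fn L) rfl ?_
    rw [DMap.comp_assoc φ' φ, DMap.comp_assoc φ', DMap.comp_assoc φ', DMap.comp_assoc φ]
    rw [← DMap.comp_assoc _ (φr _), hφr', DMap.comp_assoc, DMap.incl_comp_incl, DMap.incl_comp_incl]
    rfl
  · intro S L hL
    change AddMonoidHom.comp _ _ = 0
    rw [Janus.term_of_not_surjective_right, AddMonoidHom.zero_comp]
    intro h3
    refine hL fun k hk => ?_
    obtain ⟨a, ha⟩ := h3 ⟨k, hk⟩
    rw [DMap.fn_comp_incl] at ha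
    exact ⟨a.1, a.2, (hφv S a.1).symm.trans (congrArg Subtype.val ha)⟩

open Classical in
/-- The square formula for a horizontal composite. -/
theorem Sq.formula_horizontal (hM : M.PermInverse) [Fintype A] [Fintype B] {F' : A → E}
    {φ : DMap P A C} {χ : DMap P E F} {g : C → D} {g' : D → F} {f' : B → E} {ψ : DMap P B D}
    (H : Sq F' φ χ (g' ∘ g)) (h' : Sq f' ψ χ g') (hg : Function.Surjective g)
    (Fo : M.Formula f' ψ χ g')
    (IH : ∀ S : Set B, Function.Surjective (fun b : S => f' b) →
      Function.Surjective (fun b : S => ψ.fn b) → ∀ (A₁ : Set A) (f₁ : A₁ → S) (φ₁ : DMap P A₁ C),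
      Sq f₁ φ₁ (ψ.comp (DMap.val P S)) g → M.Formula f₁ φ₁ (ψ.comp (DMap.val P S)) g) :
    M.Formula F' φ χ (g' ∘ g) := by
  have H1 : ∀ a, ∃ b, f' b = F' a ∧ ψ.fn b = g (φ.fn a) := fun a => h'.pullback _ _ (H.comm a)
  choose f hf hf' using H1
  obtain rfl : f' ∘ f = F' := funext hf
  have hs := h'.of_horizontal H hf'
  let fr : ∀ S : Set B, (f ⁻¹' S) → S := fun S a => ⟨f a, a.2⟩
  have hsq : ∀ S, Sq (fr S) (φ.comp (DMap.val P (f ⁻¹' S))) (ψ.comp (DMap.val P S)) g :=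
    fun S => hs.restrict_right Subtype.val_injective Subtype.val_injective rfl
      fun a b hab => ⟨⟨a, by change f a ∈ S; rw [hab]; exact b.2⟩, rfl⟩
  let t : ∀ S : Set B, Set ↥(f ⁻¹' S) → (M.obj (size C) →+ M.obj (size E)) := fun S L =>
    (M.ps fun b : S => f' b).comp
      (M.term (fun a : L => fr S a) ((φ.comp (DMap.val P (f ⁻¹' S))).comp (DMap.val P L)))
  -- Again both sides vanish when `S` is not admissible.
  have key : ∀ S : Set B, (M.ps fun b : S => f' b).comp
      ((M.pl (ψ.comp (DMap.val P S))).comp (M.ps g)) = ∑ L, t S L := by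
    intro S
    by_cases h1 : Function.Surjective fun b : S => f' b
    · by_cases h2 : Function.Surjective (ψ.comp (DMap.val P S)).fn
      · rw [IH S h1 (by rwa [DMap.fn_comp_incl] at h2) _ _ _ (hsq S), Janus.termSum, comp_sum]
      · rw [M.pl_of_not_surjective h2, AddMonoidHom.zero_comp, AddMonoidHom.comp_zero]
        refine (Finset.sum_eq_zero fun L _ => ?_).symm
        change AddMonoidHom.comp _ _ = 0
        rw [Janus.term_of_not_surjective_right, AddMonoidHom.comp_zero]
        intro h3
        -- As `g` is onto, a subset `L` onto `C` would force `S` to be onto `D`.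
        refine h2 fun d => ?_
        obtain ⟨c, rfl⟩ := hg d
        obtain ⟨a, rfl⟩ := h3 c
        refine ⟨⟨f a, a.1.2⟩, ?_⟩
        rw [DMap.fn_comp_incl, DMap.fn_comp_incl, Function.comp_apply, Function.comp_apply,
          DMap.fn_comp_incl]
        exact hf' _
    · rw [M.ps_of_not_surjective h1, AddMonoidHom.zero_comp]
      refine (Finset.sum_eq_zero fun L _ => ?_).symm
      change AddMonoidHom.comp _ _ = 0
      rw [M.ps_of_not_surjective h1, AddMonoidHom.zero_comp]
  rw [Janus.Formula, M.ps_comp hg, ← AddMonoidHom.comp_assoc, Fo, Janus.termSum, sum_comp]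
  have h3 : ∀ S : Set B, (M.term (fun c : S => f' c) (ψ.comp (DMap.val P S))).comp (M.ps g) =
      ∑ L, t S L := key
  rw [Finset.sum_congr rfl fun S _ => h3 S, sum_pairs]
  · refine Finset.sum_congr rfl fun L _ => ?_
    change AddMonoidHom.comp _ (M.term _ _) = M.term _ _
    have hs : Function.Surjective
        fun a : {a : ↥(f ⁻¹' (f '' L)) | a.1 ∈ L} => fr (f '' L) a :=
      image_surjective f L _ fun _ => rfl
    rw [Janus.term, ← AddMonoidHom.comp_assoc, ← M.ps_comp hs]
    refine hM.term_equiv' (imageEquiv f L) rfl ?_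
    rw [DMap.comp_assoc φ, DMap.comp_assoc φ, DMap.incl_comp_incl, DMap.incl_comp_incl]
    rfl
  · intro S L hL
    change AddMonoidHom.comp _ _ = 0
    rw [Janus.term_of_not_surjective_left, AddMonoidHom.comp_zero]
    intro h3
    refine hL fun k hk => ?_
    obtain ⟨a, ha⟩ := h3 ⟨k, hk⟩
    exact ⟨a.1, a.2, congrArg Subtype.val ha⟩

end
attribute [instance] Enumerated.finite

/-! ### Decorations of the standard vertical maps -/

/-- There is only one increasing enumeration of a finite set, so an increasing `j` must be the one
by which decorations are stored. -/
theorem fiberEnum_of_strictMono {a b : ℕ} {f : Fin a → Fin b} {y : Fin b} {m : ℕ} {j : Fin m → Fin a}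
    (hj : StrictMono j) (h : Enumerates f y j) :
    ∃ e : m = (fiber f y).card, ∀ t, (fiberEnum f y (finCongr e t) : Fin a) = j t := by
  obtain ⟨σ, -⟩ := h.exists_equiv (enumerates_fiberEnum f y) fun _ => Iff.rfl
  obtain rfl := fin_card_eq σ
  refine ⟨rfl, fun t => ?_⟩
  exact (congrFun (Finset.orderEmbOfFin_unique (s := fiber f y) rfl
    (fun t => mem_fiber.2 (h.apply t)) hj) t).symm

theorem VHom.hasDec_of_strictMono {a b : ℕ} (φ : VHom P a b) {y : Fin b} {m : ℕ} {j : Fin m → Fin a}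
    (hj : StrictMono j) (h : Enumerates φ.toFun y j) (e : m = (fiber φ.toFun y).card) :
    φ.HasDec y j (P.reindex (finCongr e) (φ.dec y)) := by
  obtain ⟨e', h'⟩ := fiberEnum_of_strictMono hj h
  exact ⟨finCongr e, h', rfl⟩

theorem enumerates_singleton {X Y : Type*} {f : X → Y} {y : Y} {x : X} (h : ∀ x', f x' = y ↔ x = x') :
    Enumerates f y (fun _ : Fin 1 => x) :=
  ⟨fun _ _ _ => Subsingleton.elim _ _, fun x' => (h x').trans ⟨fun h => ⟨0, h⟩, fun ⟨_, h⟩ => h⟩⟩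

theorem collapse_val {a b p : ℕ} (h : a = b + p) (i : Fin b) (x : Fin a) :
    (collapse h i x : ℕ) = if (x : ℕ) ≤ i then (x : ℕ) else if (x : ℕ) ≤ i + p then i else x - p :=
  rfl

theorem enumerates_collapse {a b p : ℕ} (h : a = b + p) (i : Fin b) :
    Enumerates (collapse h i) i (fun t : Fin (p + 1) => (⟨i + t, by omega⟩ : Fin a)) := by
  refine ⟨fun s t hst => ?_, fun x => ?_⟩
  · simp only [Fin.mk.injEq] at hst
    exact Fin.ext (by omega)
  · rw [Fin.ext_iff, collapse_val]
    constructor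
    · intro hx
      refine ⟨⟨x - i, ?_⟩, Fin.ext ?_⟩
      · split_ifs at hx <;> omega
      · simp only
        split_ifs at hx <;> omega
    · rintro ⟨t, rfl⟩
      simp only
      split_ifs <;> omega

theorem collapse_eq_iff_of_ne {a b p : ℕ} (h : a = b + p) (i : Fin b) {x : Fin a}
    (hx : collapse h i x ≠ i) (x' : Fin a) : collapse h i x' = collapse h i x ↔ x = x' := by
  refine ⟨fun hx' => ?_, fun hx' => by rw [hx']⟩
  rw [Ne, Fin.ext_iff] at hx
  rw [Fin.ext_iff] at hx' ⊢
  simp only [collapse_val] at hx hx'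
  split_ifs at hx hx' <;> omega

/-- The morphism of enumerated types given by a vertical map. -/
abbrev VHom.toD {a b : ℕ} (φ : VHom P a b) : DMap P (Fin a) (Fin b) := ⟨φ⟩

theorem fn_block {a b p : ℕ} (h : a = b + p) (i : Fin b) (ω : P.Op (p + 1)) :
    (VHom.block h i ω).toD.fn = collapse h i := rfl

theorem block_hasDec {a b p : ℕ} (h : a = b + p) (i : Fin b) (ω : P.Op (p + 1)) :
    (VHom.block h i ω).toD.HasDec i (fun t : Fin (p + 1) => (⟨i + t, by omega⟩ : Fin a)) ω := by
  have := (VHom.block h i ω).hasDec_of_strictMono (j := fun t : Fin (p + 1) => ⟨i + t, by omega⟩)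
    (fun s t hst => by simpa using hst) (enumerates_collapse h i) (card_fiber_collapse_self h i).symm
  have h2 : (VHom.block h i ω).dec i =
    P.reindex (finCongr (card_fiber_collapse_self h i)) ω := dif_pos rfl
  rw [h2] at this
  -- Stated for variable arities, so that the equality can be substituted away.
  have h3 : ∀ {a b : ℕ} (e : a = b) (x : P.Op a),
    P.reindex (finCongr e) (P.reindex (finCongr e.symm) x) = x := by
    intro a b e x
    subst e
    exact (P.reindex_refl _).trans (P.reindex_refl _)
  have h4 := h3 (card_fiber_collapse_self h i).symm ω
  have h5 : P.reindex (finCongr (card_fiber_collapse_self h i).symm)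
    (P.reindex (finCongr (card_fiber_collapse_self h i)) ω) = ω := h4
  exact (congrArg (fun z => (VHom.block h i ω).HasDec i _ z) h5).mp this

theorem block_hasDec_of_ne {a b p : ℕ} (h : a = b + p) (i : Fin b) (ω : P.Op (p + 1)) {y : Fin b}
    {x : Fin a} (hx : collapse h i x = y) (hy : y ≠ i) :
    (VHom.block h i ω).toD.HasDec y (fun _ : Fin 1 => x) P.one := by
  subst hx
  have h1 : Enumerates (collapse h i) (collapse h i x) (fun _ : Fin 1 => x) :=
    enumerates_singleton (collapse_eq_iff_of_ne h i hy)
  obtain ⟨z, E, hE, hz⟩ := (VHom.block h i ω).exists_hasDec h1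
  refine ⟨E, hE, ?_⟩
  have h2 : (VHom.block h i ω).dec (collapse h i x) =
    P.reindex (finCongr (card_fiber_collapse_of_ne h i hy)) (P.point 1 le_rfl) := dif_neg hy
  have h3 : ∀ {c d : ℕ} (E : Fin 1 ≃ Fin d) (e : Fin d ≃ Fin 1),
    P.one = P.reindex E (P.reindex e (P.point 1 le_rfl)) := by
    intro c d E e
    rw [SymSeq.reindex_trans]
    exact (P.reindex_point _ _ le_rfl).symm
  exact (h3 (c := 0) E _).trans (congrArg (P.reindex E) h2.symm)

theorem unary_hasDec {n : ℕ} (α : Fin n → P.Op 1) (y : Fin n) :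
    (VHom.unary P α).toD.HasDec y (fun _ : Fin 1 => y) (α y) := by
  have h1 : Enumerates (id : Fin n → Fin n) y (fun _ : Fin 1 => y) :=
    enumerates_singleton fun x' => eq_comm
  obtain ⟨z, E, hE, hz⟩ := (VHom.unary P α).exists_hasDec h1
  refine ⟨E, hE, ?_⟩
  have h3 : ∀ {d : ℕ} (E : Fin 1 ≃ Fin d) (e : Fin d ≃ Fin 1) (x : P.Op 1),
    x = P.reindex E (P.reindex e x) := by
    intro d E e x
    rw [SymSeq.reindex_trans, Subsingleton.elim (E.trans e) (Equiv.refl _), SymSeq.reindex_refl]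
  exact h3 E _ (α y)

/-! ### Squares with a bijective side, and transport along bijections -/

section

variable {A B C D X Y Z : Type} [Enumerated A] [Enumerated B] [Enumerated C]
  [Enumerated D] [Enumerated X] [Enumerated Y] [Enumerated Z]

namespace Janus

/-- Composing with a bijection neither creates nor destroys surjectivity, so the default value `0`
causes no trouble and `f` may be arbitrary. -/
theorem ps_comp_of_bijective (f : X → Y) (e : Y ≃ Z) : M.ps (e ∘ f) = (M.ps e).comp (M.ps f) := by
  by_cases hf : Function.Surjective f
  · exact M.ps_comp hf _
  · rw [M.ps_of_not_surjective hf, M.ps_of_not_surjective, AddMonoidHom.comp_zero]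
    rwa [e.comp_surjective]

theorem pl_comp_of_bijective (φ : DMap P X Y) (e : Y ≃ Z) :
    M.pl ((DMap.incl P e e.injective).comp φ) =
      (M.pl φ).comp (M.pl (DMap.incl P e e.injective)) := by
  by_cases hf : Function.Surjective φ.fn
  · exact M.pl_comp hf _
  · rw [M.pl_of_not_surjective hf, M.pl_of_not_surjective, AddMonoidHom.zero_comp]
    rwa [DMap.fn_incl_comp, e.comp_surjective]

/-- If no proper subspan is surjective on both sides, the sum has one term. -/
theorem PermInverse.termSum_eq_term (hM : M.PermInverse) [Fintype A] {f : A → B} {φ : DMap P A C}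
    (h : ∀ S : Set A, Function.Surjective (fun a : S => f a) →
      Function.Surjective (fun a : S => φ.fn a) → S = Set.univ) : M.termSum f φ = M.term f φ := by
  rw [termSum, Finset.sum_eq_single Set.univ]
  · exact hM.term_equiv' (Equiv.Set.univ A) rfl rfl
  · intro S _ hS
    by_cases h1 : Function.Surjective (fun a : S => f a)
    · refine term_of_not_surjective_right fun h2 => hS (h S h1 ?_)
      rwa [DMap.fn_comp_incl] at h2
    · exact term_of_not_surjective_left h1
  · exact fun h => (h (Finset.mem_univ _)).elim

/-- A subset that is still onto must contain the only point over `f a`, which is `a`. -/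
theorem PermInverse.termSum_eq_term_of_injective_left (hM : M.PermInverse) [Fintype A] {f : A → B}
    {φ : DMap P A C} (h : Function.Injective f) : M.termSum f φ = M.term f φ :=
  hM.termSum_eq_term fun _ hS _ => Set.eq_univ_of_forall fun a =>
    let ⟨s, hs⟩ := hS (f a)
    h hs ▸ s.2

theorem PermInverse.termSum_eq_term_of_injective_right (hM : M.PermInverse) [Fintype A] {f : A → B}
    {φ : DMap P A C} (h : Function.Injective φ.fn) : M.termSum f φ = M.term f φ :=
  hM.termSum_eq_term fun _ _ hS => Set.eq_univ_of_forall fun a =>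
    let ⟨s, hs⟩ := hS (φ.fn a)
    h hs ▸ s.2

end Janus

theorem Sq.surjective_left {f : A → B} {φ : DMap P A C} {ψ : DMap P B D} {g : C → D}
    (h : Sq f φ ψ g) (hψ : Function.Surjective ψ.fn) : Function.Surjective φ.fn := fun c =>
  let ⟨_, hb⟩ := hψ (g c)
  let ⟨a, _, ha⟩ := h.pullback _ _ hb
  ⟨a, ha⟩

theorem Sq.surjective_top {f : A → B} {φ : DMap P A C} {ψ : DMap P B D} {g : C → D}
    (h : Sq f φ ψ g) (hg : Function.Surjective g) : Function.Surjective f := fun b =>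
  let ⟨c, hc⟩ := hg (ψ.fn b)
  let ⟨a, ha, _⟩ := h.pullback b c hc.symm
  ⟨a, ha⟩

theorem Sq.injective_top {f : A → B} {φ : DMap P A C} {ψ : DMap P B D} {g : C → D}
    (h : Sq f φ ψ g) (hg : Function.Injective g) : Function.Injective f := fun a a' haa =>
  h.inj _ _ haa (hg (by rw [← h.comm, ← h.comm, haa]))

theorem Sq.injective_left {f : A → B} {φ : DMap P A C} {ψ : DMap P B D} {g : C → D}
    (h : Sq f φ ψ g) (hψ : Function.Injective ψ.fn) : Function.Injective φ.fn := fun a a' haa =>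
  h.inj _ _ (hψ (by rw [h.comm, h.comm, haa])) haa

/-- The square formula for a horizontal bijection. -/
theorem Sq.formula_of_bijective (hM : M.PermInverse) [Fintype A] {f : A → B} {φ : DMap P A C}
    {ψ : DMap P B D} {g : C → D} (h : Sq f φ ψ g) (hψ : Function.Surjective ψ.fn)
    (hg : Function.Bijective g) : M.Formula f φ ψ g := by
  obtain ⟨g, rfl⟩ : ∃ e : C ≃ D, e = g := ⟨Equiv.ofBijective g hg, rfl⟩
  obtain ⟨f, rfl⟩ : ∃ e : A ≃ B, e = f := ⟨Equiv.ofBijective f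
    ⟨h.injective_top hg.1, h.surjective_top hg.2⟩, rfl⟩
  -- With bijective horizontal sides the square is a commutative square of decorated maps. Applying
  -- `M^*` and cancelling the two bijections by `PermInverse` gives the formula.
  have key : (DMap.incl P g g.injective).comp φ = ψ.comp (DMap.incl P f f.injective) := by
    refine DMap.ext_hasDec ?_ fun d => ?_
    · rw [DMap.fn_incl_comp, DMap.fn_comp_incl]
      exact funext fun a => (h.comm a).symm
    · obtain ⟨c, rfl⟩ := g.surjective d
      obtain ⟨m, j, x, h1, h2⟩ := h.dec c
      exact ⟨m, j, x, h1.incl_comp g.injective, h2.comp_incl f.injective⟩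
  rw [Janus.Formula, hM.termSum_eq_term_of_injective_left f.injective, Janus.term]
  have h1 := congrArg M.pl key
  rw [M.pl_comp (h.surjective_left hψ), M.pl_comp (by rw [DMap.fn_incl]; exact f.surjective)] at h1
  ext x
  have h2 := DFunLike.congr_fun h1 (M.ps g x)
  have h3 := DFunLike.congr_fun (hM.pl_comp_ps g) x
  have h4 := DFunLike.congr_fun (hM.ps_comp_pl f) (M.pl ψ (M.ps g x))
  simp only [AddMonoidHom.comp_apply, AddMonoidHom.id_apply] at h2 h3 h4 ⊢
  rw [← h4, ← h2, h3]

/-- Transport of the square formula along bijections. -/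
theorem formula_of_equiv (hM : M.PermInverse) {B₀ C₀ D₀ : Type} [Enumerated B₀] [Enumerated C₀]
    [Enumerated D₀] [Fintype A] {f : A → B₀} {φ : DMap P A C₀} {ψ₀ : DMap P B₀ D₀} {g₀ : C₀ → D₀}
    (eB : B ≃ B₀) (eC : C ≃ C₀) (eD : D ≃ D₀) {ψ : DMap P B D} {g : C → D}
    (hψ : (DMap.incl P eD eD.injective).comp ψ = ψ₀.comp (DMap.incl P eB eB.injective))
    (hg : eD ∘ g = g₀ ∘ eC) (h : M.Formula f φ ψ₀ g₀) :
    M.Formula (eB.symm ∘ f) ((DMap.incl P eC.symm eC.symm.injective).comp φ) ψ g := by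
  have h1 : M.termSum (eB.symm ∘ f) ((DMap.incl P eC.symm eC.symm.injective).comp φ) =
      (M.ps eB.symm).comp ((M.termSum f φ).comp (M.ps eC)) := by
    rw [Janus.termSum, Janus.termSum, sum_comp, comp_sum]
    refine Finset.sum_congr rfl fun S _ => ?_
    rw [Janus.term, Janus.term, DMap.comp_assoc, Janus.pl_comp_of_bijective, hM.pl_incl,
      ← AddMonoidHom.comp_assoc, ← AddMonoidHom.comp_assoc, ← AddMonoidHom.comp_assoc,
      ← Janus.ps_comp_of_bijective]
    rfl
  have h2 : g = eD.symm ∘ g₀ ∘ eC := by rw [← hg]; funext c; simp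
  have h3 := congrArg M.pl hψ
  rw [Janus.pl_comp_of_bijective, M.pl_comp (by rw [DMap.fn_incl]; exact eB.surjective),
    hM.pl_incl, hM.pl_incl] at h3
  rw [Janus.Formula, h1, ← h, h2, Janus.ps_comp_of_bijective, M.ps_comp eC.surjective,
    ← AddMonoidHom.comp_assoc, h3]
  simp only [AddMonoidHom.comp_assoc]

/-! ### Normal forms of surjections -/

/-- Maps to a fixed set are classified, up to bijections of the source, by the sizes of their
fibres. The source can thus be put in standard form without moving the target. -/
theorem exists_equiv_of_card_fiber {X Y Z : Type} [Finite X] [Finite Y] (f : X → Z) (g : Y → Z)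
    (h : ∀ z, Nat.card {x // f x = z} = Nat.card {y // g y = z}) :
    ∃ e : X ≃ Y, f = g ∘ e := by
  have e := fun z => (Finite.equivFin {x // f x = z}).trans
    ((finCongr (h z)).trans (Finite.equivFin {y // g y = z}).symm)
  refine ⟨(Equiv.sigmaFiberEquiv f).symm.trans ((Equiv.sigmaCongrRight e).trans
    (Equiv.sigmaFiberEquiv g)), funext fun x => ?_⟩
  exact (e (f x) ⟨x, rfl⟩).2.symm

theorem Enumerates.card {X Y : Type} {f : X → Y} {y : Y} {m : ℕ} {j : Fin m → X}
    (h : Enumerates f y j) : Nat.card {x // f x = y} = m := by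
  have e : Fin m ≃ {x // f x = y} := Equiv.ofBijective (fun t => ⟨j t, h.apply t⟩)
    ⟨fun s t hst => h.injective (congrArg Subtype.val hst), fun x =>
      let ⟨t, ht⟩ := (h.mem_iff _).1 x.2
      ⟨t, Subtype.ext ht⟩⟩
  rw [← Nat.card_congr e, Nat.card_fin]

/-- A map with one fibre of `p + 1` elements, the others being singletons, is a standard one. -/
theorem exists_equiv_collapse {X : Type} [Finite X] {N p : ℕ} (i : Fin N) (f : X → Fin N)
    {j : Fin (p + 1) → X} (hi : Enumerates f i j)
    (h : ∀ y, y ≠ i → ∃ x, Enumerates f y (fun _ : Fin 1 => x)) :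
    ∃ e : X ≃ Fin (N + p), f = collapse rfl i ∘ e := by
  refine exists_equiv_of_card_fiber f _ fun z => ?_
  by_cases hz : z = i
  · subst hz
    rw [hi.card, (enumerates_collapse rfl z).card]
  · obtain ⟨x, hx⟩ := h z hz
    obtain ⟨x', rfl⟩ := collapse_surjective (p := p) rfl i z
    rw [hx.card, (enumerates_singleton (collapse_eq_iff_of_ne rfl i hz)).card]

/-- A surjection that lowers the number of elements by one identifies exactly two elements. -/
theorem exists_pair {X Y : Type} [Finite X] [Finite Y] {g : X → Y} (hg : Function.Surjective g)
    (hc : Nat.card X = Nat.card Y + 1) :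
    ∃ x x' : X, x ≠ x' ∧ g x = g x' ∧ ∀ y z, y ≠ x' → z ≠ x' → g y = g z → y = z := by
  have hn : ¬ Function.Injective g := fun h => by
    have := Nat.card_congr (Equiv.ofBijective g ⟨h, hg⟩)
    omega
  rw [Function.not_injective_iff] at hn
  obtain ⟨x, x', h, hne⟩ := hn
  refine ⟨x, x', hne, h, ?_⟩
  have hs : Function.Surjective (fun z : {z // z ≠ x'} => g z) := fun y => by
    obtain ⟨z, rfl⟩ := hg y
    by_cases hz : z = x'
    · exact ⟨⟨x, hne⟩, by simp [hz, h]⟩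
    · exact ⟨⟨z, hz⟩, rfl⟩
  have hcard : Nat.card {z // z ≠ x'} = Nat.card Y := by
    have := Fintype.ofFinite X
    classical
    have h1 := Set.ncard_compl_add_ncard ({x'} : Set X)
    rw [Set.ncard_singleton, hc] at h1
    have h2 : Nat.card {z // z ≠ x'} = ({x'}ᶜ : Set X).ncard := rfl
    omega
  have hi : Function.Injective (fun z : {z // z ≠ x'} => g z) := by
    have := Fintype.ofFinite Y
    have := Fintype.ofFinite {z // z ≠ x'}
    refine ((Fintype.bijective_iff_surjective_and_card _).2 ⟨hs, ?_⟩).1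
    rwa [Fintype.card_eq_nat_card, Fintype.card_eq_nat_card]
  exact fun y z hy hz hyz => congrArg Subtype.val (@hi ⟨y, hy⟩ ⟨z, hz⟩ hyz)

/-- One fibre is the pair `x`, `x'` and the others are single points. The labelling `e` of the
target is prescribed because the same labelling must serve the other map into that target. -/
theorem exists_equiv_collapse_one {X Y : Type} [Finite X] [Finite Y] {N : ℕ} {g : X → Y} (e : Y ≃ Fin N)
    (hg : Function.Surjective g) (hc : Nat.card X = Nat.card Y + 1) :
    ∃ (i : Fin N) (e' : X ≃ Fin (N + 1)), e ∘ g = collapse (p := 1) rfl i ∘ e' := by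
  obtain ⟨x, x', hne, h, hinj⟩ := exists_pair hg hc
  refine ⟨e (g x), exists_equiv_collapse (j := ![x, x']) _ _ ⟨?_, fun z => ?_⟩ fun y hy => ?_⟩
  · intro s t hst
    fin_cases s <;> fin_cases t <;> simp_all
  · have h2 : (∃ t, (![x, x'] : Fin (1 + 1) → X) t = z) ↔ x = z ∨ x' = z := Fin.exists_fin_two
    rw [h2, Function.comp_apply, e.injective.eq_iff]
    by_cases hz : z = x'
    · simp [hz, h]
    · refine ⟨fun h' => Or.inl (hinj _ _ hne hz h'.symm), ?_⟩
      rintro (rfl | rfl)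
      · rfl
      · exact h.symm
  · obtain ⟨z, hz⟩ := hg (e.symm y)
    have hz' : e (g z) = y := by rw [hz, Equiv.apply_symm_apply]
    subst hz'
    refine ⟨z, enumerates_singleton fun w => ?_⟩
    simp only [Function.comp_apply, e.injective.eq_iff] at hy ⊢
    refine ⟨fun hw => hinj _ _ ?_ ?_ hw.symm, fun hw => by rw [hw]⟩
    · rintro rfl; exact hy (congrArg e h.symm)
    · rintro rfl; exact hy (congrArg e (hw.symm.trans h.symm))

end
-- Elementary squares and factorization of decorated maps
section

variable {A B C D X Y Z : Type} [Enumerated A] [Enumerated B] [Enumerated C]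
  [Enumerated D] [Enumerated X] [Enumerated Y] [Enumerated Z]

/-- Verified for one pullback of a standard pair `(ψ₀, g₀)`, the formula passes to every square over
an isomorphic pair. -/
theorem Sq.formula_transport (hM : M.PermInverse) {B₀ C₀ D₀ : Type} [Enumerated B₀] [Enumerated C₀]
    [Enumerated D₀] [Fintype A] [Fintype X] {f : A → B₀} {φ : DMap P A C₀} {ψ₀ : DMap P B₀ D₀}
    {g₀ : C₀ → D₀} (h₀ : Sq f φ ψ₀ g₀) (h : M.Formula f φ ψ₀ g₀)
    (eB : B ≃ B₀) (eC : C ≃ C₀) (eD : D ≃ D₀) {ψ : DMap P B D} {g : C → D}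
    (hψ : (DMap.incl P eD eD.injective).comp ψ = ψ₀.comp (DMap.incl P eB eB.injective))
    (hg : eD ∘ g = g₀ ∘ eC) {f' : X → B} {φ' : DMap P X C} (h' : Sq f' φ' ψ g) :
    M.Formula f' φ' ψ g :=
  ((h₀.of_equiv eB eC eD hψ hg).formula_iff hM h').1 (formula_of_equiv hM eB eC eD hψ hg h)

variable (M) in
/-- The relation between unary operations and elementary surjections. -/
def Janus.UnaryRelation : Prop := ∀ {N : ℕ} (i : Fin N) (α : Fin N → P.Op 1),
  (M.opI α).comp (M.opP (a := N + 1) rfl i) =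
    (M.opP (a := N + 1) rfl i).comp (M.opI (α ∘ collapse (a := N + 1) rfl i))

theorem sq_unary {N : ℕ} (i : Fin N) (α : Fin N → P.Op 1) :
    Sq (collapse (a := N + 1) rfl i) (VHom.unary P (α ∘ collapse (a := N + 1) rfl i)).toD
      (VHom.unary P α).toD (collapse (a := N + 1) rfl i) where
  comm _ := rfl
  pullback _ c h := ⟨c, h.symm, rfl⟩
  inj _ _ _ h := h
  dec c := ⟨1, _, _, unary_hasDec _ c, unary_hasDec α _⟩

/-- The left leg is the identity on points, hence injective, and the sum collapses to a single term.
-/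
theorem unaryRelation_iff_formula (hM : M.PermInverse) {N : ℕ} (i : Fin N) (α : Fin N → P.Op 1) :
    (M.opI α).comp (M.opP (a := N + 1) rfl i) =
      (M.opP (a := N + 1) rfl i).comp (M.opI (α ∘ collapse (a := N + 1) rfl i)) ↔
    M.Formula (collapse (a := N + 1) rfl i) (VHom.unary P (α ∘ collapse (a := N + 1) rfl i)).toD
      (VHom.unary P α).toD (collapse (a := N + 1) rfl i) := by
  rw [Janus.Formula, hM.termSum_eq_term_of_injective_right
      (φ := (VHom.unary P (α ∘ collapse (a := N + 1) rfl i)).toD) Function.injective_id, Janus.term,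
    M.ps_fin _ (collapse_surjective _ i), M.pl_fin _ Function.surjective_id,
    M.pl_fin _ Function.surjective_id]
  rfl

/-- The square formula for a bijection with unary decorations. -/
theorem Sq.formula_of_unary (hM : M.PermInverse) (hI : M.UnaryRelation) [Fintype A] {f : A → B}
    {φ : DMap P A C} {ψ : DMap P B D} {g : C → D} (h : Sq f φ ψ g) (hψ : Function.Bijective ψ.fn)
    (hg : Function.Surjective g) (hc : Nat.card C = Nat.card D + 1) : M.Formula f φ ψ g := by
  obtain ⟨i, eC, hC⟩ := exists_equiv_collapse_one (enum D) hg hc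
  let eB : B ≃ Fin (size D) := (Equiv.ofBijective ψ.fn hψ).trans (enum D)
  have heB : ∀ b, eB b = enum D (ψ.fn b) := fun _ => rfl
  have hα : ∀ y, ∃ x : P.Op 1, ψ.HasDec ((enum D).symm y) (fun _ : Fin 1 => eB.symm y) x :=
    fun y => ψ.exists_hasDec (enumerates_singleton fun b => by
      rw [Equiv.eq_symm_apply, Equiv.symm_apply_eq, heB, eq_comm])
  choose α hα using hα
  refine (sq_unary i α).formula_transport hM ((unaryRelation_iff_formula hM i α).1 (hI i α))
    eB eC (enum D) (DMap.ext_hasDec ?_ fun y => ?_) hC h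
  · rw [DMap.fn_incl_comp, DMap.fn_comp_incl]
    rfl
  · refine ⟨1, fun _ => eB.symm y, α y, ?_, ?_⟩
    · have := (hα y).incl_comp (enum D).injective
      rwa [Equiv.apply_symm_apply] at this
    · refine DMap.HasDec.comp_incl _ ?_
      have := unary_hasDec α y
      rwa [show (fun _ : Fin 1 => y) = eB ∘ fun _ => eB.symm y by funext; simp] at this

variable (M) in
/-- The square formula for an elementary surjection and a block of `k + 1` elements. -/
def Janus.BlockFormula (k : ℕ) : Prop := ∀ {N : ℕ} (i l : Fin N) (ω : P.Op (k + 1)) {A : Type}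
  [Enumerated A] [Fintype A] (f : A → Fin (N + k)) (φ : DMap P A (Fin (N + 1))),
  Sq f φ (VHom.block (a := N + k) rfl l ω).toD (collapse (a := N + 1) rfl i) →
  M.Formula f φ (VHom.block (a := N + k) rfl l ω).toD (collapse (a := N + 1) rfl i)

/-- Coordinates are chosen in which `g` is a collapse and `ψ` a standard block. The glued point and
the block point need not be related, so `BlockFormula` allows two positions `i`, `l`. The
permutation `σ` between the given and the increasing enumeration of the fibre is absorbed into the
decoration. -/
theorem Sq.formula_of_block (hM : M.PermInverse) {k : ℕ} (hB : M.BlockFormula k) [Fintype A]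
    {f : A → B} {φ : DMap P A C} {ψ : DMap P B D} {g : C → D} (h : Sq f φ ψ g) {y : D}
    {j : Fin (k + 1) → B} {ω : P.Op (k + 1)} (hy : ψ.HasDec y j ω)
    (hψ : ∀ z, z ≠ y → ∃ b, ψ.HasDec z (fun _ : Fin 1 => b) P.one)
    (hg : Function.Surjective g) (hc : Nat.card C = Nat.card D + 1) : M.Formula f φ ψ g := by
  obtain ⟨i, eC, hC⟩ := exists_equiv_collapse_one (enum D) hg hc
  obtain ⟨eB, hB'⟩ := exists_equiv_collapse (p := k) (enum D y) (enum D ∘ ψ.fn) (j := j)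
    ⟨hy.enumerates.injective, fun x => by
      rw [← hy.enumerates.mem_iff, Function.comp_apply, (enum D).injective.eq_iff]⟩
    (fun z hz => by
      obtain ⟨b, hb⟩ := hψ ((enum D).symm z) fun h => hz (by rw [← h, Equiv.apply_symm_apply])
      refine ⟨b, hb.enumerates.injective, fun x => ?_⟩
      rw [← hb.enumerates.mem_iff, Function.comp_apply, Equiv.eq_symm_apply])
  have hB1 : ∀ b, enum D (ψ.fn b) = collapse (p := k) rfl (enum D y) (eB b) := congrFun hB'
  have he : Enumerates (collapse (a := size D + k) (p := k) rfl (enum D y)) (enum D y)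
      (eB ∘ j) := by
    refine ⟨eB.injective.comp hy.enumerates.injective, fun x => ?_⟩
    obtain ⟨b, rfl⟩ := eB.surjective x
    rw [← hB1, (enum D).injective.eq_iff, hy.enumerates.mem_iff]
    simp
  obtain ⟨σ, hσ⟩ := he.exists_equiv (enumerates_collapse (p := k) rfl (enum D y)) fun _ => Iff.rfl
  obtain ⟨φ₀, h₀⟩ := Sq.exists_sq
    (VHom.block (a := size D + k) rfl (enum D y) (P.reindex σ ω)).toD
    (collapse (a := size D + 1) (p := 1) rfl i)
  have := Fintype.ofFinite {p : Fin (size D + 1) × Fin (size D + k) // collapse (p := 1) rfl i p.1 =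
    (VHom.block (a := size D + k) rfl (enum D y) (P.reindex σ ω)).toD.fn p.2}
  refine h₀.formula_transport hM (hB i _ _ _ _ h₀) eB eC (enum D) (DMap.ext_hasDec ?_ fun z => ?_)
    hC h
  · rw [DMap.fn_incl_comp, DMap.fn_comp_incl]
    exact hB'
  · by_cases hz : z = enum D y
    · subst hz
      refine ⟨_, _, _, (hy.reindex σ).incl_comp (enum D).injective, DMap.HasDec.comp_incl _ ?_⟩
      have := block_hasDec (a := size D + k) rfl (enum D y) (P.reindex σ ω)
      rwa [← hσ] at this
    · obtain ⟨b, hb⟩ := hψ ((enum D).symm z) fun h => hz (by rw [← h, Equiv.apply_symm_apply])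
      refine ⟨_, _, _, ?_, DMap.HasDec.comp_incl _
        (block_hasDec_of_ne (a := size D + k) rfl _ _ (x := eB b) (y := z) ?_ hz)⟩
      · have := hb.incl_comp (enum D).injective
        rwa [Equiv.apply_symm_apply] at this
      · rw [← hB1, show ψ.fn b = (enum D).symm z from hb.enumerates.apply 0,
          Equiv.apply_symm_apply]

/-- A composite decoration gives a factorization. -/
theorem DMap.HasDec.exists_factor {ψ : DMap P B D} {y : D} {n : ℕ} {m : Fin n → ℕ} {c : P.Op n}
    {d : ∀ k, P.Op (m k)} {J : Fin (∑ k, m k) → B} (h : ψ.HasDec y J (P.γ m c d)) :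
    ∃ (ψ₁ : DMap P B ({b // ψ.fn b ≠ y} ⊕ Fin n)) (ψ₂ : DMap P ({b // ψ.fn b ≠ y} ⊕ Fin n) D),
      ψ₂.comp ψ₁ = ψ ∧ (∀ b, ψ₂.fn (Sum.inl b) = ψ.fn b) ∧ (∀ k, ψ₂.fn (Sum.inr k) = y) ∧
      (∀ b, ψ₁.HasDec (Sum.inl b) (fun _ : Fin 1 => b.1) P.one) ∧
      (∀ k, ψ₁.HasDec (Sum.inr k) (fun s => J (finSigmaFinEquiv ⟨k, s⟩)) (d k)) ∧
      ψ₂.HasDec y Sum.inr c := by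
  classical
  -- The first map: a point outside the fibre over `y` keeps its identity, a point of the fibre goes
  -- to the index of its block.
  have H : ∀ b : B, ∃ z : {b // ψ.fn b ≠ y} ⊕ Fin n, (∀ b', z = Sum.inl b' → b = b'.1) ∧
      ∀ k, z = Sum.inr k → ∃ s, J (finSigmaFinEquiv ⟨k, s⟩) = b := fun b => by
    by_cases hb : ψ.fn b = y
    · obtain ⟨t, rfl⟩ := (h.enumerates.mem_iff b).1 hb
      obtain ⟨⟨k, s⟩, rfl⟩ := finSigmaFinEquiv.surjective t
      refine ⟨Sum.inr k, fun b' h => (by cases h), fun k' h => ?_⟩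
      cases h
      exact ⟨s, rfl⟩
    · refine ⟨Sum.inl ⟨b, hb⟩, fun b' h => ?_, fun k' h => (by cases h)⟩
      cases h
      rfl
  choose p hp1 hp2 using H
  have hpl : ∀ b : {b // ψ.fn b ≠ y}, p b.1 = Sum.inl b := fun b => by
    rcases hb : p b.1 with b' | k
    · rw [Subtype.ext (hp1 _ _ hb)]
    · obtain ⟨s, hs⟩ := hp2 _ _ hb
      exact (b.2 (by rw [← hs, h.enumerates.apply])).elim
  have hpr : ∀ k s, p (J (finSigmaFinEquiv ⟨k, s⟩)) = Sum.inr k := fun k s => by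
    rcases hb : p (J (finSigmaFinEquiv ⟨k, s⟩)) with b' | k'
    · exact (b'.2 (by rw [← hp1 _ _ hb, h.enumerates.apply])).elim
    · obtain ⟨s', hs⟩ := hp2 _ _ hb
      have := finSigmaFinEquiv.injective (h.enumerates.injective hs)
      obtain rfl : k' = k := congrArg Sigma.fst this
      rfl
  -- The two kinds of points `z` have different arities. Quantifying over the future `ψ₁` packs both
  -- cases into one choice of data at `z`; `H2` does the same for `ψ₂`.
  have H1 : ∀ z, ∃ (m' : ℕ) (j : Fin m' → B) (x : P.Op m'),
      Enumerates p z j ∧ ∀ ψ₁ : DMap P B ({b // ψ.fn b ≠ y} ⊕ Fin n), ψ₁.HasDec z j x →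
        (∀ b, z = Sum.inl b → ψ₁.HasDec (Sum.inl b) (fun _ : Fin 1 => b.1) P.one) ∧
        ∀ k, z = Sum.inr k →
          ψ₁.HasDec (Sum.inr k) (fun s => J (finSigmaFinEquiv ⟨k, s⟩)) (d k) := by
    rintro (b | k)
    · refine ⟨1, fun _ => b.1, P.one, enumerates_singleton fun b' =>
        ⟨fun h => (hp1 _ _ h).symm, fun h => by rw [← h, hpl]⟩, fun ψ₁ h => ⟨fun b' e => ?_,
          fun k e => (by cases e)⟩⟩
      cases e
      exact h
    · refine ⟨m k, fun s => J (finSigmaFinEquiv ⟨k, s⟩), d k, ⟨fun s t hst => ?_, fun b =>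
        ⟨fun h => hp2 _ _ h, fun ⟨s, hs⟩ => by rw [← hs, hpr]⟩⟩, fun ψ₁ h =>
          ⟨fun b' e => (by cases e), fun k e => ?_⟩⟩
      · exact eq_of_heq (Sigma.mk.inj (finSigmaFinEquiv.injective (h.enumerates.injective hst))).2
      · cases e
        exact h
  choose m₁ j₁ x₁ hj₁ hx₁ using H1
  obtain ⟨ψ₁, h1, h2⟩ := DMap.exists_of_hasDec p m₁ j₁ hj₁ x₁
  have h2l := fun b => (hx₁ _ ψ₁ (h2 (Sum.inl b))).1 b rfl
  have h2r := fun k => (hx₁ _ ψ₁ (h2 (Sum.inr k))).2 k rfl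
  let q : {b // ψ.fn b ≠ y} ⊕ Fin n → D := Sum.elim (fun b => ψ.fn b) fun _ => y
  have hqp : ∀ b, q (p b) = ψ.fn b := fun b => by
    rcases hb : p b with b' | k
    · rw [hp1 _ _ hb]; rfl
    · obtain ⟨s, rfl⟩ := hp2 _ _ hb
      rw [h.enumerates.apply]; rfl
  have H2 : ∀ z, ∃ (m' : ℕ) (j : Fin m' → {b // ψ.fn b ≠ y} ⊕ Fin n) (x : P.Op m'),
      Enumerates q z j ∧ ∀ ψ₂ : DMap P ({b // ψ.fn b ≠ y} ⊕ Fin n) D, ψ₂.HasDec z j x →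
        (z = y → ψ₂.HasDec z Sum.inr c) ∧ ∃ (m'' : ℕ) (j' : Fin m'' → B) (x' : P.Op m''),
          (ψ₂.comp ψ₁).HasDec z j' x' ∧ ψ.HasDec z j' x' := fun z => by
    by_cases hz : z = y
    · subst hz
      refine ⟨n, Sum.inr, c, ⟨Sum.inr_injective, ?_⟩, fun ψ₂ h' => ⟨fun _ => h', _, _, _, h'.comp h2r, ?_⟩⟩
      · rintro (b | k)
        · exact ⟨fun h => (b.2 h).elim, fun ⟨t, ht⟩ => by cases ht⟩
        · exact ⟨fun _ => ⟨k, rfl⟩, fun _ => rfl⟩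
      · convert h using 1
        funext t
        simp
    · obtain ⟨m', j, x, hx⟩ := ψ.exists_dec z
      have hj : ∀ t, ψ.fn (j t) ≠ y := fun t => by rw [hx.enumerates.apply]; exact hz
      refine ⟨m', fun t => Sum.inl ⟨j t, hj t⟩, x, ⟨fun s t hst => ?_, ?_⟩, fun ψ₂ h' =>
        ⟨fun h => (hz h).elim, _, j, _, h'.comp_of_one_right fun t => h2l ⟨j t, hj t⟩, hx⟩⟩
      · exact hx.enumerates.injective (congrArg Subtype.val (Sum.inl_injective hst))
      · rintro (b | k)
        · change ψ.fn b = z ↔ _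
          rw [hx.enumerates.mem_iff]
          exact exists_congr fun t => ⟨fun h => congrArg Sum.inl (Subtype.ext h),
            fun h => congrArg Subtype.val (Sum.inl_injective h)⟩
        · exact ⟨fun h => (hz h.symm).elim, fun ⟨t, ht⟩ => by cases ht⟩
  choose m' j x hj hx using H2
  obtain ⟨ψ₂, h3, h4⟩ := DMap.exists_of_hasDec q m' j hj x
  refine ⟨ψ₁, ψ₂, DMap.ext_hasDec ?_ fun z => (hx z ψ₂ (h4 z)).2, fun b => by rw [h3]; rfl,
    fun k => by rw [h3]; rfl, h2l, h2r, (hx y ψ₂ (h4 y)).1 rfl⟩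
  rw [DMap.fn_comp, h1, h3]
  exact funext hqp

end
-- Induction on the size of a square
/-- The operation is a composite of operations of smaller positive arity. -/
def UnitaryOperad.Decomposable (P : UnitaryOperad.{u}) {n : ℕ} (ω : P.Op n) : Prop :=
  ∃ (r : ℕ) (m : Fin r → ℕ) (c : P.Op r) (d : ∀ k, P.Op (m k)) (e : Fin n ≃ Fin (∑ k, m k)),
    ω = P.reindex e (P.γ m c d) ∧ 1 < r ∧ (∃ k, 1 < m k) ∧ ∀ k, 1 ≤ m k

theorem card_lt_of_surjective {X Y : Type} [Finite X] {f : X → Y} (hf : Function.Surjective f)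
    (h : ¬ Function.Injective f) : Nat.card Y < Nat.card X := by
  by_contra hc
  exact h (hf.bijective_of_nat_card_le (not_lt.1 hc)).1

variable (M) in
/-- The square formula for squares that are small compared to their lower right corner. -/
def Janus.FormulaUpTo (n : ℕ) : Prop := ∀ {A B C D : Type} [Enumerated A] [Enumerated B]
  [Enumerated C] [Enumerated D] [Fintype A] {f : A → B} {φ : DMap P A C} {ψ : DMap P B D}
  {g : C → D}, Sq f φ ψ g → Function.Surjective ψ.fn → Function.Surjective g →
  Nat.card A ≤ Nat.card D + n → M.Formula f φ ψ g

section

variable {A B C D X Y Z : Type} [Enumerated A] [Enumerated B] [Enumerated C]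
  [Enumerated D] [Enumerated X] [Enumerated Y] [Enumerated Z]

/-- The corner of the lower square is a proper quotient of `A`, as `ψ₁` glues two points and `g` is
onto; its lower right corner is still `D`. The upper squares may have corners as large as `A`, but
their lower right corner `X` is larger than `D`, as `ψ₂` glues two points. Both differences drop. -/
theorem Sq.formula_of_vertical (hM : M.PermInverse) {n : ℕ} (IH : M.FormulaUpTo n) [Fintype A]
    {f : A → B} {φ : DMap P A C} {ψ : DMap P B D} {g : C → D} (h : Sq f φ ψ g)
    {ψ₁ : DMap P B X} {ψ₂ : DMap P X D} (e : ψ₂.comp ψ₁ = ψ) (h1 : Function.Surjective ψ₁.fn) (h2 : Function.Surjective ψ₂.fn)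
    (hg : Function.Surjective g) (hc : Nat.card A ≤ Nat.card D + (n + 1))
    (h1' : ¬ Function.Injective ψ₁.fn) (h2' : ¬ Function.Injective ψ₂.fn) :
    M.Formula f φ ψ g := by
  classical
  subst e
  obtain ⟨φ', h'⟩ := Sq.exists_sq ψ₂ g
  have := Fintype.ofFinite {p : C × X // g p.1 = ψ₂.fn p.2}
  refine h.formula_vertical hM h' h1 (IH h' h2 hg ?_) fun S hS _ A₁ f₁ φ₁ h₁ => IH h₁ h1 hS ?_
  · have hp : ∀ a, g (φ.fn a) = ψ₂.fn (ψ₁.fn (f a)) := fun a => by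
      rw [← h.comm, DMap.fn_comp_apply]
    have := card_lt_of_surjective
      (f := fun a => (⟨(φ.fn a, ψ₁.fn (f a)), hp a⟩ : {p : C × X // g p.1 = ψ₂.fn p.2})) ?_ ?_
    · omega
    · rintro ⟨⟨c, x⟩, hcx⟩
      obtain ⟨b, rfl⟩ := h1 x
      obtain ⟨a, rfl, rfl⟩ := h.pullback b c (by rw [DMap.fn_comp_apply]; exact hcx.symm)
      exact ⟨a, rfl⟩
    · rw [Function.not_injective_iff] at h1' ⊢
      obtain ⟨b, b', hbb, hne⟩ := h1'
      obtain ⟨c, hc⟩ := hg (ψ₂.fn (ψ₁.fn b))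
      obtain ⟨a, ha, ha'⟩ := h.pullback b c (by rw [DMap.fn_comp_apply, hc])
      obtain ⟨a', hb, hb'⟩ := h.pullback b' c (by rw [DMap.fn_comp_apply, hc, hbb])
      refine ⟨a, a', Subtype.ext (Prod.ext (ha'.trans hb'.symm) ?_), ?_⟩
      · simp only [ha, hb, hbb]
      · rintro rfl
        exact hne (ha.symm.trans hb)
  · have := card_lt_of_surjective h2 h2'
    have := Finite.card_subtype_le (· ∈ A₁)
    change Nat.card {x // x ∈ A₁} ≤ _
    omega

/-- The mirror image of the vertical case: the right square has a smaller corner because `g₁` glues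
two points, the left squares have a larger lower right corner because `g₂` does. -/
theorem Sq.formula_of_horizontal (hM : M.PermInverse) {n : ℕ} (IH : M.FormulaUpTo n) [Fintype A]
    {f : A → B} {φ : DMap P A C} {ψ : DMap P B D} {g : C → D} (h : Sq f φ ψ g)
    {g₁ : C → X} {g₂ : X → D} (e : g₂ ∘ g₁ = g) (hψ : Function.Surjective ψ.fn) (h1 : Function.Surjective g₁)
    (h2 : Function.Surjective g₂) (hc : Nat.card A ≤ Nat.card D + (n + 1))
    (h1' : ¬ Function.Injective g₁) (h2' : ¬ Function.Injective g₂) :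
    M.Formula f φ ψ g := by
  classical
  subst e
  obtain ⟨φ', h'⟩ := Sq.exists_sq ψ g₂
  have := Fintype.ofFinite {p : X × B // g₂ p.1 = ψ.fn p.2}
  refine h.formula_horizontal hM h' h1 (IH h' hψ h2 ?_) fun S _ hS A₁ f₁ φ₁ h₁ =>
    IH h₁ (by rwa [DMap.fn_comp_incl]) h1 ?_
  · have := card_lt_of_surjective
      (f := fun a => (⟨(g₁ (φ.fn a), f a), (h.comm a).symm⟩ :
        {p : X × B // g₂ p.1 = ψ.fn p.2})) ?_ ?_
    · omega
    · rintro ⟨⟨x, b⟩, hxb⟩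
      obtain ⟨c, rfl⟩ := h1 x
      obtain ⟨a, rfl, rfl⟩ := h.pullback b c hxb.symm
      exact ⟨a, rfl⟩
    · rw [Function.not_injective_iff] at h1' ⊢
      obtain ⟨c, c', hcc, hne⟩ := h1'
      obtain ⟨b, hb⟩ := hψ (g₂ (g₁ c))
      obtain ⟨a, ha, ha'⟩ := h.pullback b c hb
      obtain ⟨a', hb, hb'⟩ := h.pullback b c' (by rw [hb, hcc]; rfl)
      refine ⟨a, a', Subtype.ext (Prod.ext ?_ (ha.trans hb.symm)), ?_⟩
      · simp only [ha', hb', hcc]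
      · rintro rfl
        exact hne (ha'.symm.trans hb')
  · have := card_lt_of_surjective h2 h2'
    have := Finite.card_subtype_le (· ∈ A₁)
    change Nat.card {x // x ∈ A₁} ≤ _
    omega

/-- If `ω` is composite, `ψ` factors and the vertical step applies. The conditions in `Decomposable`
are made for this: nonempty blocks make `ψ₁` surjective, a block with two inputs makes it
non-injective, and two blocks make `ψ₂` non-injective. -/
theorem Sq.formula_of_block_or_decomposable (hM : M.PermInverse)
    (hB : ∀ k, 1 ≤ k → M.BlockFormula k ∨ ∀ ω : P.Op (k + 1), P.Decomposable ω) {n : ℕ}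
    (IH : M.FormulaUpTo n) [Fintype A] {f : A → B} {φ : DMap P A C} {ψ : DMap P B D} {g : C → D}
    (h : Sq f φ ψ g) {y : D} {m : ℕ} {j : Fin m → B} {ω : P.Op m} (hy : ψ.HasDec y j ω) (hm : 1 < m)
    (hψ : ∀ z, z ≠ y → ∃ b, ψ.HasDec z (fun _ : Fin 1 => b) P.one)
    (hg : Function.Surjective g) (hcg : Nat.card C = Nat.card D + 1)
    (hc : Nat.card A ≤ Nat.card D + (n + 1)) : M.Formula f φ ψ g := by
  obtain ⟨k, rfl⟩ : ∃ k, m = k + 1 := ⟨m - 1, by omega⟩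
  rcases hB k (by omega) with hB | hB
  · exact h.formula_of_block hM hB hy hψ hg hcg
  · obtain ⟨r, m, c, d, e', rfl, hr, ⟨k₀, hk₀⟩, hk⟩ := hB ω
    have hy' := hy.reindex e'.symm
    rw [SymSeq.reindex_trans, Equiv.symm_trans_self, SymSeq.reindex_refl] at hy'
    obtain ⟨ψ₁, ψ₂, e, h2l, h2r, h1l, h1r, -⟩ := hy'.exists_factor
    have hs2 : Function.Surjective ψ₂.fn := fun z => by
      by_cases hz : z = y
      · exact ⟨Sum.inr k₀, by rw [h2r, hz]⟩
      · obtain ⟨b, hb⟩ := hψ z hz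
        have hb' := hb.enumerates.apply 0
        exact ⟨Sum.inl ⟨b, by rw [hb']; exact hz⟩, by rw [h2l, hb']⟩
    refine h.formula_of_vertical hM IH e ?_ hs2 hg hc ?_ ?_
    · rintro (b | k)
      · exact ⟨b.1, (h1l b).enumerates.apply 0⟩
      · exact ⟨_, (h1r k).enumerates.apply ⟨0, hk k⟩⟩
    · intro hi
      have := (h1r k₀).enumerates.le_one hi
      omega
    · intro hi
      have : (⟨0, by omega⟩ : Fin r) = ⟨1, hr⟩ := Sum.inr_injective (hi ((h2r _).trans (h2r _).symm))
      simp at this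

end

/-- The square formula holds in general if it holds for unary operations and for blocks that are not
decomposable. -/
theorem Janus.formulaUpTo (hM : M.PermInverse) (hI : M.UnaryRelation)
    (hB : ∀ k, 1 ≤ k → M.BlockFormula k ∨ ∀ ω : P.Op (k + 1), P.Decomposable ω) (n : ℕ) :
    M.FormulaUpTo n := by
  induction n with
  | zero =>
    intro A B C D _ _ _ _ _ f φ ψ g h hψ hg hc
    -- Here `|C| ≤ |A| ≤ |D|`, so the surjection `g` is bijective.
    refine h.formula_of_bijective hM hψ ⟨?_, hg⟩
    by_contra hi
    have := card_lt_of_surjective hg hi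
    have := Nat.card_le_card_of_surjective _ (h.surjective_left hψ)
    omega
  | succ n IH =>
    intro A B C D _ _ _ _ _ f φ ψ g h hψ hg hc
    by_cases hi : Function.Injective g
    · exact h.formula_of_bijective hM hψ ⟨hi, hg⟩
    by_cases hcg : Nat.card C = Nat.card D + 1
    swap
    · have hlt := card_lt_of_surjective hg hi
      rw [Function.not_injective_iff] at hi
      obtain ⟨c, c', hcc, hne⟩ := hi
      classical
      -- Only `c` and `c'` are glued first. If the remaining map `g₂` were injective, `C` would have
      -- just one element more than `D`, which is excluded here.
      let g₁ : C → {x // x ≠ c'} := fun x => if hx : x = c' then ⟨c, hne⟩ else ⟨x, hx⟩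
      let g₂ : {x // x ≠ c'} → D := fun x => g x
      have hg₁ : ∀ x : {x // x ≠ c'}, g₁ x.1 = x := fun x => dif_neg x.2
      have hg' : g₂ ∘ g₁ = g := by
        funext x
        by_cases hx : x = c'
        · simp [g₁, g₂, hx, hcc]
        · simp [g₁, g₂, hx]
      have hs₂ : Function.Surjective g₂ := by
        rw [← hg'] at hg
        exact hg.of_comp
      refine h.formula_of_horizontal hM IH hg' hψ (fun x => ⟨x, hg₁ x⟩) hs₂ hc
        (fun hi => hne (hi ?_)) fun hi => ?_
      · rw [hg₁ ⟨c, hne⟩]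
        simp [g₁]
      · have h1 := Nat.card_congr (Equiv.ofBijective g₂ ⟨hi, hs₂⟩)
        have h2 := Set.ncard_compl_add_ncard ({c'} : Set C)
        rw [Set.ncard_singleton] at h2
        have h3 : Nat.card {x // x ≠ c'} = ({c'}ᶜ : Set C).ncard := rfl
        omega
    by_cases hψi : Function.Injective ψ.fn
    · exact h.formula_of_unary hM hI ⟨hψi, hψ⟩ hg hcg
    rw [Function.not_injective_iff] at hψi
    obtain ⟨b, b', hbb, hne⟩ := hψi
    obtain ⟨m, j, ω, hω⟩ := ψ.exists_dec (ψ.fn b)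
    have hm : 1 < m := by
      obtain ⟨t, rfl⟩ := (hω.enumerates.mem_iff b).1 rfl
      obtain ⟨t', rfl⟩ := (hω.enumerates.mem_iff b').1 hbb.symm
      by_contra hm
      have : Subsingleton (Fin m) := Fin.subsingleton_iff_le_one.2 (not_lt.1 hm)
      exact hne (congrArg j (Subsingleton.elim _ _))
    -- Writing `ω = γ(1; ω)` splits off one fibre: `ψ₁` carries the block `ω` and units, `ψ₂`
    -- everything else.
    have hω' := hω.reindex (finCongr (show ∑ _ : Fin 1, m = m by simp))
    rw [← P.one_γ] at hω'
    obtain ⟨ψ₁, ψ₂, e, h2l, h2r, h1l, h1r, -⟩ := hω'.exists_factor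
    have hs1 : Function.Surjective ψ₁.fn := by
      rintro (b | k)
      · exact ⟨b.1, (h1l b).enumerates.apply 0⟩
      · exact ⟨_, (h1r k).enumerates.apply ⟨0, by omega⟩⟩
    have hs2 : Function.Surjective ψ₂.fn := by
      rw [← e, DMap.fn_comp] at hψ
      exact hψ.of_comp
    by_cases hi2 : Function.Injective ψ₂.fn
    swap
    · refine h.formula_of_vertical hM IH e hs1 hs2 hg hc (fun hi => ?_) hi2
      have := (h1r 0).enumerates.le_one hi
      omega
    -- Now `ψ₂` is bijective, so the size does not drop. Instead the lower square is covered by the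
    -- unary relation, and the only subset `S` of its corner that is onto `C` is the whole corner;
    -- the upper square is then a block over a set with as many elements as `D`.
    have hc2 := Nat.card_congr (Equiv.ofBijective ψ₂.fn ⟨hi2, hs2⟩)
    obtain ⟨φ', h'⟩ := Sq.exists_sq ψ₂ g
    have := Fintype.ofFinite {p : C × ({x // ψ.fn x ≠ ψ.fn b} ⊕ Fin 1) //
      g p.1 = ψ₂.fn p.2}
    have hφ' : Function.Bijective φ'.fn := ⟨h'.injective_left hi2, h'.surjective_left hs2⟩
    have hc3 := Nat.card_congr (Equiv.ofBijective φ'.fn hφ')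
    classical
    rw [← e] at h ⊢
    refine h.formula_vertical hM h' hs1 (h'.formula_of_unary hM hI ⟨hi2, hs2⟩ hg hcg)
      fun S hS hS' A₁ f₁ φ₁ h₁ => ?_
    have hc4 : Nat.card S = Nat.card C := Nat.card_congr (Equiv.ofBijective _
      ⟨fun s t hst => Subtype.ext (hφ'.1 hst), hS'⟩)
    refine h₁.formula_of_block_or_decomposable hM hB IH (h1r 0) hm ?_ hS (by omega) ?_
    · rintro (x | k) hz
      · exact ⟨x.1, h1l x⟩
      · exact (hz (congrArg Sum.inr (Subsingleton.elim _ _))).elim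
    · have := Finite.card_subtype_le (· ∈ A₁)
      change Nat.card {x // x ∈ A₁} ≤ _
      omega

/-! ### Translation to standard sets -/

theorem toD_ofEquiv {a b : ℕ} (σ : Fin a ≃ Fin b) :
    (VHom.ofEquiv P σ).toD = DMap.incl P σ σ.injective :=
  congrArg DMap.mk (VHom.ofInj_eq_ofEquiv σ).symm

theorem toD_id (n : ℕ) : (VHom.id P n).toD = DMap.incl P id Function.injective_id := by
  refine DMap.ext_hasDec (by rw [DMap.fn_incl]; rfl) fun y => ?_
  exact ⟨1, _, _, unary_hasDec _ y, DMap.incl_hasDec id Function.injective_id y⟩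

theorem toD_incl {a : ℕ} (A : Finset (Fin a)) :
    (VHom.incl P A).toD = DMap.incl P (A.orderEmbOfFin rfl) (A.orderEmbOfFin rfl).injective := by
  have h : (VHom.ofInj P (A.orderEmbOfFin rfl) (A.orderEmbOfFin rfl).injective).dec =
      (VHom.incl P A).dec := by
    funext y
    simp only [VHom.ofInj, VHom.incl]
    split_ifs with hy
    · exact (P.reindex_point _ le_rfl _).symm
    · exact (P.reindex_point _ zero_le_one _).symm
  exact congrArg DMap.mk (congrArg (VHom.mk (A.orderEmbOfFin rfl : Fin A.card → Fin a)) h).symm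

theorem isSquare_iff {a b c d : ℕ} {f : Fin a → Fin b} {φ : VHom P a c} {ψ : VHom P b d}
    {g : Fin c → Fin d} : IsSquare f φ ψ g ↔ Sq f φ.toD ψ.toD g := by
  constructor
  · intro h
    refine ⟨h.comm, fun b c hbc => (h.pullback b c hbc).exists, fun x x' h1 h2 => ?_, fun c => ?_⟩
    · exact (h.pullback (f x') (φ.toFun x') (h.comm x')).unique ⟨h1, h2⟩ ⟨rfl, rfl⟩
    · obtain ⟨e, he, hd⟩ := h.dec c
      refine ⟨_, _, _, φ.hasDec_dec c, e, he, ?_⟩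
      change _ = P.reindex e (ψ.dec (g c))
      rw [← hd, SymSeq.reindex_trans, Equiv.self_trans_symm, SymSeq.reindex_refl]
  · intro h
    refine ⟨h.comm, fun b c hbc => ?_, fun c => ?_⟩
    · obtain ⟨x, h1, h2⟩ := h.pullback b c hbc
      exact ⟨x, ⟨h1, h2⟩, fun x' hx' => h.inj _ _ (hx'.1.trans h1.symm) (hx'.2.trans h2.symm)⟩
    · have h1 : ψ.HasDec (g c) (fun t => f (fiberEnum φ.toFun c t)) (φ.dec c) :=
        h.hasDec (φ := φ.toD) (φ.hasDec_dec c)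
      obtain ⟨e, he, hd⟩ := h1
      refine ⟨e, he, ?_⟩
      rw [hd, SymSeq.reindex_trans, Equiv.symm_trans_self, SymSeq.reindex_refl]

namespace Janus

theorem pl_incl_perm {n : ℕ} (σ : Equiv.Perm (Fin n)) :
    M.pl (DMap.incl P σ σ.injective) = M.pull (VHom.ofEquiv P σ) σ.surjective := by
  rw [← toD_ofEquiv]
  exact M.pl_fin _ _

/-- It suffices to consider the transpositions of neighbours. -/
theorem permInverse_of_tau (h : ∀ {N : ℕ} (i : Fin N), (M.opT i).comp (M.opT' i) =
    AddMonoidHom.id _) : M.PermInverse := by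
  suffices H : ∀ (n : ℕ) (σ : Equiv.Perm (Fin n)),
      (M.ps σ).comp (M.pl (DMap.incl P σ σ.injective)) = AddMonoidHom.id _ by
    intro n σ
    rw [← M.ps_fin, ← M.pl_incl_perm]
    exact H n σ
  have h1 : ∀ n, (M.ps (1 : Equiv.Perm (Fin n))).comp
      (M.pl (DMap.incl P (1 : Equiv.Perm (Fin n)) (Equiv.injective _))) = AddMonoidHom.id _ := by
    intro n
    rw [M.ps_id (f := (1 : Equiv.Perm (Fin n))) rfl, AddMonoidHom.id_comp]
    change M.pl (DMap.incl P id Function.injective_id) = _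
    rw [← toD_id]
    exact (M.pl_fin _ _).trans (M.pull_id n)
  rintro (- | n) σ
  · rw [Subsingleton.elim σ 1]
    exact h1 0
  -- The neighbouring transpositions generate already as a monoid, so stability under products is
  -- enough.
  · have hσ : σ ∈ Submonoid.closure (Set.range fun i : Fin n => Equiv.swap i.castSucc i.succ) := by
      rw [Equiv.Perm.mclosure_swap_castSucc_succ]
      trivial
    induction hσ using Submonoid.closure_induction with
    | mem σ hσ =>
      obtain ⟨i, rfl⟩ := hσ
      rw [M.pl_incl_perm, M.ps_fin _ (Equiv.surjective _)]
      exact h i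
    | one => exact h1 _
    | mul σ τ _ _ hσ hτ =>
      change (M.ps (σ ∘ τ)).comp (M.pl (DMap.incl P (σ ∘ τ) _)) = _
      rw [← DMap.incl_comp_incl (P := P) τ τ.injective σ σ.injective,
        M.ps_comp τ.surjective, M.pl_comp (by rw [DMap.fn_incl]; exact τ.surjective),
        AddMonoidHom.comp_assoc, ← AddMonoidHom.comp_assoc _ _ (M.ps τ), hτ, AddMonoidHom.id_comp, hσ]

theorem PermInverse.tau (hM : M.PermInverse) {N : ℕ} (i : Fin N) :
    (M.opT i).comp (M.opT' i) = AddMonoidHom.id _ ∧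
      (M.opT' i).comp (M.opT i) = AddMonoidHom.id _ := by
  have h := hM.pl_comp_ps (PMack.tau i)
  rw [M.pl_incl_perm, M.ps_fin _ (Equiv.surjective _)] at h
  exact ⟨hM _ _, h⟩

/-- Subsets that are not admissible contribute `0` on the right; for the others the increasing
enumeration identifies the two spans. -/
theorem PermInverse.sum_admissible (hM : M.PermInverse) {a b c : ℕ} (f : Fin a → Fin b)
    (φ : VHom P a c) :
    ∑ A : Admissible f φ, (M.push (f ∘ (VHom.incl P A.1).toFun) A.2.1).comp
      (M.pull (φ.comp (VHom.incl P A.1)) A.2.2) = M.termSum f φ.toD := by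
  refine Finset.sum_of_injOn (fun A => (A.1 : Set (Fin a)))
    (fun A _ B _ h => Subtype.ext (Finset.coe_injective h)) (fun _ _ => Finset.mem_coe.2 (Finset.mem_univ _))
    (fun S _ hS => ?_) fun A _ => ?_
  · by_cases h1 : Function.Surjective (fun a : S => f a)
    swap
    · exact term_of_not_surjective_left h1
    by_cases h2 : Function.Surjective (fun a : S => φ.toFun a)
    swap
    · exact term_of_not_surjective_right (by rwa [DMap.fn_comp_incl])
    classical
    refine (hS ?_).elim
    have key : ∀ s : S, ∃ t, S.toFinset.orderEmbOfFin rfl t = s.1 := fun s => by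
      have : s.1 ∈ Set.range (S.toFinset.orderEmbOfFin rfl) := by simp
      exact this
    refine ⟨⟨S.toFinset, fun y => ?_, fun y => ?_⟩, Finset.mem_coe.2 (Finset.mem_univ _), by simp⟩
    · obtain ⟨s, rfl⟩ := h1 y
      obtain ⟨t, ht⟩ := key s
      exact ⟨t, congrArg f ht⟩
    · obtain ⟨s, rfl⟩ := h2 y
      obtain ⟨t, ht⟩ := key s
      exact ⟨t, congrArg φ.toFun ht⟩
  · rw [← M.ps_fin, ← M.pl_fin]
    refine hM.term_equiv' (A.1.orderIsoOfFin rfl).toEquiv rfl ?_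
    rw [DMap.comp_assoc, DMap.incl_comp_incl]
    refine Eq.trans ?_ (congrArg φ.toD.comp (toD_incl A.1).symm)
    rfl

end Janus

/-- Pseudo-Mackey functors, in terms of the square formula. -/
theorem isPseudoMackey_iff : IsPseudoMackey M ↔ M.PermInverse ∧
    ∀ {a b c d : ℕ} {f : Fin a → Fin b} {φ : VHom P a c} {ψ : VHom P b d} {g : Fin c → Fin d},
      Sq f φ.toD ψ.toD g → Function.Surjective ψ.toFun → Function.Surjective g →
      M.Formula f φ.toD ψ.toD g := by
  constructor
  · intro h
    have hM : M.PermInverse := by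
      intro n σ
      -- A permutation and its vertical version decorated by units form a double isomorphism.
      refine h.double_iso _ _ _ _ ⟨σ.bijective, ⟨VHom.ofEquiv P σ.symm, ?_, ?_⟩, ?_⟩
      · have e1 := DMap.incl_comp_incl (P := P) σ.symm σ.symm.injective σ σ.injective
        rw [DMap.incl_congr _ (σ.self_comp_symm), ← toD_id, ← toD_ofEquiv, ← toD_ofEquiv] at e1
        exact congrArg DMap.hom e1
      · have e1 := DMap.incl_comp_incl (P := P) σ σ.injective σ.symm σ.symm.injective
        rw [DMap.incl_congr _ (σ.symm_comp_self), ← toD_id, ← toD_ofEquiv, ← toD_ofEquiv] at e1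
        exact congrArg DMap.hom e1
      · rw [isSquare_iff, toD_id, toD_ofEquiv]
        refine ⟨fun x => by simp, fun b c hbc => ⟨σ.symm c, ?_, ?_⟩, fun x x' h _ => σ.injective h,
          fun c => ?_⟩
        · rw [DMap.fn_incl] at hbc
          simp only [id] at hbc
          simp [hbc]
        · simp
        · obtain ⟨x, rfl⟩ := σ.surjective c
          exact ⟨1, _, _, DMap.incl_hasDec _ _ x, DMap.incl_hasDec id _ (σ x)⟩
    refine ⟨hM, fun {a b c d f φ ψ g} hs hψ hg => ?_⟩
    have := h.square f φ ψ g (hs.surjective_top hg) (hs.surjective_left hψ) hψ hg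
      (isSquare_iff.2 hs)
    rw [hM.sum_admissible, ← M.ps_fin, ← M.pl_fin] at this
    exact this
  · rintro ⟨hM, h⟩
    refine ⟨fun {a b} f w hf hw hd => ?_, fun {a b c d} f φ ψ g _ _ hψ hg hs => ?_⟩
    · have hs := isSquare_iff.1 hd.square
      -- The bottom and right sides are identities and the top is injective, so the formula reads `1
      -- = M_*(f) M^*(w)`.
      have := hs.formula_of_bijective hM Function.surjective_id Function.bijective_id
      rw [Janus.Formula, hM.termSum_eq_term_of_injective_left hd.horizontal.1,
        M.ps_id rfl, M.pl_fin _ Function.surjective_id, M.pull_id, Janus.term, M.ps_fin f hf,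
        M.pl_fin w hw] at this
      exact this.symm
    · have := h (isSquare_iff.1 hs) hψ hg
      rw [Janus.Formula, ← hM.sum_admissible, M.ps_fin g hg, M.pl_fin ψ hψ] at this
      exact this

/-! ### A collapse and a block at different places -/

/-- A point that is alone in its fibre for one leg cannot be omitted from an admissible subset. -/
theorem Janus.PermInverse.termSum_eq_term_of_injOn (hM : M.PermInverse) {A B C : Type}
    [Enumerated A] [Enumerated B] [Enumerated C] [Fintype A] {f : A → B} {φ : DMap P A C}
    (h : ∀ a, (∀ a', f a' = f a → a' = a) ∨ ∀ a', φ.fn a' = φ.fn a → a' = a) :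
    M.termSum f φ = M.term f φ := by
  refine hM.termSum_eq_term fun S h1 h2 => Set.eq_univ_of_forall fun a => ?_
  rcases h a with h | h
  · obtain ⟨s, hs⟩ := h1 (f a)
    exact h _ hs ▸ s.2
  · obtain ⟨s, hs⟩ := h2 (φ.fn a)
    exact h _ hs ▸ s.2

theorem opH_eq_pl {a b p : ℕ} (h : a = b + p) (i : Fin b) (ω : P.Op (p + 1)) :
    M.opH h i ω = M.pl (VHom.block h i ω).toD := (M.pl_fin _ _).symm

theorem opP_eq_ps {a b : ℕ} (h : a = b + 1) (i : Fin b) :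
    M.opP h i = M.ps (collapse h i) := (M.ps_fin _ _).symm

theorem opI_eq_pl {n : ℕ} (α : Fin n → P.Op 1) : M.opI α = M.pl (VHom.unary P α).toD :=
  (M.pl_fin _ _).symm

theorem opT_eq_ps {n : ℕ} (i : Fin n) : M.opT i = M.ps (tau i) := (M.ps_fin _ _).symm

section

variable {N k : ℕ} (i j : Fin N) (α : P.Op (k + 1))

theorem sq_block_lt (hij : i < j) : Sq (collapse (a := N + k + 1) rfl (i.castAdd k))
    (VHom.block (a := N + k + 1) (by omega) j.succ α).toD (VHom.block (a := N + k) rfl j α).toD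
    (collapse (a := N + 1) rfl i) where
  comm x := by
    simp only [fn_block, Fin.ext_iff, collapse_val, Fin.val_castAdd, Fin.val_succ, Fin.lt_def] at *
    split_ifs <;> omega
  pullback b c hbc := by
    -- Up to the glued pair the corner looks like `C`; beyond it, it looks like `B` shifted by one.
    refine ⟨⟨if (b : ℕ) ≤ i then c else b + 1, by split_ifs <;> omega⟩, ?_⟩
    simp only [fn_block, Fin.ext_iff, collapse_val, Fin.val_castAdd, Fin.val_succ, Fin.lt_def] at *
    split_ifs at * <;> omega
  inj x x' h h' := by
    simp only [fn_block, Fin.ext_iff, collapse_val, Fin.val_castAdd, Fin.val_succ, Fin.lt_def] at *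
    split_ifs at h h' <;> omega
  dec c := by
    have hc : collapse (a := N + 1) rfl i c = j ↔ c = j.succ := by
      simp only [Fin.ext_iff, collapse_val, Fin.val_succ, Fin.lt_def] at *
      split_ifs <;> omega
    by_cases h : c = j.succ
    · subst h
      refine ⟨_, _, _, block_hasDec _ j.succ α, ?_⟩
      rw [hc.2 rfl]
      convert block_hasDec (a := N + k) rfl j α using 1
      funext t
      simp only [Function.comp_apply, Fin.ext_iff, collapse_val, Fin.val_castAdd, Fin.val_succ,
        Fin.lt_def] at *
      split_ifs <;> omega
    · obtain ⟨x, hx⟩ := collapse_surjective (a := N + k + 1) (p := k) (by omega) j.succ c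
      refine ⟨_, _, _, block_hasDec_of_ne _ j.succ α hx h,
        block_hasDec_of_ne _ j α ?_ fun h' => h (hc.1 h')⟩
      simp only [Fin.ext_iff, collapse_val, Fin.val_castAdd, Fin.val_succ, Fin.lt_def] at *
      split_ifs at * <;> omega

theorem sq_block_gt (hij : j < i) : Sq (collapse (a := N + k + 1) rfl (i.addNat k))
    (VHom.block (a := N + k + 1) (by omega) j.castSucc α).toD (VHom.block (a := N + k) rfl j α).toD
    (collapse (a := N + 1) rfl i) where
  comm x := by
    simp only [fn_block, Fin.ext_iff, collapse_val, Fin.val_addNat, Fin.val_castSucc, Fin.lt_def] at *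
    split_ifs <;> omega
  pullback b c hbc := by
    -- Up to the end of the block the corner looks like `B`; beyond it, it looks like `C` shifted by
    -- `k`.
    refine ⟨⟨if (b : ℕ) ≤ j + k then b else c + k, by split_ifs <;> omega⟩, ?_⟩
    simp only [fn_block, Fin.ext_iff, collapse_val, Fin.val_addNat, Fin.val_castSucc, Fin.lt_def] at *
    split_ifs at * <;> omega
  inj x x' h h' := by
    simp only [fn_block, Fin.ext_iff, collapse_val, Fin.val_addNat, Fin.val_castSucc, Fin.lt_def] at *
    split_ifs at h h' <;> omega
  dec c := by
    have hc : collapse (a := N + 1) rfl i c = j ↔ c = j.castSucc := by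
      simp only [Fin.ext_iff, collapse_val, Fin.val_castSucc, Fin.lt_def] at *
      split_ifs <;> omega
    by_cases h : c = j.castSucc
    · subst h
      refine ⟨_, _, _, block_hasDec _ j.castSucc α, ?_⟩
      rw [hc.2 rfl]
      convert block_hasDec (a := N + k) rfl j α using 1
      funext t
      simp only [Function.comp_apply, Fin.ext_iff, collapse_val, Fin.val_addNat, Fin.val_castSucc,
        Fin.lt_def] at *
      split_ifs <;> omega
    · obtain ⟨x, hx⟩ := collapse_surjective (a := N + k + 1) (p := k) (by omega) j.castSucc c
      refine ⟨_, _, _, block_hasDec_of_ne _ j.castSucc α hx h,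
        block_hasDec_of_ne _ j α ?_ fun h' => h (hc.1 h')⟩
      simp only [Fin.ext_iff, collapse_val, Fin.val_addNat, Fin.val_castSucc, Fin.lt_def] at *
      split_ifs at * <;> omega

/-- The block begins after `i + 1`: positions up to `i + 1` are alone for the left leg, later ones
for the top leg. For `j < i` the roles are exchanged, with the cut at `j + k`. -/
theorem formula_block_lt_iff (hM : M.PermInverse) (hij : i < j) :
    M.Formula (collapse (a := N + k + 1) rfl (i.castAdd k))
      (VHom.block (a := N + k + 1) (by omega) j.succ α).toD (VHom.block (a := N + k) rfl j α).toD
      (collapse (a := N + 1) rfl i) ↔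
    (M.opH (a := N + k) rfl j α).comp (M.opP (a := N + 1) rfl i) =
      (M.opP (a := N + k + 1) rfl (i.castAdd k)).comp
        (M.opH (a := N + k + 1) (by omega) j.succ α) := by
  rw [Janus.Formula, hM.termSum_eq_term_of_injOn, opH_eq_pl, opH_eq_pl, opP_eq_ps, opP_eq_ps]
  · rfl
  · intro x
    by_cases hx : (x : ℕ) ≤ i + 1
    · right
      intro x' h
      simp only [fn_block, Fin.ext_iff, collapse_val, Fin.val_succ, Fin.lt_def] at *
      split_ifs at h <;> omega
    · left
      intro x' h
      simp only [Fin.ext_iff, collapse_val, Fin.val_castAdd, Fin.lt_def] at *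
      split_ifs at h <;> omega

theorem formula_block_gt_iff (hM : M.PermInverse) (hij : j < i) :
    M.Formula (collapse (a := N + k + 1) rfl (i.addNat k))
      (VHom.block (a := N + k + 1) (by omega) j.castSucc α).toD
      (VHom.block (a := N + k) rfl j α).toD (collapse (a := N + 1) rfl i) ↔
    (M.opH (a := N + k) rfl j α).comp (M.opP (a := N + 1) rfl i) =
      (M.opP (a := N + k + 1) rfl (i.addNat k)).comp
        (M.opH (a := N + k + 1) (by omega) j.castSucc α) := by
  rw [Janus.Formula, hM.termSum_eq_term_of_injOn, opH_eq_pl, opH_eq_pl, opP_eq_ps, opP_eq_ps]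
  · rfl
  · intro x
    by_cases hx : (x : ℕ) ≤ j + k
    · left
      intro x' h
      simp only [Fin.ext_iff, collapse_val, Fin.val_addNat, Fin.lt_def] at *
      split_ifs at h <;> omega
    · right
      intro x' h
      simp only [fn_block, Fin.ext_iff, collapse_val, Fin.val_castSucc, Fin.lt_def] at *
      split_ifs at h <;> omega

end

/-! ### Monotone maps and restricted decorations -/

/-- Monotone maps with equal fibre sizes differ by a permutation of the source, and a sorted tuple
is unique. This replaces explicit formulas for iterated collapses and for renumbered columns. -/
theorem eq_of_monotone_of_card {a b : ℕ} {f g : Fin a → Fin b} (hf : Monotone f) (hg : Monotone g)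
    (h : ∀ y, Nat.card {x // f x = y} = Nat.card {x // g x = y}) : f = g := by
  obtain ⟨e, rfl⟩ := exists_equiv_of_card_fiber f g h
  exact Tuple.unique_monotone (σ := e) (τ := Equiv.refl _) hf hg

theorem Enumerates.eq_of_strictMono {a : ℕ} {Y Y' : Type*} {f : Fin a → Y} {y : Y} {g : Fin a → Y'}
    {y' : Y'} {m : ℕ} {j j' : Fin m → Fin a} (h : Enumerates f y j) (h' : Enumerates g y' j')
    (hj : StrictMono j) (hj' : StrictMono j') (hf : ∀ x, f x = y ↔ g x = y') : j = j' := by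
  obtain ⟨e, rfl⟩ := h.exists_equiv h' hf
  exact (Tuple.unique_monotone (f := j) (σ := e) (τ := Equiv.refl _) hj'.monotone hj.monotone).symm

theorem collapse_monotone {a b p : ℕ} (h : a = b + p) (i : Fin b) : Monotone (collapse h i) := by
  intro x y hxy
  rw [Fin.le_def] at hxy ⊢
  simp only [collapse_val]
  split_ifs <;> omega

theorem finSigma_fst_strictMono {n : ℕ} {m : Fin n → ℕ} (hm : ∀ k, m k ≤ 1) :
    StrictMono fun x : Fin (∑ k, m k) => (finSigmaFinEquiv.symm x).1 := by
  intro x y hxy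
  obtain ⟨p, rfl⟩ := finSigmaFinEquiv.surjective x
  obtain ⟨q, rfl⟩ := finSigmaFinEquiv.surjective y
  simp only [Equiv.symm_apply_apply]
  rcases (finSigma_lt p q).1 hxy with h | ⟨h, h'⟩
  · exact h
  · have h1 := p.2.2
    have h2 := q.2.2
    have h3 := hm q.1
    rw [Fin.lt_def, Fin.val_cast] at h'
    omega

/-- The decoration of the restriction of a decorated map to a subset. -/
theorem DMap.HasDec.restrict {X X' Y : Type} [Enumerated X] [Enumerated X'] [Enumerated Y]
    {φ : DMap P X Y} {y : Y} {n : ℕ} {j : Fin n → X} {α : P.Op n} (h : φ.HasDec y j α) {i : X' → X}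
    (hi : Function.Injective i) {Z : Finset (Fin n)} (hZ : ∀ l, l ∈ Z ↔ j l ∉ Set.range i) {q : ℕ}
    (hq : q + Z.card = n) : ∃ (j' : Fin q → X') (e : Fin q → Fin n),
      (φ.comp (incl P i hi)).HasDec y j' (P.plugZeros α Z q hq) ∧ StrictMono e ∧ i ∘ j' = j ∘ e := by
  -- An input in `Z` has empty preimage and decoration `0`, any other has one preimage and
  -- decoration `1`. The case distinction follows the arguments of `γ` in `plugZeros` literally.
  have H : ∀ l, ∃ J : Fin (if l ∈ Z then 0 else 1) → X', (∀ t, i (J t) = j l) ∧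
      (incl P i hi).HasDec (j l) J
        (if hl : l ∈ Z then P.reindex (finCongr (if_pos hl)) P.zero
          else P.reindex (finCongr (if_neg hl)) P.one) := by
    intro l
    by_cases hl : l ∈ Z
    · have e : (if l ∈ Z then 0 else 1) = 0 := if_pos hl
      refine ⟨Fin.elim0 ∘ finCongr e, fun t => (finCongr e t).elim0, ?_⟩
      rw [dif_pos hl]
      exact (incl_hasDec_zero (P := P) i hi ((hZ l).1 hl)).reindex (finCongr e)
    · obtain ⟨x, hx⟩ := not_not.1 (mt (hZ l).2 hl)
      have e : (if l ∈ Z then 0 else 1) = 1 := if_neg hl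
      refine ⟨fun _ => x, fun t => hx, ?_⟩
      rw [dif_neg hl, ← hx]
      exact (incl_hasDec (P := P) i hi x).reindex (finCongr e)
  choose J hJ H using H
  refine ⟨_, fun t => (finSigmaFinEquiv.symm (finCongr (sum_zero_one hq) t)).1,
    (h.comp H).reindex (finCongr (sum_zero_one hq)), ?_, ?_⟩
  · intro s t hst
    exact finSigma_fst_strictMono (fun k => by split_ifs <;> omega) hst
  · funext t
    exact hJ _ _

/-- Two neighbouring blocks. -/
def VHom.blocks {N p q a : ℕ} (ha : a = N + 1 + q + p) (i : Fin N) (β : P.Op (p + 1))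
    (β' : P.Op (q + 1)) : VHom P a (N + 1) :=
  (VHom.block (a := N + 1 + q) rfl i.succ β').comp (VHom.block ha (i.castSucc.castAdd q) β)

section

variable {N p q a : ℕ} (ha : a = N + 1 + q + p) (i : Fin N) (β : P.Op (p + 1)) (β' : P.Op (q + 1))

theorem fn_blocks : (VHom.blocks ha i β β').toD.fn =
    collapse (a := N + 1 + q) rfl i.succ ∘ collapse ha (i.castSucc.castAdd q) := rfl

theorem fn_blocks_val (x : Fin a) : ((VHom.blocks ha i β β').toD.fn x : ℕ) =
    if (x : ℕ) ≤ i then (x : ℕ) else if (x : ℕ) ≤ i + p then i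
      else if (x : ℕ) ≤ i + p + 1 + q then i + 1 else x - p - q := by
  simp only [fn_blocks, Function.comp_apply, collapse_val, Fin.val_castAdd, Fin.val_castSucc,
    Fin.val_succ]
  split_ifs <;> omega

theorem blocks_hasDec_left : (VHom.blocks ha i β β').toD.HasDec i.castSucc
    (fun t : Fin (p + 1) => (⟨i + t, by omega⟩ : Fin a)) β := by
  have h1 := block_hasDec ha (i.castSucc.castAdd q) β
  refine DMap.HasDec.comp_of_one_left (block_hasDec_of_ne _ _ _ (x := i.castSucc.castAdd q) ?_ ?_) h1
  · simp only [Fin.ext_iff, collapse_val, Fin.val_castAdd, Fin.val_castSucc, Fin.val_succ]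
    split_ifs <;> omega
  · simp [Fin.ext_iff]

theorem blocks_hasDec_right : (VHom.blocks ha i β β').toD.HasDec i.succ
    (fun t : Fin (q + 1) => (⟨i + (p + 1) + t, by omega⟩ : Fin a)) β' := by
  have h1 := block_hasDec (a := N + 1 + q) rfl i.succ β'
  refine DMap.HasDec.comp_of_one_right h1 fun t => block_hasDec_of_ne _ _ _ ?_ ?_
  · simp only [Fin.ext_iff, collapse_val, Fin.val_castAdd, Fin.val_castSucc, Fin.val_succ]
    split_ifs <;> omega
  · simp only [ne_eq, Fin.ext_iff, Fin.val_castAdd, Fin.val_castSucc, Fin.val_succ]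
    omega

theorem blocks_hasDec_of_ne {y : Fin (N + 1)} (h1 : y ≠ i.castSucc) (h2 : y ≠ i.succ) {x : Fin a}
    (hx : (VHom.blocks ha i β β').toD.fn x = y) :
    (VHom.blocks ha i β β').toD.HasDec y (fun _ : Fin 1 => x) P.one := by
  refine DMap.HasDec.comp_of_one_left (block_hasDec_of_ne (a := N + 1 + q) rfl i.succ β' hx h2)
    (block_hasDec_of_ne _ _ _ rfl fun h => h1 ?_)
  rw [← hx]
  refine (congrArg (collapse (a := N + 1 + q) rfl i.succ) h).trans ?_
  simp only [Fin.ext_iff, collapse_val, Fin.val_castAdd, Fin.val_castSucc, Fin.val_succ]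
  split_ifs <;> omega

theorem blocks_surjective : Function.Surjective (VHom.blocks ha i β β').toD.fn :=
  (collapse_surjective rfl i.succ).comp (collapse_surjective ha (i.castSucc.castAdd q))

end

/-! ### A collapse and a block at the same place -/

section

variable {N k : ℕ} (i : Fin N) (α : P.Op (k + 1))

/-- The top map of the square of a collapse and a block at the same place. -/
def topMap (k : ℕ) (i : Fin N) : Fin (N + 1 + 2 * k) → Fin (N + k) := fun x =>
  ⟨if (x : ℕ) ≤ i + k then x else x - (k + 1), by split_ifs <;> omega⟩

theorem topMap_val (x : Fin (N + 1 + 2 * k)) :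
    (topMap k i x : ℕ) = if (x : ℕ) ≤ i + k then (x : ℕ) else x - (k + 1) := rfl

/-- The left map of the square of a collapse and a block at the same place. -/
abbrev VHom.leftMap : VHom P (N + 1 + 2 * k) (N + 1) :=
  VHom.blocks (q := k) (p := k) (by omega) i α α

/-- The two points of the glued pair each carry a copy of the block, the copies standing side by
side in the corner; the top map superposes them. -/
theorem sq_block_eq : Sq (topMap k i) (VHom.leftMap i α).toD
    (VHom.block (a := N + k) rfl i α).toD (collapse (a := N + 1) rfl i) where
  comm x := by
    simp only [fn_block, Fin.ext_iff, collapse_val, topMap_val, fn_blocks_val]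
    split_ifs <;> omega
  pullback b c hbc := by
    -- The value of `c` decides which of the two copies contains the point.
    refine ⟨⟨if (c : ℕ) ≤ i then b else b + (k + 1), by
      simp only [fn_block, Fin.ext_iff, collapse_val] at hbc
      split_ifs at * <;> omega⟩, ?_⟩
    simp only [fn_block, Fin.ext_iff, collapse_val, topMap_val, fn_blocks_val] at hbc ⊢
    split_ifs at * <;> omega
  inj x x' h h' := by
    simp only [Fin.ext_iff, topMap_val, fn_blocks_val] at *
    split_ifs at h h' <;> omega
  dec c := by
    by_cases h1 : c = i.castSucc
    · subst h1
      refine ⟨_, _, _, blocks_hasDec_left _ i α α, ?_⟩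
      convert block_hasDec (a := N + k) rfl i α using 1
      · simp only [Fin.ext_iff, collapse_val, Fin.val_castSucc]
        split_ifs <;> omega
      · funext t
        simp only [Function.comp_apply, Fin.ext_iff, topMap_val]
        split_ifs <;> omega
    by_cases h2 : c = i.succ
    · subst h2
      refine ⟨_, _, _, blocks_hasDec_right _ i α α, ?_⟩
      convert block_hasDec (a := N + k) rfl i α using 1
      · simp only [Fin.ext_iff, collapse_val, Fin.val_succ]
        split_ifs <;> omega
      · funext t
        simp only [Function.comp_apply, Fin.ext_iff, topMap_val]
        split_ifs <;> omega
    obtain ⟨x, hx⟩ := blocks_surjective (a := N + 1 + 2 * k) (by omega) i α α c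
    refine ⟨_, _, _, blocks_hasDec_of_ne _ i α α h1 h2 hx, block_hasDec_of_ne _ i α ?_ ?_⟩
    · simp only [Fin.ext_iff, collapse_val, fn_blocks_val] at *
      split_ifs at * <;> omega
    · simp only [ne_eq, Fin.ext_iff, collapse_val, Fin.val_succ, Fin.val_castSucc] at *
      split_ifs at * <;> omega

/-- The restriction of the left map to the complement of a set of columns. -/
theorem blocks_eq_restrict {U : Finset (Fin (k + 1)) × Finset (Fin (k + 1))} {p q a : ℕ}
    (ha : a = N + 1 + q + p) (hp : p + 1 + U.1.card = k + 1) (hq : q + 1 + U.2.card = k + 1)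
    {e : Fin a → Fin (N + 1 + 2 * k)} (he : StrictMono e)
    (h0 : ∀ l : Fin (k + 1), l ∈ U.1 ↔ (⟨i + l, by omega⟩ : Fin (N + 1 + 2 * k)) ∉ Set.range e)
    (h1 : ∀ l : Fin (k + 1), l ∈ U.2 ↔
      (⟨i + (k + 1) + l, by omega⟩ : Fin (N + 1 + 2 * k)) ∉ Set.range e)
    (h2 : ∀ x : Fin (N + 1 + 2 * k), (x : ℕ) < i ∨ i + (k + 1) + k < (x : ℕ) → x ∈ Set.range e) :
    (VHom.blocks ha i (P.plugZeros α U.1 (p + 1) hp) (P.plugZeros α U.2 (q + 1) hq)).toD =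
      (VHom.leftMap i α).toD.comp (DMap.incl P e he.injective) := by
  obtain ⟨j, d, hj, hd, hjd⟩ := (blocks_hasDec_left (by omega) i α α).restrict he.injective h0 hp
  obtain ⟨j', d', hj', hd', hjd'⟩ :=
    (blocks_hasDec_right (by omega) i α α).restrict he.injective h1 hq
  have hL := blocks_hasDec_left ha i (P.plugZeros α U.1 (p + 1) hp)
    (P.plugZeros α U.2 (q + 1) hq)
  have hR := blocks_hasDec_right ha i (P.plugZeros α U.1 (p + 1) hp)
    (P.plugZeros α U.2 (q + 1) hq)
  have h3 : ∀ y, y ≠ i.castSucc → y ≠ i.succ → ∃ x,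
      ((VHom.leftMap i α).toD.comp (DMap.incl P e he.injective)).HasDec y
        (fun _ : Fin 1 => x) P.one := by
    intro y hy hy'
    obtain ⟨x, hx⟩ := blocks_surjective (a := N + 1 + 2 * k) (by omega) i α α y
    obtain ⟨x', rfl⟩ := h2 x (by
      simp only [ne_eq, Fin.ext_iff, fn_blocks_val, Fin.val_castSucc, Fin.val_succ] at hx hy hy'
      split_ifs at hx <;> omega)
    exact ⟨x', (blocks_hasDec_of_ne _ i α α hy hy' hx).comp_incl (j := fun _ : Fin 1 => x') he.injective⟩
  have hfn : (VHom.blocks ha i (P.plugZeros α U.1 (p + 1) hp)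
      (P.plugZeros α U.2 (q + 1) hq)).toD.fn =
      ((VHom.leftMap i α).toD.comp (DMap.incl P e he.injective)).fn := by
    -- Both maps are monotone, so counting fibres suffices: the blocks have `p + 1` and `q + 1`
    -- points, all other fibres one.
    refine eq_of_monotone_of_card ?_ ?_ fun y => ?_
    · exact (collapse_monotone rfl i.succ).comp (collapse_monotone ha (i.castSucc.castAdd q))
    · rw [DMap.fn_comp_incl]
      exact ((collapse_monotone (a := N + 1 + k) rfl i.succ).comp
        (collapse_monotone (a := N + 1 + 2 * k) (by omega) (i.castSucc.castAdd k))).comp he.monotone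
    · by_cases hy : y = i.castSucc
      · subst hy
        rw [hL.enumerates.card, hj.enumerates.card]
      by_cases hy' : y = i.succ
      · subst hy'
        rw [hR.enumerates.card, hj'.enumerates.card]
      obtain ⟨x, hx⟩ := h3 y hy hy'
      obtain ⟨x', hx'⟩ := blocks_surjective ha i (P.plugZeros α U.1 (p + 1) hp)
        (P.plugZeros α U.2 (q + 1) hq) y
      rw [hx.enumerates.card, (blocks_hasDec_of_ne ha i _ _ hy hy' hx').enumerates.card]
  -- The enumerations obtained by restriction are increasing because they are so after applying `e`;
  -- hence they coincide with the standard ones.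
  have hmono : ∀ {m n : ℕ} {j : Fin m → Fin a} {J : Fin n → Fin (N + 1 + 2 * k)} {d : Fin m → Fin n},
      StrictMono J → StrictMono d → e ∘ j = J ∘ d → StrictMono j := by
    intro m n j J d hJ hd h s t hst
    have := congrFun h
    simp only [Function.comp_apply] at this
    rw [← he.lt_iff_lt, this, this]
    exact hJ (hd hst)
  refine DMap.ext_hasDec hfn fun y => ?_
  by_cases hy : y = i.castSucc
  · subst hy
    refine ⟨_, _, _, hL, ?_⟩
    rwa [hL.enumerates.eq_of_strictMono hj.enumerates (fun s t hst => by simpa using hst)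
      (hmono (fun s t hst => by simpa using hst) hd hjd) fun x => by rw [hfn]]
  by_cases hy' : y = i.succ
  · subst hy'
    refine ⟨_, _, _, hR, ?_⟩
    rwa [hR.enumerates.eq_of_strictMono hj'.enumerates (fun s t hst => by simpa using hst)
      (hmono (fun s t hst => by simpa using hst) hd' hjd') fun x => by rw [hfn]]
  obtain ⟨x, hx⟩ := h3 y hy hy'
  exact ⟨_, _, _, blocks_hasDec_of_ne ha i _ _ hy hy' (by rw [hfn, hx.enumerates.apply 0]), hx⟩

end

/-! ### Identification of the summands of the long relation -/

/-- The composite of the collapses at the positions of a list. -/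
def foldMap {b : ℕ} : (L : List (Fin b)) → Fin (b + L.length) → Fin b
  | [] => id
  | v :: L => foldMap L ∘ collapse (a := b + L.length + 1) rfl (v.castAdd L.length)

theorem opPs_eq_ps {b : ℕ} (L : List (Fin b)) : M.opPs L = M.ps (foldMap L) := by
  induction L with
  | nil => exact (M.ps_id (X := Fin b) rfl).symm
  | cons v L ih =>
    change (M.opPs L).comp (M.opP (a := b + L.length + 1) rfl (v.castAdd L.length)) = _
    rw [ih, opP_eq_ps]
    exact (M.ps_comp (collapse_surjective _ _) (foldMap L)).symm

theorem foldMap_monotone {b : ℕ} (L : List (Fin b)) : Monotone (foldMap L) := by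
  induction L with
  | nil => exact monotone_id
  | cons v L ih => exact ih.comp (collapse_monotone _ _)

/-- The collapse is split by omitting `i.succ`, which is the one additional point and lies over `i`.
-/
theorem card_fiber_comp_collapse {b c : ℕ} (f : Fin b → Fin c) (i : Fin b) (y : Fin c) :
    (fiber (f ∘ collapse (a := b + 1) rfl i) y).card =
      (fiber f y).card + if f i = y then 1 else 0 := by
  have h1 : collapse (a := b + 1) rfl i i.succ = i := by
    simp only [Fin.ext_iff, collapse_val, Fin.val_succ]
    split_ifs <;> omega
  have h2 : ∀ x, collapse (a := b + 1) rfl i (i.succ.succAbove x) = x := by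
    intro x
    simp only [Fin.ext_iff, collapse_val, Fin.succAbove, Fin.lt_def, Fin.val_castSucc, Fin.val_succ]
    split_ifs <;> simp_all <;> omega
  simp only [fiber, Finset.card_filter, Function.comp_apply]
  rw [Fin.sum_univ_succAbove _ i.succ, h1, add_comm]
  simp only [h2]

theorem foldMap_castAdd {b : ℕ} {L : List (Fin b)} {v : Fin b} (hv : ∀ l ∈ L, v ≤ l) :
    foldMap L (v.castAdd L.length) = v := by
  induction L with
  | nil => rfl
  | cons w L ih =>
    have h : collapse (a := b + L.length + 1) rfl (w.castAdd L.length)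
        (v.castAdd (L.length + 1)) = v.castAdd L.length := by
      have := hv w (by simp)
      rw [Fin.le_def] at this
      simp only [Fin.ext_iff, collapse_val, Fin.val_castAdd]
      split_ifs
      omega
    change foldMap L (collapse _ _ (v.castAdd (L.length + 1))) = v
    rw [h, ih fun l hl => hv l (by simp [hl])]

/-- In an increasing list the later collapses fix the earlier positions, so each listed position
gains one preimage and no two gains coincide. -/
theorem card_fiber_foldMap {b : ℕ} {L : List (Fin b)} (hL : L.Pairwise (· < ·)) (y : Fin b) :
    (fiber (foldMap L) y).card = 1 + if y ∈ L then 1 else 0 := by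
  induction L with
  | nil => exact (card_fiber_id y).trans (by simp)
  | cons v L ih =>
    rw [List.pairwise_cons] at hL
    change (fiber (foldMap L ∘ collapse (a := b + L.length + 1) rfl (v.castAdd L.length)) y).card = _
    rw [card_fiber_comp_collapse, ih hL.2, foldMap_castAdd fun l hl => (hL.1 l hl).le]
    by_cases hy : v = y
    · subst hy
      have : v ∉ L := fun h => lt_irrefl _ (hL.1 v h)
      simp [this]
    · have : y ≠ v := fun h => hy h.symm
      simp [hy, this]

theorem card_fiber {a b : ℕ} (f : Fin a → Fin b) (y : Fin b) :
    Nat.card {x // f x = y} = (fiber f y).card := by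
  rw [Nat.card_eq_fintype_card, Fintype.card_subtype]
  rfl

theorem card_fiber_comp_orderEmb {L a b : ℕ} (f : Fin L → Fin b) (S : Finset (Fin L))
    (h : S.card = a) (y : Fin b) :
    (fiber (f ∘ S.orderEmbOfFin h) y).card = (S.filter (f · = y)).card := by
  rw [← Finset.card_map (S.orderEmbOfFin h).toEmbedding]
  congr 1
  ext x
  simp only [Finset.mem_map, mem_fiber, Finset.mem_filter, Function.comp_apply]
  constructor
  · rintro ⟨t, rfl, rfl⟩
    exact ⟨S.orderEmbOfFin_mem h t, rfl⟩
  · rintro ⟨hx, rfl⟩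
    have : x ∈ Set.range (S.orderEmbOfFin h) := by rwa [Finset.range_orderEmbOfFin]
    obtain ⟨t, rfl⟩ := this
    exact ⟨t, rfl, rfl⟩

section

variable {N k : ℕ} (i : Fin N) (U : LongIndex k)

theorem LongIndex.mem_columns_left (l : Fin (k + 1)) :
    (⟨i + l, by omega⟩ : Fin (N + 1 + 2 * k)) ∈ U.columns i ↔ l ∈ U.1.1 := by
  simp only [LongIndex.columns, Finset.mem_union, Finset.mem_image, Fin.mk.injEq]
  refine ⟨?_, fun h => Or.inl ⟨l, h, rfl⟩⟩
  rintro (⟨l', h, h'⟩ | ⟨l', h, h'⟩)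
  · rwa [show l = l' from Fin.ext (by omega)]
  · omega

theorem LongIndex.mem_columns_right (l : Fin (k + 1)) :
    (⟨i + (k + 1) + l, by omega⟩ : Fin (N + 1 + 2 * k)) ∈ U.columns i ↔ l ∈ U.1.2 := by
  simp only [LongIndex.columns, Finset.mem_union, Finset.mem_image, Fin.mk.injEq]
  refine ⟨?_, fun h => Or.inr ⟨l, h, rfl⟩⟩
  rintro (⟨l', h, h'⟩ | ⟨l', h, h'⟩)
  · omega
  · rwa [show l = l' from Fin.ext (by omega)]

theorem LongIndex.notMem_columns {x : Fin (N + 1 + 2 * k)}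
    (h : (x : ℕ) < i ∨ i + (k + 1) + k < (x : ℕ)) : x ∉ U.columns i := by
  simp only [LongIndex.columns, Finset.mem_union, Finset.mem_image, Fin.ext_iff]
  rintro (⟨l', -, h'⟩ | ⟨l', -, h'⟩) <;> omega

theorem LongIndex.mem_kept (y : Fin (N + k)) :
    y ∈ U.kept i ↔ ∃ l : Fin (k + 1), l ∉ U.1.1 ∧ l ∉ U.1.2 ∧ (y : ℕ) = i + l := by
  simp only [LongIndex.kept, List.mem_map, Finset.mem_sort, Finset.mem_compl, Finset.mem_union,
    not_or, Fin.ext_iff]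
  exact ⟨fun ⟨l, h, h'⟩ => ⟨l, h.1, h.2, h'.symm⟩, fun ⟨l, h, h1, h'⟩ => ⟨l, ⟨h, h1⟩, h'.symm⟩⟩

theorem LongIndex.kept_pairwise : (U.kept i).Pairwise (· < ·) := by
  rw [LongIndex.kept, List.pairwise_map]
  refine (Finset.sortedLT_sort _).pairwise.imp fun {l l'} h => ?_
  exact Fin.lt_def.2 (Nat.add_lt_add_left (Fin.lt_def.1 h) _)

/-- Over `i + l` lie two points, one in each copy. Disjointness of `U₀` and `U₁` keeps at least one
of them; both survive exactly at the kept positions. -/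
theorem card_filter_topMap (y : Fin (N + k)) :
    ((U.columns i)ᶜ.filter (topMap k i · = y)).card = 1 + if y ∈ U.kept i then 1 else 0 := by
  by_cases hy : (i : ℕ) ≤ y ∧ (y : ℕ) ≤ i + k
  · obtain ⟨l, hl⟩ : ∃ l : Fin (k + 1), (y : ℕ) = i + l := ⟨⟨y - i, by omega⟩, by simp; omega⟩
    have hk : y ∈ U.kept i ↔ l ∉ U.1.1 ∧ l ∉ U.1.2 := by
      rw [U.mem_kept]
      refine ⟨fun ⟨l', h, h', e⟩ => ?_, fun ⟨h, h'⟩ => ⟨l, h, h', hl⟩⟩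
      rw [show l = l' from Fin.ext (by omega)]
      exact ⟨h, h'⟩
    have e : (U.columns i)ᶜ.filter (topMap k i · = y) =
        ({⟨i + l, by omega⟩, ⟨i + (k + 1) + l, by omega⟩} : Finset (Fin (N + 1 + 2 * k))).filter
          (· ∉ U.columns i) := by
      ext x
      simp only [Finset.mem_filter, Finset.mem_compl, Finset.mem_insert, Finset.mem_singleton]
      rw [and_comm]
      refine and_congr_left fun _ => ?_
      simp only [Fin.ext_iff, topMap_val]
      split_ifs <;> omega
    have hd : l ∈ U.1.1 → l ∉ U.1.2 := fun h h' => Finset.disjoint_left.1 U.2.1 h h'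
    rw [e, Finset.filter_insert, Finset.filter_singleton]
    simp only [U.mem_columns_left, U.mem_columns_right, hk]
    by_cases h1 : l ∈ U.1.1
    · simp [h1, hd h1]
    · by_cases h2 : l ∈ U.1.2
      · simp [h1, h2]
      · simp only [h1, h2, not_false_eq_true, if_true, and_self]
        rw [Finset.card_pair]
        simp [Fin.ext_iff]
  · have hk : y ∉ U.kept i := by
      rw [U.mem_kept]
      rintro ⟨l, -, -, h⟩
      omega
    rw [if_neg hk, Finset.card_eq_one]
    refine ⟨⟨if (y : ℕ) < i then y else y + (k + 1), by split_ifs <;> omega⟩, ?_⟩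
    ext x
    simp only [Finset.mem_filter, Finset.mem_compl, Finset.mem_singleton]
    constructor
    · rintro ⟨-, h⟩
      simp only [Fin.ext_iff, topMap_val] at h ⊢
      split_ifs at * <;> omega
    · rintro rfl
      refine ⟨U.notMem_columns i ?_, ?_⟩
      · simp only
        split_ifs <;> omega
      · simp only [Fin.ext_iff, topMap_val]
        split_ifs at * <;> omega

theorem removeColumns_apply {m a b : ℕ} (σ : Equiv.Perm (Fin m)) (C : Finset (Fin m))
    (ha : Cᶜ.card = a) (hb : (Cᶜ.map σ.toEmbedding).card = b) (x : Fin a) :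
    (Cᶜ.map σ.toEmbedding).orderEmbOfFin hb (removeColumns σ C ha hb x) =
      σ (Cᶜ.orderEmbOfFin ha x) := by
  simp only [removeColumns, Equiv.trans_apply, ← Finset.coe_orderIsoOfFin_apply]
  change (((Cᶜ.map σ.toEmbedding).orderIsoOfFin hb
    (((Cᶜ.map σ.toEmbedding).orderIsoOfFin hb).symm _) : _) : Fin m) = _
  rw [OrderIso.apply_symm_apply]
  rfl

/-- This is the purpose of `σ`: it puts the two copies of each input next to each other, after which
the top map is monotone. -/
theorem exists_topMap_eq : ∃ G : Fin (N + 1 + 2 * k) → Fin (N + k), Monotone G ∧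
    topMap k i = G ∘ interleave k i := by
  refine ⟨fun y => ⟨if (y : ℕ) < i then y else if (y : ℕ) ≤ i + 2 * k + 1 then i + (y - i) / 2
    else y - (k + 1), by split_ifs <;> omega⟩, fun x y hxy => ?_, funext fun x => ?_⟩
  · simp only [Fin.le_def] at *
    split_ifs <;> omega
  · simp only [Function.comp_apply, Fin.ext_iff, topMap_val, interleave, Equiv.coe_fn_mk]
    split_ifs <;> omega

theorem LongIndex.card_compl_columns : (U.columns i)ᶜ.card =
    N + 1 + (k - U.1.2.card) + (k - U.1.1.card) := by
  have := U.2.2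
  rw [Finset.card_compl, U.card_columns, Fintype.card_fin]
  omega

/-- After the renumbered permutation is split off, both sides become monotone maps, and their fibre
sizes were computed in `card_fiber_foldMap` and `card_filter_topMap`. -/
theorem foldMap_kept_comp_perm : foldMap (U.kept i) ∘ U.perm i =
    topMap k i ∘ (U.columns i)ᶜ.orderEmbOfFin (U.card_compl_columns i) := by
  obtain ⟨G, hG, hG'⟩ := exists_topMap_eq (k := k) i
  have hb : ((U.columns i)ᶜ.map (interleave k i).toEmbedding).card =
      N + k + (U.kept i).length := by
    have := U.card_union_le
    rw [Finset.card_map, Finset.card_compl, U.card_columns, Fintype.card_fin, U.length_kept]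
    omega
  have h1 : topMap k i ∘ (U.columns i)ᶜ.orderEmbOfFin (U.card_compl_columns i) =
      (G ∘ ((U.columns i)ᶜ.map (interleave k i).toEmbedding).orderEmbOfFin hb) ∘ U.perm i := by
    funext x
    rw [hG']
    exact congrArg G (removeColumns_apply (interleave k i) (U.columns i) _ hb x).symm
  have h2 : foldMap (U.kept i) =
      G ∘ ((U.columns i)ᶜ.map (interleave k i).toEmbedding).orderEmbOfFin hb := by
    refine eq_of_monotone_of_card (foldMap_monotone _) (hG.comp (OrderEmbedding.monotone _))
      fun y => ?_
    have e : Nat.card {x // (G ∘ ((U.columns i)ᶜ.map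
          (interleave k i).toEmbedding).orderEmbOfFin hb) x = y} =
        Nat.card {x // (topMap k i ∘ (U.columns i)ᶜ.orderEmbOfFin (U.card_compl_columns i)) x = y} := by
      rw [h1]
      exact Nat.card_congr ((U.perm i).subtypeEquiv fun x => Iff.rfl).symm
    rw [e, card_fiber, card_fiber, card_fiber_foldMap (U.kept_pairwise i),
      card_fiber_comp_orderEmb, card_filter_topMap]
  rw [h1, h2]

/-- The summand of an admissible subset of the corner. -/
noncomputable def Janus.cornerTerm (M : Janus.{u, v} P) (α : P.Op (k + 1)) :
    M.obj (N + 1) →+ M.obj (N + k) :=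
  M.term (fun x : {x // x ∉ U.columns i} => topMap k i x)
    ((VHom.leftMap i α).toD.comp
      (DMap.incl P (fun x : {x // x ∉ U.columns i} => x.1) Subtype.val_injective))

/-- Any increasing parametrization of the remaining columns computes the summand. The arities `p`,
`q` are free parameters, so that special cases can be stated with literal numbers. -/
theorem Janus.PermInverse.cornerTerm_eq (hM : M.PermInverse) (α : P.Op (k + 1)) {p q a : ℕ}
    (ha : a = N + 1 + q + p) (hp : p + 1 + U.1.1.card = k + 1) (hq : q + 1 + U.1.2.card = k + 1)
    {e : Fin a → Fin (N + 1 + 2 * k)} (he : StrictMono e)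
    (he' : ∀ x, x ∈ Set.range e ↔ x ∉ U.columns i) :
    M.cornerTerm i U α = (M.ps (topMap k i ∘ e)).comp
      ((M.opH (p := p) ha (i.castSucc.castAdd q) (P.plugZeros α U.1.1 (p + 1) hp)).comp
        (M.opH (p := q) rfl i.succ (P.plugZeros α U.1.2 (q + 1) hq))) := by
  have h1 := blocks_eq_restrict (U := U.1) i α ha hp hq he
    (fun l => by rw [he', not_not, U.mem_columns_left])
    (fun l => by rw [he', not_not, U.mem_columns_right])
    (fun x hx => by rw [he']; exact U.notMem_columns i hx)
  have h2 : (M.opH (p := p) ha (i.castSucc.castAdd q) (P.plugZeros α U.1.1 (p + 1) hp)).comp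
        (M.opH (p := q) rfl i.succ (P.plugZeros α U.1.2 (q + 1) hq)) =
      M.pl ((VHom.leftMap i α).toD.comp (DMap.incl P e he.injective)) := by
    rw [← h1, opH_eq_pl, opH_eq_pl]
    exact (M.pl_comp (φ := (VHom.block ha (i.castSucc.castAdd q)
      (P.plugZeros α U.1.1 (p + 1) hp)).toD) (collapse_surjective ha (i.castSucc.castAdd q)) _).symm
  rw [h2]
  let E : Fin a ≃ {x // x ∉ U.columns i} := (Equiv.ofInjective e he.injective).trans
    (Equiv.subtypeEquivRight he')
  refine (hM.term_equiv' E rfl ?_).symm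
  rw [DMap.comp_assoc, DMap.incl_comp_incl]
  rfl

theorem Janus.PermInverse.longTerm_eq (hM : M.PermInverse) (α : P.Op (k + 1)) :
    M.longTerm i α U = M.cornerTerm i U α := by
  rw [hM.cornerTerm_eq i U α (p := k - U.1.1.card) (q := k - U.1.2.card) rfl
    (by have := U.2.2.1; omega) (by have := U.2.2.2; omega)
    (e := (U.columns i)ᶜ.orderEmbOfFin (U.card_compl_columns i)) (OrderEmbedding.strictMono _)
    (fun x => by rw [Finset.range_orderEmbOfFin]; simp), ← foldMap_kept_comp_perm,
    M.ps_comp (U.perm i).surjective, ← opPs_eq_ps, AddMonoidHom.comp_assoc]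
  rw [Janus.longTerm, ← M.ps_fin]

end

/-! ### Admissible subsets of the corner -/

section

variable {N k : ℕ} (i : Fin N) (α : P.Op (k + 1))

/-- Surjectivity of the top map forbids omitting both copies of an input; surjectivity of the left
map forbids omitting a whole copy. Points outside the two copies are alone over their image and must
stay. -/
theorem exists_longIndex {S : Set (Fin (N + 1 + 2 * k))}
    (h1 : Function.Surjective fun x : S => topMap k i x)
    (h2 : Function.Surjective fun x : S => (VHom.leftMap i α).toD.fn x) :
    ∃ U : LongIndex k, S = {x | x ∉ U.columns i} := by
  classical
  refine ⟨⟨(Finset.univ.filter fun l => (⟨i + l, by omega⟩ : Fin (N + 1 + 2 * k)) ∉ S,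
    Finset.univ.filter fun l => (⟨i + (k + 1) + l, by omega⟩ : Fin (N + 1 + 2 * k)) ∉ S),
    ?_, ?_, ?_⟩, ?_⟩
  · rw [Finset.disjoint_left]
    intro l hl hl'
    simp only [Finset.mem_filter, Finset.mem_univ, true_and] at hl hl'
    obtain ⟨x, hx⟩ := h1 ⟨i + l, by omega⟩
    simp only [Fin.ext_iff, topMap_val] at hx
    split_ifs at hx
    · exact hl (by convert x.2 using 1; exact Fin.ext hx.symm)
    · refine hl' (by convert x.2 using 1; exact Fin.ext (by simp only; omega))
  · obtain ⟨x, hx⟩ := h2 i.castSucc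
    have hx' : (i : ℕ) ≤ x.1.1 ∧ x.1.1 ≤ i + k := by
      simp only [Fin.ext_iff, fn_blocks_val, Fin.val_castSucc] at hx
      split_ifs at hx <;> omega
    rw [← Nat.lt_succ_iff]
    refine lt_of_lt_of_eq (Finset.card_lt_univ_of_notMem (x := ⟨x.1.1 - i, by omega⟩) ?_) (by simp)
    simp only [Finset.mem_filter, Finset.mem_univ, true_and, not_not]
    convert x.2 using 1
    exact Fin.ext (by simp only; omega)
  · obtain ⟨x, hx⟩ := h2 i.succ
    have hx' : (i : ℕ) + (k + 1) ≤ x.1.1 ∧ x.1.1 ≤ i + (k + 1) + k := by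
      simp only [Fin.ext_iff, fn_blocks_val, Fin.val_succ] at hx
      split_ifs at hx <;> omega
    rw [← Nat.lt_succ_iff]
    refine lt_of_lt_of_eq (Finset.card_lt_univ_of_notMem (x := ⟨x.1.1 - (i + (k + 1)), by omega⟩) ?_)
      (by simp)
    simp only [Finset.mem_filter, Finset.mem_univ, true_and, not_not]
    convert x.2 using 1
    exact Fin.ext (by simp only; omega)
  · ext x
    rw [Set.mem_ofPred_eq]
    by_cases hx : (x : ℕ) < i ∨ i + (k + 1) + k < (x : ℕ)
    · refine iff_of_true ?_ (LongIndex.notMem_columns i _ hx)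
      obtain ⟨s, hs⟩ := h1 (topMap k i x)
      convert s.2 using 1
      simp only [Fin.ext_iff, topMap_val] at hs ⊢
      split_ifs at hs <;> omega
    by_cases hx' : (x : ℕ) ≤ i + k
    · obtain ⟨l, _, rfl⟩ : ∃ (l : Fin (k + 1)) (h : _), (⟨i + l, h⟩ : Fin (N + 1 + 2 * k)) = x :=
        ⟨⟨x - i, by omega⟩, by simp only; omega, Fin.ext (by simp only; omega)⟩
      rw [LongIndex.mem_columns_left]
      simp
    · obtain ⟨l, _, rfl⟩ : ∃ (l : Fin (k + 1)) (h : _),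
          (⟨i + (k + 1) + l, h⟩ : Fin (N + 1 + 2 * k)) = x :=
        ⟨⟨x - (i + (k + 1)), by omega⟩, by simp only; omega, Fin.ext (by simp only; omega)⟩
      rw [LongIndex.mem_columns_right]
      simp

theorem termSum_block : M.termSum (topMap k i) (VHom.leftMap i α).toD =
    ∑ U : LongIndex k, M.cornerTerm i U α := by
  symm
  refine Finset.sum_of_injOn (fun U => {x | x ∉ U.columns i}) ?_
    (fun _ _ => Finset.mem_coe.2 (Finset.mem_univ _)) (fun S _ hS => ?_) fun U _ => rfl
  · intro U _ V _ h
    have h' : ∀ x, x ∈ U.columns i ↔ x ∈ V.columns i := fun x =>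
      not_iff_not.1 (Set.ext_iff.1 h x)
    refine Subtype.ext (Prod.ext (Finset.ext fun l => ?_) (Finset.ext fun l => ?_))
    · rw [← U.mem_columns_left i, ← V.mem_columns_left i, h']
    · rw [← U.mem_columns_right i, ← V.mem_columns_right i, h']
  · by_cases h1 : Function.Surjective (fun x : S => topMap k i x)
    swap
    · exact Janus.term_of_not_surjective_left h1
    by_cases h2 : Function.Surjective (fun x : S => (VHom.leftMap i α).toD.fn x)
    swap
    · exact Janus.term_of_not_surjective_right (by rwa [DMap.fn_comp_incl])
    obtain ⟨U, rfl⟩ := exists_longIndex i α h1 h2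
    exact (hS ⟨U, Finset.mem_coe.2 (Finset.mem_univ _), rfl⟩).elim

theorem formula_block_eq_iff :
    M.Formula (topMap k i) (VHom.leftMap i α).toD (VHom.block (a := N + k) rfl i α).toD
      (collapse (a := N + 1) rfl i) ↔
    (M.opH (a := N + k) rfl i α).comp (M.opP (a := N + 1) rfl i) =
      ∑ U : LongIndex k, M.cornerTerm i U α := by
  rw [Janus.Formula, termSum_block, opH_eq_pl, opP_eq_ps]

end

/-! ### The presentation for a general operad -/

theorem Janus.PermInverse.blockFormula (hM : M.PermInverse) {k : ℕ}
    (hlt : ∀ {N : ℕ} (i j : Fin N) (α : P.Op (k + 1)), i < j →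
      (M.opH (a := N + k) rfl j α).comp (M.opP (a := N + 1) rfl i) =
        (M.opP (a := N + k + 1) rfl (i.castAdd k)).comp
          (M.opH (a := N + k + 1) (by omega) j.succ α))
    (hgt : ∀ {N : ℕ} (i j : Fin N) (α : P.Op (k + 1)), j < i →
      (M.opH (a := N + k) rfl j α).comp (M.opP (a := N + 1) rfl i) =
        (M.opP (a := N + k + 1) rfl (i.addNat k)).comp
          (M.opH (a := N + k + 1) (by omega) j.castSucc α))
    (heq : ∀ {N : ℕ} (i : Fin N) (α : P.Op (k + 1)),
      (M.opH (a := N + k) rfl i α).comp (M.opP (a := N + 1) rfl i) =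
        ∑ U : LongIndex k, M.cornerTerm i U α) : M.BlockFormula k := by
  intro N i l ω A _ _ f φ h
  rcases lt_trichotomy i l with hil | rfl | hil
  · exact ((sq_block_lt i l ω hil).formula_iff hM h).1
      ((formula_block_lt_iff i l ω hM hil).2 (hlt i l ω hil))
  · exact ((sq_block_eq i ω).formula_iff hM h).1 ((formula_block_eq_iff i ω).2 (heq i ω))
  · exact ((sq_block_gt i l ω hil).formula_iff hM h).1
      ((formula_block_gt_iff i l ω hM hil).2 (hgt i l ω hil))

theorem Janus.PermInverse.isPseudoMackey (hM : M.PermInverse) (hI : M.UnaryRelation)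
    (hB : ∀ k, 1 ≤ k → M.BlockFormula k ∨ ∀ ω : P.Op (k + 1), P.Decomposable ω) :
    IsPseudoMackey M :=
  isPseudoMackey_iff.2 ⟨hM, fun {a _ _ _ _ _ _ _} h hψ hg =>
    -- The bound is no restriction: the corner has exactly `a` elements.
    Janus.formulaUpTo hM hI hB a h hψ hg (by rw [Nat.card_fin]; omega)⟩

namespace IsPseudoMackey

variable (h : IsPseudoMackey M)
include h

theorem permInverse : M.PermInverse := (isPseudoMackey_iff.1 h).1

theorem unaryRelation : M.UnaryRelation := fun i α =>
  (unaryRelation_iff_formula h.permInverse i α).2 ((isPseudoMackey_iff.1 h).2 (sq_unary i α)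
    Function.surjective_id (collapse_surjective _ _))

theorem lt {N k : ℕ} (i j : Fin N) (α : P.Op (k + 1)) (hij : i < j) :
    (M.opH (a := N + k) rfl j α).comp (M.opP (a := N + 1) rfl i) =
      (M.opP (a := N + k + 1) rfl (i.castAdd k)).comp
        (M.opH (a := N + k + 1) (by omega) j.succ α) :=
  (formula_block_lt_iff i j α h.permInverse hij).1 ((isPseudoMackey_iff.1 h).2
    (sq_block_lt i j α hij) (collapse_surjective rfl j) (collapse_surjective _ _))

theorem gt {N k : ℕ} (i j : Fin N) (α : P.Op (k + 1)) (hij : j < i) :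
    (M.opH (a := N + k) rfl j α).comp (M.opP (a := N + 1) rfl i) =
      (M.opP (a := N + k + 1) rfl (i.addNat k)).comp
        (M.opH (a := N + k + 1) (by omega) j.castSucc α) :=
  (formula_block_gt_iff i j α h.permInverse hij).1 ((isPseudoMackey_iff.1 h).2
    (sq_block_gt i j α hij) (collapse_surjective rfl j) (collapse_surjective _ _))

theorem eq {N k : ℕ} (i : Fin N) (α : P.Op (k + 1)) :
    (M.opH (a := N + k) rfl i α).comp (M.opP (a := N + 1) rfl i) =
      ∑ U : LongIndex k, M.cornerTerm i U α :=
  (formula_block_eq_iff i α).1 ((isPseudoMackey_iff.1 h).2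
    (sq_block_eq i α) (collapse_surjective rfl i) (collapse_surjective _ _))

end IsPseudoMackey

/-- The presentation of pseudo-Mackey functors, for a general operad. -/
theorem isPseudoMackey_iff_relations : IsPseudoMackey M ↔ Relations M := by
  constructor
  · intro h
    have hM := h.permInverse
    refine ⟨hM.tau, h.unaryRelation, fun i j α _ => h.lt i j α, fun i j α _ => h.gt i j α,
      fun i α _ => ?_⟩
    rw [h.eq]
    exact Finset.sum_congr rfl fun U _ => (hM.longTerm_eq i U α).symm
  · intro h
    have hM := Janus.permInverse_of_tau fun i => (h.rel_T i).1
    refine hM.isPseudoMackey h.rel_I fun k hk => Or.inl (hM.blockFormula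
      (fun i j α => h.rel_lt i j α hk) (fun i j α => h.rel_gt i j α hk) fun i α => ?_)
    rw [h.rel_eq i α hk]
    exact Finset.sum_congr rfl fun U _ => hM.longTerm_eq i U α

/-! ### The number of terms -/

theorem card_le_iff_ne_univ {k : ℕ} {U : Finset (Fin (k + 1))} : U.card ≤ k ↔ U ≠ Finset.univ := by
  rw [Ne, ← Finset.card_eq_iff_eq_univ, Fintype.card_fin]
  have := Finset.card_le_univ U
  rw [Fintype.card_fin] at this
  omega

/-- The index set of the long relation in terms of functions to a set with three elements. -/
def LongIndex.equivFun (k : ℕ) : LongIndex k ≃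
    {f : Fin (k + 1) → Fin 3 // f ≠ (fun _ => 0) ∧ f ≠ fun _ => 1} where
  toFun U := ⟨fun l => if l ∈ U.1.1 then 0 else if l ∈ U.1.2 then 1 else 2, by
    refine ⟨fun h => card_le_iff_ne_univ.1 U.2.2.1 (Finset.eq_univ_of_forall fun l => ?_),
      fun h => card_le_iff_ne_univ.1 U.2.2.2 (Finset.eq_univ_of_forall fun l => ?_)⟩
    · by_contra hl
      have := congrFun h l
      simp only [if_neg hl] at this
      split_ifs at this <;> exact absurd this (by decide)
    · by_contra hl
      have := congrFun h l
      simp only [if_neg hl] at this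
      split_ifs at this <;> exact absurd this (by decide)⟩
  invFun f := ⟨(Finset.univ.filter (f.1 · = 0), Finset.univ.filter (f.1 · = 1)), by
    refine ⟨?_, card_le_iff_ne_univ.2 fun h => f.2.1 ?_, card_le_iff_ne_univ.2 fun h => f.2.2 ?_⟩
    · rw [Finset.disjoint_filter]
      intro l _ h h'
      exact absurd (h.symm.trans h') (by decide)
    · funext l
      simpa using h.ge (Finset.mem_univ l)
    · funext l
      simpa using h.ge (Finset.mem_univ l)⟩
  left_inv U := by
    refine Subtype.ext (Prod.ext (Finset.ext fun l => ?_) (Finset.ext fun l => ?_))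
    · by_cases h : l ∈ U.1.1 <;> by_cases h' : l ∈ U.1.2 <;> simp [h, h']
    · have : l ∈ U.1.1 → l ∉ U.1.2 := fun h h' => Finset.disjoint_left.1 U.2.1 h h'
      by_cases h : l ∈ U.1.1 <;> by_cases h' : l ∈ U.1.2 <;> simp_all
  right_inv f := by
    refine Subtype.ext (funext fun l => ?_)
    simp only [Finset.mem_filter, Finset.mem_univ, true_and]
    generalize f.1 l = x
    revert x
    decide

/-- Each input is omitted from the first copy, from the second or from neither; the two excluded
functions are those that omit a whole copy. -/
theorem LongIndex.card (k : ℕ) : Fintype.card (LongIndex k) = 3 ^ (k + 1) - 2 := by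
  rw [Fintype.card_congr (LongIndex.equivFun k), Fintype.card_subtype]
  have h : (Finset.univ.filter fun f : Fin (k + 1) → Fin 3 => f ≠ (fun _ => 0) ∧ f ≠ fun _ => 1) =
      ({fun _ => 0, fun _ => 1} : Finset (Fin (k + 1) → Fin 3))ᶜ := by
    ext f
    simp
  rw [h, Finset.card_compl, Finset.card_pair, Fintype.card_fun, Fintype.card_fin, Fintype.card_fin]
  intro h
  exact absurd (congrFun h 0) (by decide)

/-! ### Decomposability in operads generated in arity at most two -/

/-- A factorization of a decorated map that is not trivial over a point. -/
def DMap.Splits {X Y : Type} [Enumerated X] [Enumerated Y] (φ : DMap P X Y) (y : Y) : Prop :=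
  ∃ (Z : Type) (_ : Enumerated Z) (ψ₁ : DMap P X Z) (ψ₂ : DMap P Z Y), ψ₂.comp ψ₁ = φ ∧
    (∀ z, ψ₂.fn z = y → ∃ x, ψ₁.fn x = z) ∧ (∃ z z', z ≠ z' ∧ ψ₂.fn z = y ∧ ψ₂.fn z' = y) ∧
    ∃ x x', x ≠ x' ∧ ψ₁.fn x = ψ₁.fn x' ∧ φ.fn x = y

theorem Enumerates.one_lt {X Y : Type*} {f : X → Y} {y : Y} {m : ℕ} {j : Fin m → X}
    (h : Enumerates f y j) {x x' : X} (hne : x ≠ x') (hx : f x = y) (hx' : f x' = y) : 1 < m := by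
  obtain ⟨t, rfl⟩ := (h.mem_iff _).1 hx
  obtain ⟨t', rfl⟩ := (h.mem_iff _).1 hx'
  by_contra hm
  have : Subsingleton (Fin m) := Fin.subsingleton_iff_le_one.2 (not_lt.1 hm)
  exact hne (congrArg j (Subsingleton.elim _ _))

section

variable {X Y Z : Type} [Enumerated X] [Enumerated Y] [Enumerated Z]

/-- `Splits` is decomposability without coordinates: `z`, `z'` give two blocks, `x`, `x'` a block
with two inputs, and the condition on fibres makes all blocks nonempty. In this form restriction to
fewer inputs is simply composition with an injection. -/
theorem DMap.Splits.decomposable {φ : DMap P X Y} {y : Y} (h : φ.Splits y) {n : ℕ} {j : Fin n → X}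
    {x : P.Op n} (hx : φ.HasDec y j x) : P.Decomposable x := by
  obtain ⟨Z, _, ψ₁, ψ₂, rfl, hs, ⟨z, z', hz, hzy, hzy'⟩, a, a', ha, haa, hay⟩ := h
  obtain ⟨r, i, c, hc⟩ := ψ₂.exists_dec y
  choose m J d hd using fun k => ψ₁.exists_dec (i k)
  have h1 := hc.comp hd
  obtain ⟨e, he⟩ := h1.enumerates.exists_equiv hx.enumerates fun _ => Iff.rfl
  refine ⟨r, m, c, d, e, ?_, hc.enumerates.one_lt hz hzy hzy', ?_, fun k => ?_⟩
  · have h2 := h1.reindex e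
    rw [he] at h2
    exact hx.unique h2
  · rw [DMap.fn_comp_apply] at hay
    obtain ⟨k, hk⟩ := (hc.enumerates.mem_iff _).1 hay
    exact ⟨k, (hd k).enumerates.one_lt ha hk.symm (haa.symm.trans hk.symm)⟩
  · obtain ⟨b, hb⟩ := hs _ (hc.enumerates.apply k)
    obtain ⟨t, -⟩ := ((hd k).enumerates.mem_iff b).1 hb
    exact t.pos

theorem DMap.HasDec.splits {φ : DMap P X Y} {y : Y} {n : ℕ} {j : Fin n → X} {x : P.Op n}
    (hx : φ.HasDec y j x) (h : P.Decomposable x) : φ.Splits y := by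
  obtain ⟨r, m, c, d, e, rfl, hr, ⟨k₀, hk₀⟩, hk⟩ := h
  have hy' := hx.reindex e.symm
  rw [SymSeq.reindex_trans, Equiv.symm_trans_self, SymSeq.reindex_refl] at hy'
  obtain ⟨ψ₁, ψ₂, e, h2l, h2r, h1l, h1r, -⟩ := hy'.exists_factor
  refine ⟨_, _, ψ₁, ψ₂, e, ?_, ⟨Sum.inr ⟨0, by omega⟩, Sum.inr ⟨1, hr⟩, ?_, h2r _, h2r _⟩, ?_⟩
  · rintro (b | k) h
    · exact (b.2 ((h2l b).symm.trans h)).elim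
    · exact ⟨_, (h1r k).enumerates.apply ⟨0, hk k⟩⟩
  · intro h
    simpa using Sum.inr_injective h
  · have h1 := (h1r k₀).enumerates.apply ⟨0, by omega⟩
    refine ⟨_, _, ?_, h1.trans ((h1r k₀).enumerates.apply ⟨1, hk₀⟩).symm, ?_⟩
    · intro h
      simpa using (h1r k₀).enumerates.injective h
    · rw [← e, DMap.fn_comp_apply, h1, h2r]

/-- All restrictions to at least three points of the fibre split. -/
def DMap.SplitsStably (φ : DMap P X Y) (y : Y) : Prop :=
  ∀ (X' : Type) [Enumerated X'] (i : X' → X) (hi : Function.Injective i),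
    3 ≤ Nat.card {x' // φ.fn (i x') = y} → (φ.comp (DMap.incl P i hi)).Splits y

theorem DMap.HasDec.splitsStably_of_le_two {φ : DMap P X Y} {y : Y} {n : ℕ} {j : Fin n → X}
    {x : P.Op n} (h : φ.HasDec y j x) (hn : n ≤ 2) : φ.SplitsStably y := by
  intro X' _ i hi hc
  have h1 : Nat.card {x' // φ.fn (i x') = y} ≤ Nat.card {x // φ.fn x = y} :=
    Nat.card_le_card_of_injective (fun x => ⟨i x.1, x.2⟩) fun x x' hx =>
      Subtype.ext (hi (congrArg Subtype.val hx))
  rw [h.enumerates.card] at h1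
  omega

/-- After restriction to at least three points over `y` there are three possibilities: the composite
itself is a nontrivial splitting, or all blocks are single points and the outer map splits, or there
is only one block and the inner map splits. -/
theorem DMap.SplitsStably.comp {ψ₁ : DMap P X Z} {ψ₂ : DMap P Z Y} {y : Y}
    (h1 : ∀ z, ψ₂.fn z = y → ψ₁.SplitsStably z) (h2 : ψ₂.SplitsStably y) :
    (ψ₂.comp ψ₁).SplitsStably y := by
  intro X' _ i hi hc
  -- Blocks emptied by the restriction are dropped, so that the map `χ` onto the remaining ones is
  -- surjective.
  let T : Set Z := Set.range (ψ₁.fn ∘ i)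
  obtain ⟨χ, hχ, hχ'⟩ := (ψ₁.comp (DMap.incl P i hi)).exists_lift (fun z : T => (z : Z))
    Subtype.val_injective (fun x => ⟨ψ₁.fn (i x), x, rfl⟩) (by rw [DMap.fn_comp_incl]; rfl)
  have hχs : Function.Surjective χ.fn := by
    rw [hχ]
    rintro ⟨_, x, rfl⟩
    exact ⟨x, rfl⟩
  set ψ := ψ₂.comp (DMap.incl P (fun z : T => (z : Z)) Subtype.val_injective) with hψ
  have hφ : (ψ₂.comp ψ₁).comp (DMap.incl P i hi) = ψ.comp χ := by
    rw [DMap.comp_assoc, ← hχ', hψ, DMap.comp_assoc]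
  have hfib : ∀ x, (ψ₂.comp ψ₁).fn (i x) = ψ.fn (χ.fn x) := fun x => by
    rw [← DMap.fn_comp_apply, ← hφ, DMap.fn_comp_incl]; rfl
  rw [hφ]
  simp only [hfib] at hc
  by_cases hz : ∃ z z', z ≠ z' ∧ ψ.fn z = y ∧ ψ.fn z' = y
  · by_cases hx : ∃ x x', x ≠ x' ∧ χ.fn x = χ.fn x' ∧ (ψ.comp χ).fn x = y
    · exact ⟨_, _, χ, ψ, rfl, fun z _ => hχs z, hz, hx⟩
    -- All blocks over `y` are single points: at least three middle points survive there, and a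
    -- splitting of the restricted outer map is preceded by `χ`.
    · have hinj : ∀ x x', χ.fn x = χ.fn x' → ψ.fn (χ.fn x) = y → x = x' := fun x x' h h' => by
        by_contra hne
        exact hx ⟨x, x', hne, h, by rwa [DMap.fn_comp_apply]⟩
      have hcard : Nat.card {x // ψ.fn (χ.fn x) = y} = Nat.card {z : T // ψ₂.fn z = y} := by
        have e : ∀ z : T, ψ.fn z = ψ₂.fn z := fun z => by rw [hψ, DMap.fn_comp_incl]; rfl
        refine Nat.card_congr (Equiv.ofBijective (fun x => ⟨χ.fn x.1, (e _).symm.trans x.2⟩) ⟨?_, ?_⟩)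
        · intro x x' h
          exact Subtype.ext (hinj _ _ (congrArg Subtype.val h) x.2)
        · rintro ⟨z, hz⟩
          obtain ⟨x, rfl⟩ := hχs z
          exact ⟨⟨x, (e _).trans hz⟩, rfl⟩
      rw [hcard] at hc
      obtain ⟨W, _, a, b, hab, hb, hw, z, z', hne, hzz, hzy⟩ := h2 T _ Subtype.val_injective hc
      obtain ⟨x, rfl⟩ := hχs z
      obtain ⟨x', rfl⟩ := hχs z'
      refine ⟨W, _, a.comp χ, b, ?_, fun w hw => ?_, hw, x, x', fun h => hne (by rw [h]), ?_, ?_⟩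
      · rw [← DMap.comp_assoc, hab]
      · obtain ⟨z, rfl⟩ := hb w hw
        obtain ⟨x, rfl⟩ := hχs z
        exact ⟨x, DMap.fn_comp_apply _ _ _⟩
      · rw [DMap.fn_comp_apply, DMap.fn_comp_apply, hzz]
      · rw [DMap.fn_comp_apply]
        exact hzy
  -- Only one middle point lies over `y`: the whole surviving fibre sits over it, and a splitting of
  -- the restricted inner map is followed by `ψ`.
  · have hpos : 0 < Nat.card {x // ψ.fn (χ.fn x) = y} := by omega
    obtain ⟨⟨x₀, hx₀⟩⟩ := (Nat.card_pos_iff.1 hpos).1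
    have huniq : ∀ z, ψ.fn z = y ↔ z = χ.fn x₀ := fun z => by
      refine ⟨fun h => ?_, fun h => by rw [h, hx₀]⟩
      by_contra hne
      exact hz ⟨_, _, hne, h, hx₀⟩
    have hzy : ψ₂.fn (χ.fn x₀ : T) = y := by
      rw [hψ, DMap.fn_comp_incl] at hx₀
      exact hx₀
    have hx1 : ∀ x, ψ₁.fn (i x) = (χ.fn x : T) := fun x => by rw [hχ]
    have e1 : ∀ x, ψ.fn (χ.fn x) = y ↔ ψ₁.fn (i x) = (χ.fn x₀ : T) := fun x => by
      rw [huniq, hx1, Subtype.ext_iff]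
    simp only [e1] at hc
    have hs : χ.Splits (χ.fn x₀) := by
      obtain ⟨m, j, x, hx⟩ := χ.exists_dec (χ.fn x₀)
      refine hx.splits ((h1 _ hzy X' i hi hc).decomposable (j := j) ?_)
      rw [← hχ']
      exact (DMap.hasDec_incl_comp_iff (i := fun z : T => (z : Z)) Subtype.val_injective).2 hx
    obtain ⟨W, _, a, b, hab, hb, ⟨w, w', hww, hw, hw'⟩, x, x', hne, hxx, hxz⟩ := hs
    refine ⟨W, _, a, ψ.comp b, ?_, fun w hw => hb w ?_, ⟨w, w', hww, ?_, ?_⟩, x, x', hne, hxx, ?_⟩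
    · rw [DMap.comp_assoc, hab]
    · rwa [DMap.fn_comp_apply, huniq] at hw
    · rw [DMap.fn_comp_apply, hw, hx₀]
    · rw [DMap.fn_comp_apply, hw', hx₀]
    · rw [DMap.fn_comp_apply, hxz, hx₀]

end

/-- Operations of arity at least three in an operad generated by operations of arity at most two. -/
theorem BinaryGenerated.decomposable (h : BinaryGenerated P) {n : ℕ} (hn : 3 ≤ n) (ω : P.Op n) :
    P.Decomposable ω := by
  -- Decomposability alone would not pass through `γ`, whose arguments may have arity `0` or `1`;
  -- stability under restriction repairs this. In arity at most two the condition is vacuous.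
  have H := h (fun n => {ω | ∀ (X Y : Type) [Enumerated X] [Enumerated Y] (φ : DMap P X Y) (y : Y)
    (j : Fin n → X), φ.HasDec y j ω → φ.SplitsStably y}) ?_ ?_ ?_ ?_ ?_ n ω
  -- The operation is realized as the decoration of the map to a point, and the trivial restriction
  -- is used.
  · have he : Enumerates (fun _ : Fin n => (0 : Fin 1)) 0 id :=
      ⟨Function.injective_id, fun x => ⟨fun _ => ⟨x, rfl⟩, fun _ => rfl⟩⟩
    obtain ⟨φ, hφ, hd⟩ := DMap.exists_of_hasDec (P := P) (fun _ : Fin n => (0 : Fin 1))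
      (fun _ => n) (fun _ => id) (fun y => by rw [Subsingleton.elim y 0]; exact he) fun _ => ω
    have h1 := H _ _ φ 0 id (hd 0) _ id Function.injective_id (hn.trans_eq (hd 0).enumerates.card.symm)
    rw [DMap.comp_incl_id _ _ rfl] at h1
    exact h1.decomposable (hd 0)
  case refine_1 => exact fun X Y _ _ φ y j hj => hj.splitsStably_of_le_two (by omega)
  case refine_2 => exact fun ω X Y _ _ φ y j hj => hj.splitsStably_of_le_two (by omega)
  case refine_3 => exact fun ω X Y _ _ φ y j hj => hj.splitsStably_of_le_two le_rfl
  · intro n ω σ hω X Y _ _ φ y j hj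
    have h1 := hj.reindex σ.symm
    rw [← SymSeq.reindex_perm, SymSeq.reindex_trans, Equiv.symm_trans_self, SymSeq.reindex_refl] at h1
    exact hω X Y φ y _ h1
  · intro n m c d hc hd X Y _ _ φ y j hj
    obtain ⟨ψ₁, ψ₂, e, h2l, h2r, h1l, h1r, h2⟩ := hj.exists_factor
    rw [← e]
    refine DMap.SplitsStably.comp (fun z hz => ?_) (hc _ _ ψ₂ y _ h2)
    obtain ⟨k, rfl⟩ := (h2.enumerates.mem_iff z).1 hz
    exact hd k _ _ ψ₁ _ _ (h1r k)

/-! ### The seven-term relation -/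

theorem UnitaryOperad.γ_units (P : UnitaryOperad.{u}) {n : ℕ} (α : P.Op n) {m : Fin n → ℕ}
    (hm : ∀ l, m l = 1) (d : ∀ l, P.Op (m l)) (hd : ∀ l, d l = P.reindex (finCongr (hm l)) P.one)
    (h : n = ∑ l, m l) : P.reindex (finCongr h) (P.γ m α d) = α := by
  obtain rfl : m = fun _ => 1 := funext hm
  obtain rfl : d = fun _ => P.one := funext fun l => (hd l).trans (P.reindex_refl _)
  rw [P.γ_one, SymSeq.reindex_trans]
  exact P.reindex_refl _

theorem UnitaryOperad.plugZeros_empty (P : UnitaryOperad.{u}) {n : ℕ} (α : P.Op n)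
    (h : n + (∅ : Finset (Fin n)).card = n) : P.plugZeros α ∅ n h = α :=
  P.γ_units α (fun l => if_neg (Finset.notMem_empty l)) _
    (fun l => dif_neg (Finset.notMem_empty l)) _

theorem tau_val {n : ℕ} (i : Fin n) (x : Fin (n + 1)) :
    (tau i x : ℕ) = if (x : ℕ) = i then (i : ℕ) + 1 else if (x : ℕ) = i + 1 then (i : ℕ) else x := by
  simp only [tau, Equiv.swap_apply_def, Fin.ext_iff, Fin.val_castSucc, Fin.val_succ]
  split_ifs <;> simp

theorem opI_single_one {n : ℕ} (j : Fin n) : M.opI (P.single j P.one) = AddMonoidHom.id _ := by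
  have h : P.single j P.one = fun _ => P.one := Function.update_eq_self j _
  rw [h]
  exact M.pull_id n

theorem opI_single {n : ℕ} (j : Fin n) (x : P.Op 1) :
    M.opI (P.single j x) = M.opH (p := 0) rfl j x := (M.opH_zero j x).symm

theorem opI_double {N : ℕ} (i : Fin N) (x y : P.Op 1) : M.opI (P.double i x y) =
    (M.opI (P.single i.castSucc x)).comp (M.opI (P.single i.succ y)) := by
  have hne : i.castSucc ≠ i.succ := i.castSucc_lt_succ.ne
  have h : (VHom.unary P (P.double i x y)).toD =
      (VHom.unary P (P.single i.succ y)).toD.comp (VHom.unary P (P.single i.castSucc x)).toD := by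
    refine DMap.ext_hasDec rfl fun z => ⟨1, _, _, unary_hasDec _ z, ?_⟩
    by_cases hz : z = i.succ
    · subst hz
      have h1 := unary_hasDec (P.single i.castSucc x) i.succ
      rw [UnitaryOperad.single, Function.update_of_ne hne.symm] at h1
      have h2 := (unary_hasDec (P.single i.succ y) i.succ).comp_of_one_right fun _ => h1
      rw [UnitaryOperad.single, Function.update_self] at h2
      rwa [UnitaryOperad.double, Function.update_self]
    · have h1 := unary_hasDec (P.single i.succ y) z
      rw [UnitaryOperad.single, Function.update_of_ne hz] at h1
      rw [UnitaryOperad.double, Function.update_of_ne hz]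
      exact h1.comp_of_one_left (unary_hasDec (P.single i.castSucc x) z)
  rw [opI_eq_pl, opI_eq_pl, opI_eq_pl, h]
  exact M.pl_comp (φ := (VHom.unary P (P.single i.castSucc x)).toD) Function.surjective_id _

/-- The parametrization and the top map enter only through their values as natural numbers, which
leaves linear arithmetic in each of the seven cases. -/
theorem Janus.PermInverse.cornerTerm_eq_of_comp (hM : M.PermInverse) {N k : ℕ} (i : Fin N)
    (U : LongIndex k) (α : P.Op (k + 1)) {p q a : ℕ} (ha : a = N + 1 + q + p)
    (hp : p + 1 + U.1.1.card = k + 1) (hq : q + 1 + U.1.2.card = k + 1) (e : Fin a → ℕ)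
    (he : ∀ x y : Fin a, x < y → e x < e y) (he' : ∀ x, e x < N + 1 + 2 * k)
    (hc : ∀ x, (⟨e x, he' x⟩ : Fin (N + 1 + 2 * k)) ∉ U.columns i) (f : Fin a → Fin (N + k))
    (hf : ∀ x, (f x : ℕ) = if e x ≤ i + k then e x else e x - (k + 1)) {β : P.Op (p + 1)}
    {β' : P.Op (q + 1)} (hβ : P.plugZeros α U.1.1 (p + 1) hp = β)
    (hβ' : P.plugZeros α U.1.2 (q + 1) hq = β') :
    M.cornerTerm i U α = (M.ps f).comp ((M.opH (p := p) ha (i.castSucc.castAdd q) β).comp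
      (M.opH (p := q) rfl i.succ β')) := by
  subst hβ hβ'
  have hm : StrictMono fun x => (⟨e x, he' x⟩ : Fin (N + 1 + 2 * k)) := fun x y hxy => he x y hxy
  -- The image avoids the columns and has the right number of elements, so it is the full
  -- complement.
  have h1 : Finset.univ.image (fun x => (⟨e x, he' x⟩ : Fin (N + 1 + 2 * k))) = (U.columns i)ᶜ := by
    refine Finset.eq_of_subset_of_card_le (fun x hx => ?_) ?_
    · obtain ⟨t, -, rfl⟩ := Finset.mem_image.1 hx
      exact Finset.mem_compl.2 (hc t)
    · rw [Finset.card_image_of_injective _ hm.injective, U.card_compl_columns, Finset.card_univ,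
        Fintype.card_fin]
      omega
  rw [hM.cornerTerm_eq i U α ha hp hq hm fun x => ?_]
  · congr 2
    funext x
    exact Fin.ext (hf x).symm
  · rw [← Finset.mem_compl, ← h1]
    simp

/-- The order of the summands is the one in `SevenTerm`. -/
theorem sum_longIndex_one {G : Type*} [AddCommMonoid G] (F : LongIndex 1 → G) :
    ∑ U, F U = F ⟨(∅, ∅), by decide⟩ + F ⟨({0}, ∅), by decide⟩ + F ⟨(∅, {0}), by decide⟩ +
      F ⟨({1}, ∅), by decide⟩ + F ⟨(∅, {1}), by decide⟩ + F ⟨({1}, {0}), by decide⟩ +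
      F ⟨({0}, {1}), by decide⟩ := by
  have h : (Finset.univ : Finset (LongIndex 1)) = {⟨(∅, ∅), by decide⟩, ⟨({0}, ∅), by decide⟩,
      ⟨(∅, {0}), by decide⟩, ⟨({1}, ∅), by decide⟩, ⟨(∅, {1}), by decide⟩, ⟨({1}, {0}), by decide⟩,
      ⟨({0}, {1}), by decide⟩} := by decide
  rw [h, Finset.sum_insert (by decide), Finset.sum_insert (by decide), Finset.sum_insert (by decide),
    Finset.sum_insert (by decide), Finset.sum_insert (by decide), Finset.sum_insert (by decide),
    Finset.sum_singleton]
  simp only [add_assoc]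

section

variable {N : ℕ} (i : Fin N) (α : P.Op 2)

/-- For `k = 1` the interleaving permutation only exchanges the two middle columns, so it is a
neighbouring transposition. -/
theorem cornerTerm_zero_zero (hM : M.PermInverse) : M.cornerTerm i ⟨(∅, ∅), by decide⟩ α =
    (M.opP (a := N + 2) rfl i.succ).comp ((M.opP (a := N + 3) rfl i.castSucc.castSucc).comp
      ((M.opT i.succ.castSucc).comp ((M.opH (a := N + 3) (p := 1) rfl i.castSucc.castSucc α).comp
        (M.opH (a := N + 2) (p := 1) rfl i.succ α)))) := by
  rw [hM.cornerTerm_eq_of_comp i ⟨(∅, ∅), by decide⟩ α (p := 1) (q := 1) (a := N + 3) rfl rfl rfl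
    (fun x => x)
    (fun _ _ h => h) (fun x => x.2)
    (fun x => by simp [LongIndex.columns])
    (collapse (a := N + 2) (p := 1) rfl i.succ ∘ collapse (a := N + 3) (p := 1) rfl i.castSucc.castSucc ∘
      tau i.succ.castSucc) (fun x => by
      have h1 := tau_val i.succ.castSucc x
      have h2 := collapse_val (a := N + 3) (p := 1) rfl i.castSucc.castSucc (tau i.succ.castSucc x)
      rw [Function.comp_apply, Function.comp_apply, collapse_val]
      generalize collapse (a := N + 3) (p := 1) rfl i.castSucc.castSucc (tau i.succ.castSucc x) = z
        at h2 ⊢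
      generalize tau i.succ.castSucc x = y at h1 h2
      simp only [Fin.val_succ, Fin.val_castSucc] at h1 h2 ⊢
      split_ifs at h1 h2 ⊢ <;> omega) (P.plugZeros_empty α _) (P.plugZeros_empty α _),
    M.ps_comp ((collapse_surjective _ _).comp (Equiv.surjective _)),
    M.ps_comp (Equiv.surjective _), ← opP_eq_ps, ← opP_eq_ps, ← opT_eq_ps]
  rfl

/-- The remaining columns `i + 1`, `i + 2`, `i + 3` have top values `i + 1`, `i`, `i + 1`: the first
two are exchanged, then the last two are glued. The other cases are read off in the same way. -/
theorem cornerTerm_left_zero (hM : M.PermInverse) : M.cornerTerm i ⟨({0}, ∅), by decide⟩ α =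
    (M.opP (a := N + 2) rfl i.succ).comp ((M.opT i.castSucc).comp
      ((M.opI (P.single i.castSucc.castSucc (P.zeroLeft α))).comp (M.opH (a := N + 2) (p := 1) rfl i.succ α))) := by
  rw [hM.cornerTerm_eq_of_comp i ⟨({0}, ∅), by decide⟩ α (p := 0) (q := 1) (a := N + 2) rfl rfl rfl
    (fun x => if (x : ℕ) < i then x else x + 1)
    (fun x y h => by rw [Fin.lt_def] at h; split_ifs <;> omega) (fun x => by split_ifs <;> omega)
    (fun x => by simp [LongIndex.columns, Fin.ext_iff]; split_ifs <;> omega)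
    (collapse (a := N + 2) (p := 1) rfl i.succ ∘ tau i.castSucc) (fun x => by
      simp only [Function.comp_apply, collapse_val, tau_val, Fin.val_succ, Fin.val_castSucc]
      split_ifs <;> omega) rfl (P.plugZeros_empty α _),
    M.ps_comp (Equiv.surjective _), ← opP_eq_ps, ← opT_eq_ps, opI_single]
  rfl

theorem cornerTerm_right_zero (hM : M.PermInverse) : M.cornerTerm i ⟨(∅, {0}), by decide⟩ α =
    (M.opP (a := N + 2) rfl i.succ).comp ((M.opH (a := N + 2) (p := 1) rfl i.castSucc α).comp
      (M.opI (P.single i.succ (P.zeroLeft α)))) := by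
  rw [hM.cornerTerm_eq_of_comp i ⟨(∅, {0}), by decide⟩ α (p := 1) (q := 0) (a := N + 2) rfl rfl rfl
    (fun x => if (x : ℕ) < i + 2 then x else x + 1)
    (fun x y h => by rw [Fin.lt_def] at h; split_ifs <;> omega) (fun x => by split_ifs <;> omega)
    (fun x => by simp [LongIndex.columns, Fin.ext_iff]; split_ifs <;> omega)
    (collapse (a := N + 2) (p := 1) rfl i.succ) (fun x => by
      simp only [collapse_val, Fin.val_succ]
      split_ifs <;> omega) (P.plugZeros_empty α _) rfl,
    ← opP_eq_ps, opI_single]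
  rfl

theorem cornerTerm_left_one (hM : M.PermInverse) : M.cornerTerm i ⟨({1}, ∅), by decide⟩ α =
    (M.opP (a := N + 2) rfl i.castSucc).comp
      ((M.opI (P.single i.castSucc.castSucc (P.zeroRight α))).comp (M.opH (a := N + 2) (p := 1) rfl i.succ α)) := by
  rw [hM.cornerTerm_eq_of_comp i ⟨({1}, ∅), by decide⟩ α (p := 0) (q := 1) (a := N + 2) rfl rfl rfl
    (fun x => if (x : ℕ) < i + 1 then x else x + 1)
    (fun x y h => by rw [Fin.lt_def] at h; split_ifs <;> omega) (fun x => by split_ifs <;> omega)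
    (fun x => by simp [LongIndex.columns, Fin.ext_iff]; split_ifs <;> omega)
    (collapse (a := N + 2) (p := 1) rfl i.castSucc) (fun x => by
      simp only [collapse_val, Fin.val_castSucc]
      split_ifs <;> omega) rfl (P.plugZeros_empty α _),
    ← opP_eq_ps, opI_single]
  rfl

theorem cornerTerm_right_one (hM : M.PermInverse) : M.cornerTerm i ⟨(∅, {1}), by decide⟩ α =
    (M.opP (a := N + 2) rfl i.castSucc).comp ((M.opT i.succ).comp
      ((M.opH (a := N + 2) (p := 1) rfl i.castSucc α).comp (M.opI (P.single i.succ (P.zeroRight α))))) := by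
  rw [hM.cornerTerm_eq_of_comp i ⟨(∅, {1}), by decide⟩ α (p := 1) (q := 0) (a := N + 2) rfl rfl rfl
    (fun x => if (x : ℕ) < i + 3 then x else x + 1)
    (fun x y h => by rw [Fin.lt_def] at h; split_ifs <;> omega) (fun x => by split_ifs <;> omega)
    (fun x => by simp [LongIndex.columns, Fin.ext_iff]; split_ifs <;> omega)
    (collapse (a := N + 2) (p := 1) rfl i.castSucc ∘ tau i.succ) (fun x => by
      simp only [Function.comp_apply, collapse_val, tau_val, Fin.val_succ, Fin.val_castSucc]
      split_ifs <;> omega) (P.plugZeros_empty α _) rfl,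
    M.ps_comp (Equiv.surjective _), ← opP_eq_ps, ← opT_eq_ps, opI_single]
  rfl

theorem cornerTerm_one_zero (hM : M.PermInverse) : M.cornerTerm i ⟨({1}, {0}), by decide⟩ α =
    M.opI (P.double i (P.zeroRight α) (P.zeroLeft α)) := by
  rw [hM.cornerTerm_eq_of_comp i ⟨({1}, {0}), by decide⟩ α (p := 0) (q := 0) (a := N + 1) rfl rfl rfl
    (fun x => if (x : ℕ) < i + 1 then x else x + 2)
    (fun x y h => by rw [Fin.lt_def] at h; split_ifs <;> omega) (fun x => by split_ifs <;> omega)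
    (fun x => by simp [LongIndex.columns, Fin.ext_iff]; split_ifs <;> omega)
    id (fun x => by
      simp only [id]
      split_ifs <;> omega) rfl rfl, opI_double, M.ps_id rfl, opI_single, opI_single]
  rfl

theorem cornerTerm_zero_one (hM : M.PermInverse) : M.cornerTerm i ⟨({0}, {1}), by decide⟩ α =
    (M.opT i).comp (M.opI (P.double i (P.zeroLeft α) (P.zeroRight α))) := by
  rw [hM.cornerTerm_eq_of_comp i ⟨({0}, {1}), by decide⟩ α (p := 0) (q := 0) (a := N + 1) rfl rfl rfl
    (fun x => if (x : ℕ) < i then x else if (x : ℕ) < i + 2 then x + 1 else x + 2)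
    (fun x y h => by rw [Fin.lt_def] at h; split_ifs <;> omega) (fun x => by split_ifs <;> omega)
    (fun x => by simp [LongIndex.columns, Fin.ext_iff]; split_ifs <;> omega)
    (tau i) (fun x => by
      simp only [tau_val]
      split_ifs <;> omega) rfl rfl, opI_double, ← opT_eq_ps, opI_single, opI_single]
  rfl

end

theorem Janus.PermInverse.sevenTerm_iff (hM : M.PermInverse) {N : ℕ} (i : Fin N) (α : P.Op 2) :
    SevenTerm M i α ↔ (M.opH (a := N + 1) (p := 1) rfl i α).comp (M.opP (a := N + 1) rfl i) =
      ∑ U : LongIndex 1, M.cornerTerm i U α := by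
  rw [sum_longIndex_one, cornerTerm_zero_zero i α hM, cornerTerm_left_zero i α hM,
    cornerTerm_right_zero i α hM, cornerTerm_left_one i α hM, cornerTerm_right_one i α hM,
    cornerTerm_one_zero i α hM, cornerTerm_zero_one i α hM]
  rfl

/-- The presentation of pseudo-Mackey functors, for an operad generated by binary operations. -/
theorem isPseudoMackey_iff_shortRelations (hP : BinaryGenerated P) : IsPseudoMackey M ↔
    ShortRelations M ∧ ∀ (N : ℕ) (i : Fin N) (α : P.Op 2), SevenTerm M i α := by
  constructor
  · intro h
    have hM := h.permInverse
    exact ⟨⟨hM.tau, h.unaryRelation, fun i j α => h.lt i j α, fun i j α => h.gt i j α⟩,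
      fun N i α => (hM.sevenTerm_iff i α).2 (h.eq i α)⟩
  · rintro ⟨h, h7⟩
    have hM := Janus.permInverse_of_tau fun i => (h.rel_T i).1
    refine hM.isPseudoMackey h.rel_I fun k hk => ?_
    rcases hk.eq_or_lt with rfl | hk
    · exact Or.inl (hM.blockFormula (fun i j α => h.rel_lt i j α) (fun i j α => h.rel_gt i j α)
        fun i α => (hM.sevenTerm_iff i α).1 (h7 _ i α))
    -- For `k ≥ 2` the arity is at least three, and no relation is needed.
    · exact Or.inr fun ω => hP.decomposable (by omega) ω

theorem sevenTerm_iff_unital (h : ∀ α : P.Op 2, P.zeroLeft α = P.one ∧ P.zeroRight α = P.one) {N : ℕ}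
    (i : Fin N) (α : P.Op 2) : SevenTerm M i α ↔ SevenTermUnital M i α := by
  rw [SevenTerm, SevenTermUnital, (h α).1, (h α).2]
  simp only [opI_single_one, AddMonoidHom.id_comp, AddMonoidHom.comp_id]

end PMack

theorem mainTheorem10 (P : PMack.UnitaryOperad.{u}) (M : PMack.Janus.{u, v} P) :
    (PMack.IsPseudoMackey M ↔ PMack.Relations M) ∧
    (∀ k : ℕ, Fintype.card (PMack.LongIndex k) = 3 ^ (k + 1) - 2) ∧
    (PMack.BinaryGenerated P →
      (PMack.IsPseudoMackey M ↔ PMack.ShortRelations M ∧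
        ∀ (N : ℕ) (i : Fin N) (α : P.Op 2), PMack.SevenTerm M i α)) ∧
    (PMack.BinaryGenerated P →
      (∀ α : P.Op 2, P.zeroLeft α = P.one ∧ P.zeroRight α = P.one) →
      (PMack.IsPseudoMackey M ↔ PMack.ShortRelations M ∧
        ∀ (N : ℕ) (i : Fin N) (α : P.Op 2), PMack.SevenTermUnital M i α)) := by
  refine ⟨PMack.isPseudoMackey_iff_relations, PMack.LongIndex.card,
    PMack.isPseudoMackey_iff_shortRelations, fun hP h => ?_⟩
  rw [PMack.isPseudoMackey_iff_shortRelations hP]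
  refine and_congr_right fun _ => forall_congr' fun N => forall_congr' fun i => forall_congr' fun α => ?_
  exact PMack.sevenTerm_iff_unital h i α
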